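/- Theorem 2. Consider $n\ge 1$ agents, a closed convex set $\mathbb{X}\subseteq\mathbb{R}^p$ ($p\ge1$), local loss functions $l_{i,t}:\mathbb{X}\to\mathbb{R}$ and local constraint functions $c_{i,t}:\mathbb{X}\to\mathbb{R}^{m_i}$, $i\in[n]=\{1,\dots,n\}$, $t\in\mathbb{N}_+$ (fixed sequences, i.e. not depending on the random directions below), all convex (the $c_{i,t}$ componentwise). Let $r,R,F_1,F_2,\mu>0$, $\omega\in(0,1)$, $B\in\mathbb{N}_+$ be constants such that: (a) $r\,\mathbb{B}^p\subseteq\mathbb{X}\subseteq R\,\mathbb{B}^p$, where $\mathbb{B}^p$ is the closed unit ball; $|l_{i,t}(x)|\le F_1$ and $\|c_{i,t}(x)\|\le F_1$ on $\mathbb{X}$; at every $x\in\mathbb{X}$ there are subgradients $\partial l_{i,t}(x)$, $\partial c_{i,t}(x)$ (relative to $\mathbb{X}$) with $\|\partial l_{i,t}(x)\|\le F_2$ and $\|\partial c_{i,t}(x)\|\le F_2$. (b) The communication graphs $\mathcal{G}_t=([n],\mathcal{E}_t)$ are directed, and $W_t\in\mathbb{R}^{n\times n}$ is (entrywise nonnegative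 and) doubly stochastic with $[W_t]_{ij}\ge\omega$ whenever $(j,i)\in\mathcal{E}_t$ or $i=j$; for every $t\ge1$ the graph $([n],\bigcup_{s=0}^{B-1}\mathcal{E}_{t+s})$ is strongly connected. (c) The local losses are $\mu$-strongly convex: $l_{i,t}(x)\ge l_{i,t}(y)+\langle x-y,\partial l_{i,t}(y)\rangle+\frac{\mu}{2}\|x-y\|^2$ for all $x,y\in\mathbb{X}$. Let $g_1\in(0,1)$, $g_2\in(0,g_1/4)$, $g_3\in(g_2,(g_1-2g_2)/2)$ and $$\alpha_t=\frac{r^2}{20p^2F_1^2(t+1)^{g_1}},\quad \beta_t=\frac{2}{t^{g_2}},\quad \gamma_t=\frac{1}{t^{1-g_2}},\quad \xi_t=\frac1{(t+1)^{g_3}},\quad \delta_t=\frac{r}{(t+1)^{g_3}}.$$ Let $u_{i,t}$ ($i\in[n]$, $t\in\mathbb{N}_+$) be independent and uniformly distributed on the unit sphere of $\mathbb{R}^p$. Let $\{x_{i,t}\}$ be generated by Algorithm 1: start from arbitrary deterministic $e_{i,1}\in(1-\xi_1)\mathbb{X}$, $x_{i,1}=e_{i,1}+\delta_1u_{i,1}$,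 $q_{i,1}=0\in\mathbb{R}^{m_i}$, and for $t\ge1$ put $$z_{i,t+1}=\sum_{j=1}^n[W_t]_{ij}e_{j,t},\qquad \hat\omega_{i,t+1}=\frac{p}{\delta_t}\,l_{i,t}(x_{i,t})\,u_{i,t}+\frac{p}{\delta_t}\big([c_{i,t}(x_{i,t})]_+^{T}q_{i,t}\big)u_{i,t},$$ $$e_{i,t+1}=\mathcal{P}_{(1-\xi_{t+1})\mathbb{X}}\big(z_{i,t+1}-\alpha_{t+1}\hat\omega_{i,t+1}\big),\qquad x_{i,t+1}=e_{i,t+1}+\delta_{t+1}u_{i,t+1},$$ $$q_{i,t+1}=\big[(1-\beta_{t+1}\gamma_{t+1})q_{i,t}+\gamma_{t+1}[c_{i,t}(x_{i,t})]_+\big]_+,$$ where $\mathcal{P}_K$ is the Euclidean projection onto $K$ and $[\cdot]_+$ the componentwise positive part. Write $l_t=\frac1n\sum_jl_{j,t}$ and $c_t=\mathrm{col}(c_{1,t},\dots,c_{n,t})$. Then there is a constant $C>0$, depending only on $n,p,(m_i)_{i},r,R,F_1,F_2,\omega,B,\mu,g_1,g_2,g_3$, such that for every $T\in\mathbb{N}_+$: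 (i) for every benchmark $(y_1,\dots,y_T)$ with $y_t\in\mathbb{X}$ and $c_t(y_t)\le0$ for all $t\in[T]$, $$\mathbf{E}\Big[\frac1n\sum_{i=1}^n\sum_{t=1}^Tl_t(x_{i,t})-\sum_{t=1}^Tl_t(y_t)\Big]\le C\Big(T^{\max\{1-g_1+2g_2+2g_3,\;1+g_2-g_3\}}+T^{g_1}P_T\Big),\qquad P_T=\sum_{t=1}^{T-1}\|y_{t+1}-y_t\|;$$ (ii) if there is a point $y\in\mathbb{X}$ with $c_t(y)\le0$ for all $t\in[T]$, then $$\mathbf{E}\Big[\frac1n\sum_{i=1}^n\sum_{t=1}^T\big\|[c_t(x_{i,t})]_+\big\|\Big]\le C\,T^{1-g_2/2}.$$ -/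

import Mathlib

open MeasureTheory ProbabilityTheory
open scoped Pointwise BigOperators

/-- Euclidean space `ℝ^d`. -/
abbrev Vec (d : ℕ) : Type := EuclideanSpace ℝ (Fin d)

/-- Componentwise positive part `[v]₊`, the projection of `v` onto the nonnegative orthant. -/
noncomputable def posVec {ι : Type*} (v : EuclideanSpace ℝ ι) : EuclideanSpace ℝ ι :=
  WithLp.toLp 2 (fun k => max (v k) 0)

/-- `v` is the Euclidean projection of `w` onto `K`: `v = argmin_{v' ∈ K} ‖w - v'‖²`. -/
def IsProjection {d : ℕ} (K : Set (Vec d)) (w v : Vec d) : Prop :=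
  v ∈ K ∧ IsMinOn (fun v' => ‖w - v'‖ ^ 2) K v

/-- The uniform probability measure on the unit sphere of `ℝ^p` (normalized surface measure). -/
noncomputable def uniformSphere (p : ℕ) : Measure (Metric.sphere (0 : Vec p) 1) :=
  ((volume : Measure (Vec p)).toSphere Set.univ)⁻¹ • (volume : Measure (Vec p)).toSphere

/-- The data of a distributed online convex optimization problem with `n` agents: the decision set
`X ⊆ ℝ^p`, the local losses `l_{i,t}` and the local constraint functions `c_{i,t}`, where
`t = 1, 2, …`. Only the values on `X` and at times `t ≥ 1` matter. -/
structure OnlineProblem (n p : ℕ) (m : Fin n → ℕ) where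
  X : Set (Vec p)
  loss : Fin n → ℕ → Vec p → ℝ
  con : (i : Fin n) → ℕ → Vec p → Vec (m i)

namespace OnlineProblem

variable {n p : ℕ} {m : Fin n → ℕ}

/-- Global loss `l_t(x) = (1/n) ∑_j l_{j,t}(x)`. -/
noncomputable def globalLoss (P : OnlineProblem n p m) (t : ℕ) (x : Vec p) : ℝ :=
  (1 / (n : ℝ)) * ∑ j, P.loss j t x

/-- Global constraint function `c_t(x) = col(c_{1,t}(x), …, c_{n,t}(x))`. -/
noncomputable def globalCon (P : OnlineProblem n p m) (t : ℕ) (x : Vec p) :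
    EuclideanSpace ℝ ((i : Fin n) × Fin (m i)) :=
  WithLp.toLp 2 (fun k => P.con k.1 t x k.2)

/-- Network regret of the decisions `x` (time, agent) against the benchmark `y_1, …, y_T`. -/
noncomputable def netReg (P : OnlineProblem n p m) (x : ℕ → Fin n → Vec p) (y : ℕ → Vec p)
    (T : ℕ) : ℝ :=
  (1 / (n : ℝ)) * ∑ i, ∑ t ∈ Finset.Icc 1 T, P.globalLoss t (x t i)
    - ∑ t ∈ Finset.Icc 1 T, P.globalLoss t (y t)

/-- Network cumulative constraint violation of the decisions `x`. -/
noncomputable def netCCV (P : OnlineProblem n p m) (x : ℕ → Fin n → Vec p) (T : ℕ) : ℝ :=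
  (1 / (n : ℝ)) * ∑ i, ∑ t ∈ Finset.Icc 1 T, ‖posVec (P.globalCon t (x t i))‖

/-- `(y_1, …, y_T)` is a feasible benchmark: `y_t ∈ X` and `c_t(y_t) ≤ 0` for `t = 1, …, T`. -/
def IsFeasible (P : OnlineProblem n p m) (T : ℕ) (y : ℕ → Vec p) : Prop :=
  ∀ t ∈ Finset.Icc 1 T, y t ∈ P.X ∧ ∀ k, P.globalCon t (y t) k ≤ 0

/-- The standing assumption on the decision set, the losses and the constraint functions.
`dl i t x` and `dc i t x` are the subgradients of `l_{i,t}` and `c_{i,t}` at `x` (relative to `X`).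
The subgradient of the vector function `c_{i,t}`, a matrix whose `k`-th row is a subgradient of
the `k`-th component, is represented by the linear map of that matrix, and its norm is the
operator (spectral) norm. -/
structure IsRegular (P : OnlineProblem n p m) (r R F₁ F₂ : ℝ)
    (dl : Fin n → ℕ → Vec p → Vec p)
    (dc : (i : Fin n) → ℕ → Vec p → (Vec p →L[ℝ] Vec (m i))) : Prop where
  convex_X : Convex ℝ P.X
  ball_subset : Metric.closedBall (0 : Vec p) r ⊆ P.X
  subset_ball : P.X ⊆ Metric.closedBall (0 : Vec p) R
  convex_loss : ∀ i t, 1 ≤ t → ConvexOn ℝ P.X (P.loss i t)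
  convex_con : ∀ i t, 1 ≤ t → ∀ k, ConvexOn ℝ P.X (fun x => P.con i t x k)
  loss_bound : ∀ i t, 1 ≤ t → ∀ x ∈ P.X, |P.loss i t x| ≤ F₁
  con_bound : ∀ i t, 1 ≤ t → ∀ x ∈ P.X, ‖P.con i t x‖ ≤ F₁
  subgrad_loss : ∀ i t, 1 ≤ t → ∀ x ∈ P.X, ∀ y ∈ P.X,
    P.loss i t x + inner ℝ (dl i t x) (y - x) ≤ P.loss i t y
  subgrad_con : ∀ i t, 1 ≤ t → ∀ x ∈ P.X, ∀ y ∈ P.X, ∀ k,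
    P.con i t x k + (dc i t x (y - x)) k ≤ P.con i t y k
  subgrad_loss_bound : ∀ i t, 1 ≤ t → ∀ x ∈ P.X, ‖dl i t x‖ ≤ F₂
  subgrad_con_bound : ∀ i t, 1 ≤ t → ∀ x ∈ P.X, ‖dc i t x‖ ≤ F₂

/-- All local losses are strongly convex on `X` with parameter `μ`. -/
def LossStronglyConvex (P : OnlineProblem n p m) (μ : ℝ)
    (dl : Fin n → ℕ → Vec p → Vec p) : Prop :=
  ∀ i t, 1 ≤ t → ∀ x ∈ P.X, ∀ y ∈ P.X,
    P.loss i t y + inner ℝ (x - y) (dl i t y) + μ / 2 * ‖x - y‖ ^ 2 ≤ P.loss i t x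

end OnlineProblem

/-- The assumption on the time-varying directed graphs `G_t` and their mixing matrices `W_t`.
`(G t).Adj j i` means that agent `i` can receive information from agent `j` at time `t`. -/
structure IsMixingNetwork {n : ℕ} (G : ℕ → Digraph (Fin n)) (W : ℕ → Matrix (Fin n) (Fin n) ℝ)
    (w : ℝ) (B : ℕ) : Prop where
  doubly_stochastic : ∀ t, 1 ≤ t → W t ∈ doublyStochastic ℝ (Fin n)
  weight_ge : ∀ t, 1 ≤ t → ∀ i j, (G t).Adj j i ∨ i = j → w ≤ W t i j
  strongly_connected : ∀ t, 1 ≤ t → ∀ i j,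
    Relation.ReflTransGen (fun a b => ∃ s < B, (G (t + s)).Adj a b) i j

/-- One-point estimator `(p/δ) l(e + δ u) u` of the subgradient of `l` at `e`. -/
noncomputable def lossEstimator {p : ℕ} (δ : ℝ) (l : Vec p → ℝ) (e u : Vec p) : Vec p :=
  ((p : ℝ) / δ) • (l (e + δ • u) • u)

/-- One-point estimator `(p/δ) ([c(e + δ u)]₊)ᵀ ⊗ u`, a `p × d` matrix, of the subgradient of
`[c]₊` at `e`. -/
noncomputable def conEstimator {p d : ℕ} (δ : ℝ) (c : Vec p → Vec d) (e u : Vec p) :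
    Matrix (Fin p) (Fin d) ℝ :=
  ((p : ℝ) / δ) • Matrix.vecMulVec u.ofLp (posVec (c (e + δ • u))).ofLp

/-- The variables `e_{i,t}`, `z_{i,t}`, `ω̂_{i,t}`, `x_{i,t}`, `q_{i,t}` of the algorithm. -/
structure Trajectory (n p : ℕ) (m : Fin n → ℕ) where
  e : ℕ → Fin n → Vec p
  z : ℕ → Fin n → Vec p
  dir : ℕ → Fin n → Vec p
  x : ℕ → Fin n → Vec p
  q : ℕ → (i : Fin n) → Vec (m i)

/-- `S` is the trajectory of the distributed bandit online primal-dual projection algorithm with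
one-point sampling, with parameters `α, β, γ, ξ, δ`, initial points `e₁` and sampled
directions `u` (time, agent). -/
structure IsRun {n p : ℕ} {m : Fin n → ℕ} (P : OnlineProblem n p m)
    (W : ℕ → Matrix (Fin n) (Fin n) ℝ) (α β γ ξ δ : ℕ → ℝ) (e₁ : Fin n → Vec p)
    (u : ℕ → Fin n → Vec p) (S : Trajectory n p m) : Prop where
  init_mem : ∀ i, e₁ i ∈ (1 - ξ 1) • P.X
  init_e : ∀ i, S.e 1 i = e₁ i
  init_x : ∀ i, S.x 1 i = S.e 1 i + δ 1 • u 1 i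
  init_q : ∀ i, S.q 1 i = 0
  step_z : ∀ t, 1 ≤ t → ∀ i, S.z (t + 1) i = ∑ j, W t i j • S.e t j
  step_dir : ∀ t, 1 ≤ t → ∀ i, S.dir (t + 1) i =
    lossEstimator (δ t) (P.loss i t) (S.e t i) (u t i)
      + WithLp.toLp 2
          ((conEstimator (δ t) (P.con i t) (S.e t i) (u t i)).mulVec (S.q t i).ofLp)
  step_e : ∀ t, 1 ≤ t → ∀ i,
    IsProjection ((1 - ξ (t + 1)) • P.X) (S.z (t + 1) i - α (t + 1) • S.dir (t + 1) i)
      (S.e (t + 1) i)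
  step_x : ∀ t, 1 ≤ t → ∀ i, S.x (t + 1) i = S.e (t + 1) i + δ (t + 1) • u (t + 1) i
  step_q : ∀ t, 1 ≤ t → ∀ i, S.q (t + 1) i =
    posVec ((1 - β (t + 1) * γ (t + 1)) • S.q t i
      + γ (t + 1) • posVec (P.con i t (S.x t i)))

/-- The directions `u_{i,t}`, `t = 1, 2, …`, are independent and uniformly distributed on the
unit sphere. -/
structure IsUniformSampling {n p : ℕ} {Ω : Type*} [MeasurableSpace Ω] (Pr : Measure Ω)
    (u : ℕ → Fin n → Ω → Metric.sphere (0 : Vec p) 1) : Prop where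
  meas : ∀ t, 1 ≤ t → ∀ i, Measurable (u t i)
  law : ∀ t, 1 ≤ t → ∀ i, Measure.map (u t i) Pr = uniformSphere p
  indep : iIndepFun (fun k : ℕ × Fin n => u (k.1 + 1) k.2) Pr

/-- Path length `P_T = ∑_{t=1}^{T-1} ‖y_{t+1} - y_t‖`. -/
noncomputable def pathLength {p : ℕ} (y : ℕ → Vec p) (T : ℕ) : ℝ :=
  ∑ t ∈ Finset.Ico 1 T, ‖y (t + 1) - y t‖

/-! The local Lagrangian `l(x) + ⟪q, [c(x)]₊⟫` is convex on `X` because `q ≥ 0`, and it inherits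
strong convexity from the loss. The algorithm is a distributed projected descent on it, with `(p/δ)
L(e + δ u) u` in place of a subgradient.

Estimator. For a Lipschitz `f`, integrate the derivative along `h` by parts against a radial cutoff
of the unit ball and let the cutoff sharpen: `p` times the sphere mean of `f(u) ⟪u, h⟫` is then
bounded through the derivative of `f` along `h` on the ball. Convexity bounds that derivative by
`f(v + h) - f(v)` minus the strong convexity gain. Taking `f(v) = L(e + δ v)` and `h = (y - e)/δ`
gives `lagrangian_sub_le_integral_estimator`: in the mean, the estimator is a strongly convex
subgradient at `e`, up to an error of order `δ` times the Lipschitz constant of `L`. The iterates at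
time `t` depend on past directions only, so independence and Fubini transfer this to expectations
(`integral_lagrangian_sub_le`).

Rates. The multipliers are `O(t^g₂)`, hence the estimator is `O(t^(g₂+g₃))` and a descent step moves
an agent by `O(t^(-(g₁-g₂-g₃)))`. Mixing contracts the disagreement by a fixed factor every `n B`
steps, so it obeys the same rate (`exists_disagreement_bound`). The quadratic error of a step and
the disagreement error are both `O(t^(-g₁+2g₂+2g₃))`; shrinkage and smoothing cost `O(t^(g₂-g₃))`.
The weights `1/(2α)` of the squared distances grow like `t^g₁`, but their increments eventually fall
below `μ/2` and are absorbed by strong convexity; the moving benchmark leaves `T^g₁ P_T`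
(`sum_weighted_dist_sub_le`).

This bounds the expected sum of `penalizedGap`, loss gap plus penalty. For the regret, the
nonnegative penalty is dropped. For the violation, the multipliers are compared with a constant one
of size `V` (`dual_step`): `V` times the violation is at most the sum of the penalties plus `O(V²
T^(1-g₂) + T)`. Loss gaps are at least `-2F₁`, so against a constant benchmark the penalties sum to
`O(T)` in expectation, and `V = T^(g₂/2)` gives `T^(1-g₂/2)`. -/

/-! ### Integration in polar coordinates -/

section Polar

variable {E : Type*} [NormedAddCommGroup E] [NormedSpace ℝ E] [MeasurableSpace E] [BorelSpace E]
  [FiniteDimensional ℝ E]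

/-- Off the origin, polar coordinates turn Haar measure into the product of the sphere measure and
`y^(d-1) dy`, so an angular factor times a radial one integrates to a product. `integral_prod_mul`
needs no integrability, hence `ψ` and `φ` are arbitrary. -/
lemma integral_polar_mul (μ : Measure E) [μ.IsAddHaarMeasure] [Nontrivial E]
    (ψ : E → ℝ) (φ : ℝ → ℝ) :
    ∫ x, ψ (‖x‖⁻¹ • x) * φ ‖x‖ ∂μ
      = (∫ u, ψ (u : E) ∂μ.toSphere)
        * ∫ y in Set.Ioi (0 : ℝ), y ^ (Module.finrank ℝ E - 1) * φ y :=
  calc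
    ∫ x, ψ (‖x‖⁻¹ • x) * φ ‖x‖ ∂μ
      = ∫ x : ({(0)}ᶜ : Set E), ψ (‖x.1‖⁻¹ • x.1) * φ ‖x.1‖ ∂(μ.comap (↑)) := by
      rw [integral_subtype_comap (measurableSet_singleton _).compl
        fun x ↦ ψ (‖x‖⁻¹ • x) * φ ‖x‖, restrict_compl_singleton]
    _ = ∫ x, ψ (x.1 : E) * φ x.2 ∂μ.toSphere.prod (.volumeIoiPow (Module.finrank ℝ E - 1)) := by
      have := μ.measurePreserving_homeomorphUnitSphereProd.integral_comp
        (Homeomorph.measurableEmbedding _)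
        (fun x : Metric.sphere (0 : E) 1 × Set.Ioi (0 : ℝ) => ψ (x.1 : E) * φ x.2)
      simpa using this
    _ = (∫ u, ψ (u : E) ∂μ.toSphere)
          * ∫ x : Set.Ioi (0 : ℝ), φ x ∂.volumeIoiPow (Module.finrank ℝ E - 1) :=
      integral_prod_mul (fun u : Metric.sphere (0 : E) 1 => ψ u)
        (fun x : Set.Ioi (0 : ℝ) => φ x)
    _ = _ := by
      congr 1
      simp only [Measure.volumeIoiPow, ENNReal.ofReal]
      rw [integral_withDensity_eq_integral_smul,
        integral_subtype_comap measurableSet_Ioi fun a ↦ Real.toNNReal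
          (a ^ (Module.finrank ℝ E - 1)) • φ a,
        setIntegral_congr_fun measurableSet_Ioi fun x hx ↦ ?_]
      · rw [NNReal.smul_def, Real.coe_toNNReal _ (pow_nonneg hx.out.le _), smul_eq_mul]
      · exact (measurable_subtype_coe.pow_const _).real_toNNReal

lemma integral_Ioi_pow_mul_indicator (k : ℕ) (hk : 0 < k) {ρ : ℝ} (h0 : 0 ≤ ρ) (h1 : ρ ≤ 1) :
    ∫ y in Set.Ioi (0 : ℝ), y ^ (k - 1) * (Set.Ioo ρ 1).indicator (fun _ => (1 : ℝ)) y
      = (1 - ρ ^ k) / k := by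
  have h2 : ∀ y : ℝ, y ^ (k - 1) * (Set.Ioo ρ 1).indicator (fun _ => (1 : ℝ)) y
      = (Set.Ioo ρ 1).indicator (fun y => y ^ (k - 1)) y := by
    intro y; by_cases hy : y ∈ Set.Ioo ρ 1 <;> simp [hy]
  simp_rw [h2]
  rw [setIntegral_indicator measurableSet_Ioo]
  have h3 : Set.Ioi (0 : ℝ) ∩ Set.Ioo ρ 1 = Set.Ioo ρ 1 := by
    apply Set.inter_eq_right.2
    intro y hy; exact lt_of_le_of_lt h0 hy.1
  rw [h3, ← integral_Ioc_eq_integral_Ioo, ← intervalIntegral.integral_of_le h1, integral_pow]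
  have : k - 1 + 1 = k := by omega
  rw [this]
  have : ((k - 1 : ℕ) : ℝ) + 1 = k := by exact_mod_cast this
  rw [this]; simp

lemma integral_shell (μ : Measure E) [μ.IsAddHaarMeasure] [Nontrivial E]
    (ψ : E → ℝ) {ρ : ℝ} (h0 : 0 ≤ ρ) (h1 : ρ ≤ 1) :
    ∫ x, ψ (‖x‖⁻¹ • x) * (Set.Ioo ρ 1).indicator (fun _ => (1 : ℝ)) ‖x‖ ∂μ
      = (∫ u, ψ (u : E) ∂μ.toSphere)
        * ((1 - ρ ^ Module.finrank ℝ E) / Module.finrank ℝ E) := by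
  rw [integral_polar_mul, integral_Ioi_pow_mul_indicator _ Module.finrank_pos h0 h1]

end Polar

/-! ### A Lipschitz radial cutoff of the unit ball -/

/-- The radial cutoff equal to `1` on the ball of radius `1 - ε` and to `0` off the unit ball. -/
noncomputable def radialCutoff {E : Type*} [NormedAddCommGroup E] (ε : ℝ) (v : E) : ℝ :=
  max 0 (min 1 ((1 - ‖v‖) / ε))

section Cutoff

variable {E : Type*} [NormedAddCommGroup E]

lemma radialCutoff_nonneg (ε : ℝ) (v : E) : 0 ≤ radialCutoff ε v := le_max_left _ _

lemma radialCutoff_le_one (ε : ℝ) (v : E) : radialCutoff ε v ≤ 1 :=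
  max_le zero_le_one (min_le_left _ _)

lemma radialCutoff_of_one_le {ε : ℝ} (hε : 0 < ε) {v : E} (hv : 1 ≤ ‖v‖) :
    radialCutoff ε v = 0 := by
  apply max_eq_left
  exact (min_le_right _ _).trans (div_nonpos_of_nonpos_of_nonneg (by linarith) hε.le)

lemma radialCutoff_of_le {ε : ℝ} (hε : 0 < ε) {v : E} (hv : ‖v‖ ≤ 1 - ε) :
    radialCutoff ε v = 1 := by
  have : 1 ≤ (1 - ‖v‖) / ε := by rw [le_div_iff₀ hε]; linarith
  simp [radialCutoff, this]

lemma radialCutoff_of_mem {ε : ℝ} (hε : 0 < ε) {v : E} (hv : ‖v‖ ∈ Set.Icc (1 - ε) 1) :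
    radialCutoff ε v = (1 - ‖v‖) / ε := by
  have h1 : (1 - ‖v‖) / ε ≤ 1 := by rw [div_le_iff₀ hε]; linarith [hv.1]
  have h2 : 0 ≤ (1 - ‖v‖) / ε := div_nonneg (by linarith [hv.2]) hε.le
  simp [radialCutoff, h1, h2]

lemma radialCutoff_lipschitz {ε : ℝ} (hε : 0 < ε) :
    LipschitzWith (Real.toNNReal (1 / ε)) (radialCutoff ε : E → ℝ) := by
  have h : LipschitzWith (Real.toNNReal (1 / ε)) (fun v : E => (1 - ‖v‖) / ε) := by
    apply LipschitzWith.of_dist_le_mul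
    intro x y
    rw [Real.coe_toNNReal _ (by positivity), Real.dist_eq,
      show (1 - ‖x‖) / ε - (1 - ‖y‖) / ε = (1 / ε) * (‖y‖ - ‖x‖) by ring, abs_mul,
      abs_of_pos (by positivity : 0 < 1 / ε), dist_comm, dist_eq_norm]
    gcongr
    exact abs_norm_sub_norm_le _ _
  exact (h.const_min 1).const_max 0

variable [InnerProductSpace ℝ E]

/-- The cutoff is `(1 - ‖v‖) / ε` in the shell and locally constant on either side of it. The
direction is `-h` because integration by parts produces it from a derivative along `h`. -/
lemma hasLineDerivAt_radialCutoff {ε : ℝ} (hε : 0 < ε) (hε1 : ε < 1) (h : E) {v : E}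
    (h1 : ‖v‖ ≠ 1) (h2 : ‖v‖ ≠ 1 - ε) :
    HasLineDerivAt ℝ (radialCutoff ε) ((1 / ε) * inner ℝ (‖v‖⁻¹ • v) h
      * (Set.Ioo (1 - ε) 1).indicator (fun _ => (1 : ℝ)) ‖v‖) v (-h) := by
  have hcont : ContinuousAt (fun t : ℝ => ‖v + t • (-h)‖) 0 := by fun_prop
  have hcv : ‖v + (0 : ℝ) • (-h)‖ = ‖v‖ := by simp
  unfold HasLineDerivAt
  rcases lt_or_gt_of_ne h1 with h1 | h1
  · rcases lt_or_gt_of_ne h2 with h2 | h2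
    · have hn : ‖v‖ ∉ Set.Ioo (1 - ε) 1 := fun hx => by linarith [hx.1]
      rw [Set.indicator_of_notMem hn, mul_zero]
      apply (hasDerivAt_const (0 : ℝ) (1 : ℝ)).congr_of_eventuallyEq
      filter_upwards [hcont.eventually_lt continuousAt_const
        (by rw [hcv]; exact h2 : ‖v + (0 : ℝ) • (-h)‖ < 1 - ε)] with t ht
      exact radialCutoff_of_le hε ht.le
    · rw [Set.indicator_of_mem (show ‖v‖ ∈ Set.Ioo (1 - ε) 1 from ⟨h2, h1⟩), mul_one]
      have hv0 : v ≠ 0 := by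
        rintro rfl; rw [norm_zero] at h2; linarith
      have hd1 : HasDerivAt (fun t : ℝ => v + t • (-h)) (-h) 0 := by
        simpa using ((hasDerivAt_id (0 : ℝ)).smul_const (-h)).const_add v
      have hd2 : HasDerivAt (fun t : ℝ => ‖v + t • (-h)‖ ^ 2) (2 * inner ℝ v (-h)) 0 := by
        simpa using hd1.norm_sq
      have hd3 : HasDerivAt (fun t : ℝ => ‖v + t • (-h)‖) (-inner ℝ (‖v‖⁻¹ • v) h) 0 := by
        have := hd2.sqrt (by simpa using hv0)
        have h4 : (fun t : ℝ => √(‖v + t • (-h)‖ ^ 2)) = fun t : ℝ => ‖v + t • (-h)‖ := by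
          ext t; exact Real.sqrt_sq (norm_nonneg _)
        rw [h4] at this
        convert! this using 1
        rw [real_inner_smul_left, inner_neg_right, zero_smul, add_zero,
          Real.sqrt_sq (norm_nonneg _)]
        field_simp
      have hd4 : HasDerivAt (fun t : ℝ => (1 - ‖v + t • (-h)‖) / ε)
          ((1 / ε) * inner ℝ (‖v‖⁻¹ • v) h) 0 := by
        convert! (hd3.const_sub 1).div_const ε using 1
        ring
      apply hd4.congr_of_eventuallyEq
      filter_upwards [hcont.eventually_lt continuousAt_const
        (by rw [hcv]; exact h1 : ‖v + (0 : ℝ) • (-h)‖ < 1),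
        (continuousAt_const (y := 1 - ε)).eventually_lt hcont
        (by rw [hcv]; exact h2)] with t ht ht2
      exact radialCutoff_of_mem hε ⟨ht2.le, ht.le⟩
  · have hn : ‖v‖ ∉ Set.Ioo (1 - ε) 1 := fun hx => by linarith [hx.2]
    rw [Set.indicator_of_notMem hn, mul_zero]
    apply (hasDerivAt_const (0 : ℝ) (0 : ℝ)).congr_of_eventuallyEq
    filter_upwards [(continuousAt_const (y := (1:ℝ))).eventually_lt hcont
        (by rw [hcv]; exact h1)] with t ht
    exact radialCutoff_of_one_le hε ht.le

end Cutoff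

/-! ### Sphere averages of convex functions by integration by parts -/

section SphereGradient

open Filter Topology

/-- Convexity with gain `κ` bounds the difference quotient at step `s` by `d - (1 - s) κ`; let `s`
decrease to `0`. -/
lemma lineDeriv_le_of_convex_step {E : Type*} [NormedAddCommGroup E] [NormedSpace ℝ E]
    {f : E → ℝ} {h v : E} {d κ : ℝ}
    (hd : LineDifferentiableAt ℝ f v h)
    (hconv : ∀ s ∈ Set.Ioo (0 : ℝ) 1,
      f (v + s • h) ≤ (1 - s) * f v + s * f (v + h) - s * (1 - s) * κ)
    (hinc : f (v + h) - f v ≤ d) : lineDeriv ℝ f v h ≤ d - κ := by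
  have h1 := hd.hasLineDerivAt.tendsto_slope_zero_right
  have h2 : Tendsto (fun s : ℝ => d - (1 - s) * κ) (𝓝[>] 0) (𝓝 (d - (1 - 0) * κ)) := by
    apply Tendsto.mono_left _ nhdsWithin_le_nhds
    exact Continuous.tendsto (by fun_prop) 0
  rw [sub_zero, one_mul] at h2
  refine le_of_tendsto_of_tendsto h1 h2 ?_
  filter_upwards [Ioo_mem_nhdsGT (zero_lt_one' ℝ)] with s hs
  have := hconv s hs
  rw [smul_eq_mul, inv_mul_le_iff₀ hs.1]
  nlinarith [mul_le_mul_of_nonneg_left hinc hs.1.le]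

variable {E : Type*} [NormedAddCommGroup E] [InnerProductSpace ℝ E] [MeasurableSpace E]
  [BorelSpace E] [FiniteDimensional ℝ E]

/-- A Lipschitz function has a derivative along `h` almost everywhere, and the cutoff vanishes
outside the open unit ball, where no convexity is assumed. -/
lemma integral_lineDeriv_mul_radialCutoff_le (μ : Measure E) [μ.IsAddHaarMeasure]
    {f : E → ℝ} {K : NNReal} (hf : LipschitzWith K f) {h : E} {d κ ε : ℝ} (hε : 0 < ε)
    (hconv : ∀ v : E, ‖v‖ < 1 → ∀ s ∈ Set.Ioo (0 : ℝ) 1,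
      f (v + s • h) ≤ (1 - s) * f v + s * f (v + h) - s * (1 - s) * κ)
    (hinc : ∀ v : E, ‖v‖ < 1 → f (v + h) - f v ≤ d) :
    ∫ v, lineDeriv ℝ f v h * radialCutoff ε v ∂μ ≤ (d - κ) * ∫ v : E, radialCutoff ε v ∂μ := by
  have hsupp : HasCompactSupport (radialCutoff ε : E → ℝ) := by
    apply HasCompactSupport.of_support_subset_isCompact (isCompact_closedBall (0 : E) 1)
    intro v hv
    by_contra hv'
    simp only [Metric.mem_closedBall, dist_zero_right, not_le] at hv'
    exact hv (radialCutoff_of_one_le hε hv'.le)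
  have hint : Integrable (radialCutoff ε : E → ℝ) μ :=
    (radialCutoff_lipschitz hε).continuous.integrable_of_hasCompactSupport hsupp
  rw [← integral_const_mul]
  apply integral_mono_ae
  · exact hint.bdd_mul (c := K * ‖h‖) (hf.memLp_lineDeriv h).aestronglyMeasurable
      (.of_forall fun x => norm_lineDeriv_le_of_lipschitz ℝ hf)
  · exact hint.const_mul _
  · filter_upwards [hf.ae_lineDifferentiableAt (μ := μ) h] with v hv
    by_cases hv1 : ‖v‖ < 1
    · exact mul_le_mul_of_nonneg_right
        (lineDeriv_le_of_convex_step hv (hconv v hv1) (hinc v hv1)) (radialCutoff_nonneg _ _)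
    · simp only [radialCutoff_of_one_le hε (not_lt.1 hv1), mul_zero, le_refl]

/-- Integration by parts moves the derivative onto the cutoff, where it lives on the shell `1 - ε <
‖v‖ < 1` with weight `⟪v/‖v‖, h⟫ / ε`. There `v` is within `ε` of its radial projection, so
replacing `f v` by the value on the sphere costs at most `K ε`, and the rest factors in polar
coordinates. -/
lemma integral_shell_le (μ : Measure E) [μ.IsAddHaarMeasure] [Nontrivial E]
    {f : E → ℝ} {K : NNReal} (hf : LipschitzWith K f) {h : E} {d κ ε : ℝ} (hε : 0 < ε)
    (hε1 : ε < 1)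
    (hconv : ∀ v : E, ‖v‖ < 1 → ∀ s ∈ Set.Ioo (0 : ℝ) 1,
      f (v + s • h) ≤ (1 - s) * f v + s * f (v + h) - s * (1 - s) * κ)
    (hinc : ∀ v : E, ‖v‖ < 1 → f (v + h) - f v ≤ d) :
    (∫ u, f (u : E) * inner ℝ (u : E) h ∂μ.toSphere)
        * ((1 - (1 - ε) ^ Module.finrank ℝ E) / Module.finrank ℝ E) / ε
      ≤ (d - κ) * (∫ v : E, radialCutoff ε v ∂μ)
        + K * ‖h‖ * ((∫ _u, 1 ∂μ.toSphere)
          * ((1 - (1 - ε) ^ Module.finrank ℝ E) / Module.finrank ℝ E)) := by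
  have hsupp : HasCompactSupport (radialCutoff ε : E → ℝ) := by
    apply HasCompactSupport.of_support_subset_isCompact (isCompact_closedBall (0 : E) 1)
    intro v hv
    by_contra hv'
    simp only [Metric.mem_closedBall, dist_zero_right, not_le] at hv'
    exact hv (radialCutoff_of_one_le hε hv'.le)
  set I : E → ℝ := fun v => (Set.Ioo (1 - ε) 1).indicator (fun _ => (1 : ℝ)) ‖v‖ with hI
  have hIm : Measurable I :=
    (measurable_const.indicator measurableSet_Ioo).comp measurable_norm
  have hI01 : ∀ v, 0 ≤ I v ∧ I v ≤ 1 := fun v => by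
    by_cases hv : ‖v‖ ∈ Set.Ioo (1 - ε) 1 <;> simp [hI, hv]
  have hII : Integrable I μ := by
    have h1 : I = (norm ⁻¹' (Set.Ioo (1 - ε) 1)).indicator (fun _ : E => (1 : ℝ)) := by
      ext v; simp only [hI, Set.indicator, Set.mem_preimage]
    rw [h1, integrable_indicator_iff (measurable_norm measurableSet_Ioo)]
    apply integrableOn_const (ne_top_of_le_ne_top (measure_ball_lt_top (x := (0 : E)) (r := 1)).ne
      (measure_mono ?_))
    intro v hv
    simpa using hv.2
  have h1 := integral_lineDeriv_mul_radialCutoff_le μ hf hε hconv hinc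
  rw [hf.integral_lineDeriv_mul_eq (radialCutoff_lipschitz hε) hsupp] at h1
  have h2 : ∫ v, lineDeriv ℝ (radialCutoff ε) v (-h) * f v ∂μ
      = ∫ v, (1 / ε) * (inner ℝ (‖v‖⁻¹ • v) h * f v * I v) ∂μ := by
    apply integral_congr_ae
    -- The formula for the derivative of the cutoff is needed only off the two boundary spheres,
    -- which are null sets.
    have e1 : ∀ᵐ v ∂μ, v ∉ Metric.sphere (0 : E) 1 :=
      measure_eq_zero_iff_ae_notMem.1 (Measure.addHaar_sphere μ 0 1)
    have e2 : ∀ᵐ v ∂μ, v ∉ Metric.sphere (0 : E) (1 - ε) :=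
      measure_eq_zero_iff_ae_notMem.1 (Measure.addHaar_sphere μ 0 (1 - ε))
    filter_upwards [e1, e2] with v hv1 hv2
    rw [(hasLineDerivAt_radialCutoff hε hε1 h (by simpa using hv1) (by simpa using hv2)).lineDeriv]
    simp only [hI]; ring
  rw [h2, integral_const_mul] at h1
  have hs1 := integral_shell μ (fun u => f u * inner ℝ u h) (ρ := 1 - ε) (by linarith) (by linarith)
  have hs2 := integral_shell μ (fun _ => (1 : ℝ)) (ρ := 1 - ε) (by linarith) (by linarith)
  have hfc := hf.continuous
  have hfb : ∀ v : E, ‖v‖ ≤ 1 → ‖f v‖ ≤ ‖f 0‖ + K := fun v hv => by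
    have := hf.norm_sub_le v 0
    rw [sub_zero] at this
    have h3 := norm_le_norm_add_norm_sub' (f v) (f 0)
    nlinarith [K.2]
  have hnn : ∀ v : E, ‖‖v‖⁻¹ • v‖ ≤ 1 := fun v => by
    rw [norm_smul, norm_inv, norm_norm]
    exact inv_mul_le_one
  have hinn : ∀ v : E, ‖(inner ℝ (‖v‖⁻¹ • v) h : ℝ)‖ ≤ ‖h‖ := fun v =>
    (norm_inner_le_norm _ _).trans (mul_le_of_le_one_left (norm_nonneg _) (hnn v))
  have hint1 : Integrable (fun v => (f (‖v‖⁻¹ • v) * inner ℝ (‖v‖⁻¹ • v) h) * I v) μ := by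
    apply hII.bdd_mul (c := (‖f 0‖ + K) * ‖h‖)
    · exact Measurable.aestronglyMeasurable (by fun_prop)
    · refine .of_forall fun v => ?_
      rw [norm_mul]
      exact mul_le_mul (hfb _ (hnn v)) (hinn v) (norm_nonneg _) (by positivity)
  have hint2 : Integrable (fun v => inner ℝ (‖v‖⁻¹ • v) h * f v * I v) μ := by
    have hg : Integrable (fun v => (inner ℝ (‖v‖⁻¹ • v) h * (f v * I v))) μ := by
      apply Integrable.bdd_mul (c := ‖h‖)
      · apply Integrable.mono' (hII.const_mul (‖f 0‖ + K))
        · exact (hfc.measurable.mul hIm).aestronglyMeasurable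
        · refine .of_forall fun v => ?_
          rw [norm_mul, Real.norm_of_nonneg (hI01 v).1]
          by_cases hv : ‖v‖ ∈ Set.Ioo (1 - ε) 1
          · exact mul_le_mul_of_nonneg_right (hfb v hv.2.le) (hI01 v).1
          · simp [hI, hv]
      · exact Measurable.aestronglyMeasurable (by fun_prop)
      · exact .of_forall hinn
    simpa only [mul_assoc] using hg
  have h3 : ∫ v, (f (‖v‖⁻¹ • v) * inner ℝ (‖v‖⁻¹ • v) h) * I v ∂μ
      ≤ ∫ v, inner ℝ (‖v‖⁻¹ • v) h * f v * I v + K * ε * ‖h‖ * (1 * I v) ∂μ := by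
    apply integral_mono hint1 (hint2.add ((hII.const_mul 1).const_mul _))
    intro v
    by_cases hv : ‖v‖ ∈ Set.Ioo (1 - ε) 1
    · have hv1 : I v = 1 := by simp [hI, hv]
      simp only [Pi.add_apply, hv1, mul_one]
      have hv0 : 0 < ‖v‖ := by linarith [hv.1]
      have hclose : ‖‖v‖⁻¹ • v - v‖ ≤ ε := by
        rw [show ‖v‖⁻¹ • v - v = (‖v‖⁻¹ - 1) • v by rw [sub_smul, one_smul], norm_smul,
          Real.norm_of_nonneg (by rw [sub_nonneg]; exact (one_le_inv₀ hv0).2 hv.2.le), sub_mul,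
          inv_mul_cancel₀ hv0.ne']
        linarith [hv.1]
      have h5 : ‖f (‖v‖⁻¹ • v) - f v‖ ≤ K * ε :=
        (hf.norm_sub_le _ _).trans (mul_le_mul_of_nonneg_left hclose K.2)
      have h6 : (f (‖v‖⁻¹ • v) - f v) * inner ℝ (‖v‖⁻¹ • v) h ≤ K * ε * ‖h‖ := by
        refine (le_abs_self _).trans ?_
        rw [abs_mul]
        exact mul_le_mul h5 (hinn v) (abs_nonneg _) (by positivity)
      linarith [h6]
    · have hv1 : I v = 0 := by simp [hI, hv]
      simp [hv1]
  rw [integral_add hint2 ((hII.const_mul 1).const_mul _), integral_const_mul] at h3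
  rw [hs1, hs2] at h3
  rw [div_le_iff₀ hε]
  have h7 : ∫ v, inner ℝ (‖v‖⁻¹ • v) h * f v * I v ∂μ
      ≤ ((d - κ) * ∫ v : E, radialCutoff ε v ∂μ) * ε := by
    rw [one_div, inv_mul_le_iff₀ hε] at h1; linarith
  linarith

lemma tendsto_integral_radialCutoff (μ : Measure E) [μ.IsAddHaarMeasure] :
    Tendsto (fun ε => ∫ v : E, radialCutoff ε v ∂μ) (𝓝[>] 0)
      (𝓝 (μ.real (Metric.ball (0 : E) 1))) := by
  have h0 : μ.real (Metric.ball (0 : E) 1)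
      = ∫ v, (Metric.ball (0 : E) 1).indicator (fun _ => (1 : ℝ)) v ∂μ := by
    rw [integral_indicator_const _ Metric.isOpen_ball.measurableSet, smul_eq_mul, mul_one]
  rw [h0]
  apply tendsto_integral_filter_of_dominated_convergence
    ((Metric.ball (0 : E) 1).indicator (fun _ => (1 : ℝ)))
  · filter_upwards [self_mem_nhdsWithin] with ε hε
    exact (radialCutoff_lipschitz hε).continuous.aestronglyMeasurable
  · filter_upwards [self_mem_nhdsWithin] with ε hε
    refine .of_forall fun v => ?_
    rw [Real.norm_of_nonneg (radialCutoff_nonneg _ _)]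
    by_cases hv : v ∈ Metric.ball (0 : E) 1
    · simpa [hv] using radialCutoff_le_one ε v
    · rw [radialCutoff_of_one_le hε (by simpa using hv)]
      exact Set.indicator_nonneg (fun _ _ => zero_le_one) _
  · rw [integrable_indicator_iff Metric.isOpen_ball.measurableSet]
    exact integrableOn_const measure_ball_lt_top.ne
  · refine .of_forall fun v => ?_
    by_cases hv : v ∈ Metric.ball (0 : E) 1
    · rw [Set.indicator_of_mem hv]
      apply tendsto_const_nhds.congr'
      have hv' : 0 < 1 - ‖v‖ := by simpa using hv
      filter_upwards [Ioo_mem_nhdsGT hv'] with ε hε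
      exact (radialCutoff_of_le hε.1 (by linarith [hε.2])).symm
    · rw [Set.indicator_of_notMem hv]
      apply tendsto_const_nhds.congr'
      filter_upwards [self_mem_nhdsWithin] with ε hε
      exact (radialCutoff_of_one_le hε (by simpa using hv)).symm

lemma tendsto_one_sub_pow_div (k : ℕ) (hk : 0 < k) :
    Tendsto (fun ε : ℝ => (1 - (1 - ε) ^ k) / k / ε) (𝓝[>] 0) (𝓝 1) := by
  have h1 : HasDerivAt (fun ε : ℝ => (1 - (1 - ε) ^ k) / k) 1 0 := by
    have h2 := ((((hasDerivAt_id (0 : ℝ)).const_sub 1).pow k).const_sub 1).div_const (k : ℝ)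
    convert! h2 using 1
    have : (k : ℝ) ≠ 0 := by positivity
    simp [this]
  have h3 := h1.tendsto_slope_zero_right
  refine h3.congr fun ε => ?_
  simp [div_eq_inv_mul]

/-- The sphere average of `f(u) ⟪u, h⟫` of a function `f` that is convex in the direction `h` on the
unit ball (with strong convexity gain `κ`) is bounded by the increments of `f` along `h`. -/
theorem integral_toSphere_mul_inner_le (μ : Measure E) [μ.IsAddHaarMeasure] [Nontrivial E]
    {f : E → ℝ} {K : NNReal} (hf : LipschitzWith K f) {h : E} {d κ : ℝ}
    (hconv : ∀ v : E, ‖v‖ < 1 → ∀ s ∈ Set.Ioo (0 : ℝ) 1,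
      f (v + s • h) ≤ (1 - s) * f v + s * f (v + h) - s * (1 - s) * κ)
    (hinc : ∀ v : E, ‖v‖ < 1 → f (v + h) - f v ≤ d) :
    ∫ u, f (u : E) * inner ℝ (u : E) h ∂μ.toSphere ≤ (d - κ) * μ.real (Metric.ball (0 : E) 1) := by
  set k := Module.finrank ℝ E
  have hk : 0 < k := Module.finrank_pos
  set A := ∫ u, f (u : E) * inner ℝ (u : E) h ∂μ.toSphere
  -- The shell factor divided by `ε` tends to `1`, while the factor itself tends to `0`. In the
  -- limit the left side is the sphere integral and the error of the radial replacement disappears.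
  have h1 : Tendsto (fun ε : ℝ => A * ((1 - (1 - ε) ^ k) / k) / ε) (𝓝[>] 0) (𝓝 (A * 1)) := by
    refine ((tendsto_one_sub_pow_div k hk).const_mul A).congr fun ε => ?_
    rw [mul_div_assoc]
  have h2 : Tendsto (fun ε : ℝ => (1 - (1 - ε) ^ k) / k) (𝓝[>] 0) (𝓝 0) := by
    apply Tendsto.mono_left _ nhdsWithin_le_nhds
    have : Continuous (fun ε : ℝ => (1 - (1 - ε) ^ k) / k) := by fun_prop
    simpa using this.tendsto 0
  have h3 := ((tendsto_integral_radialCutoff μ).const_mul (d - κ)).add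
    ((h2.const_mul (∫ _u, (1 : ℝ) ∂μ.toSphere)).const_mul (K * ‖h‖))
  rw [mul_zero, mul_zero, add_zero] at h3
  rw [mul_one] at h1
  refine le_of_tendsto_of_tendsto h1 h3 ?_
  filter_upwards [Ioo_mem_nhdsGT (zero_lt_one' ℝ)] with ε hε
  exact integral_shell_le μ hf hε.1 hε.2 hconv hinc

end SphereGradient

/-! ### The uniform law on the sphere -/

section UniformSphere

variable {p : ℕ}

lemma nontrivial_vec (hp : 0 < p) : Nontrivial (Vec p) := by
  have : Nonempty (Fin p) := ⟨⟨0, hp⟩⟩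
  infer_instance

lemma isProbabilityMeasure_uniformSphere (hp : 0 < p) : IsProbabilityMeasure (uniformSphere p) := by
  have := nontrivial_vec hp
  constructor
  rw [uniformSphere, Measure.smul_apply, smul_eq_mul]
  apply ENNReal.inv_mul_cancel
  · rw [Measure.measure_univ_ne_zero]
    exact Measure.toSphere_ne_zero _
  · exact measure_ne_top _ _

/-- The surface measure has total mass `p` times the volume of the ball; normalizing it is what
produces the factor `p` of the one-point estimator. -/
theorem integral_uniformSphere_mul_inner_le (hp : 0 < p)
    {f : Vec p → ℝ} {K : NNReal} (hf : LipschitzWith K f) {h : Vec p} {d κ : ℝ}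
    (hconv : ∀ v : Vec p, ‖v‖ < 1 → ∀ s ∈ Set.Ioo (0 : ℝ) 1,
      f (v + s • h) ≤ (1 - s) * f v + s * f (v + h) - s * (1 - s) * κ)
    (hinc : ∀ v : Vec p, ‖v‖ < 1 → f (v + h) - f v ≤ d) :
    p * ∫ u, f (u : Vec p) * inner ℝ (u : Vec p) h ∂(uniformSphere p) ≤ d - κ := by
  have := nontrivial_vec hp
  have h1 := integral_toSphere_mul_inner_le (volume : Measure (Vec p)) hf hconv hinc
  have hV : 0 < (volume : Measure (Vec p)).real (Metric.ball 0 1) :=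
    ENNReal.toReal_pos (Metric.measure_ball_pos _ _ one_pos).ne' measure_ball_lt_top.ne
  have h2 : ((volume : Measure (Vec p)).toSphere Set.univ)⁻¹.toReal
      = (p * (volume : Measure (Vec p)).real (Metric.ball 0 1))⁻¹ := by
    rw [ENNReal.toReal_inv, ← measureReal_def, Measure.toSphere_real_apply_univ,
      finrank_euclideanSpace_fin]
  rw [uniformSphere, integral_smul_measure, h2, smul_eq_mul, mul_inv, ← mul_assoc, ← mul_assoc,
    mul_inv_cancel₀ (by positivity), one_mul, inv_mul_le_iff₀ hV]
  linarith

end UniformSphere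

/-! ### Consensus over time-varying graphs -/

section Consensus

variable {n : ℕ}

/-- The product `W (s + k - 1) * ⋯ * W s` of `k` consecutive mixing matrices. -/
def transition (W : ℕ → Matrix (Fin n) (Fin n) ℝ) (s : ℕ) : ℕ → Matrix (Fin n) (Fin n) ℝ
  | 0 => 1
  | k + 1 => W (s + k) * transition W s k

variable {G : ℕ → Digraph (Fin n)} {W : ℕ → Matrix (Fin n) (Fin n) ℝ} {w : ℝ} {B : ℕ}

lemma transition_mem (hW : IsMixingNetwork G W w B) {s : ℕ} (hs : 1 ≤ s) (k : ℕ) :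
    transition W s k ∈ doublyStochastic ℝ (Fin n) := by
  induction k with
  | zero => exact one_mem _
  | succ k ih => exact mul_mem (hW.doubly_stochastic _ (by omega)) ih

/-- One term of the matrix product suffices: weight `w` on the edge or self-loop, times the weight
already accumulated. -/
lemma pow_succ_le_transition (hW : IsMixingNetwork G W w B) (hw : 0 ≤ w) {s : ℕ} (hs : 1 ≤ s)
    {k : ℕ} {a b j : Fin n} (hab : (G (s + k)).Adj a b ∨ b = a)
    (ha : w ^ k ≤ transition W s k a j) : w ^ (k + 1) ≤ transition W s (k + 1) b j := by
  have h0 : ∀ l, 0 ≤ W (s + k) b l * transition W s k l j := fun l =>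
    mul_nonneg (nonneg_of_mem_doublyStochastic (hW.doubly_stochastic _ (by omega)))
      (nonneg_of_mem_doublyStochastic (transition_mem hW hs k))
  have h1 : W (s + k) b a * transition W s k a j ≤ transition W s (k + 1) b j := by
    rw [transition, Matrix.mul_apply]
    exact Finset.single_le_sum (f := fun l => W (s + k) b l * transition W s k l j)
      (fun l _ => h0 l) (Finset.mem_univ a)
  have h2 := hW.weight_ge (s + k) (by omega) b a hab
  calc w ^ (k + 1) = w * w ^ k := by ring
    _ ≤ W (s + k) b a * transition W s k a j := by
        apply mul_le_mul h2 ha (by positivity) (hw.trans h2)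
    _ ≤ _ := h1

open Classical in
/-- The agents that received a weight of at least `w ^ k` from agent `j` after `k` steps. -/
noncomputable def reached (W : ℕ → Matrix (Fin n) (Fin n) ℝ) (w : ℝ) (s : ℕ) (j : Fin n) (k : ℕ) :
    Finset (Fin n) :=
  Finset.univ.filter fun i => w ^ k ≤ transition W s k i j

lemma mem_reached {s : ℕ} {j i : Fin n} {k : ℕ} :
    i ∈ reached W w s j k ↔ w ^ k ≤ transition W s k i j := by
  simp [reached]

lemma reached_mono (hW : IsMixingNetwork G W w B) (hw : 0 ≤ w) {s : ℕ} (hs : 1 ≤ s) (j : Fin n) :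
    Monotone (reached W w s j) := by
  apply monotone_nat_of_le_succ
  intro k i hi
  rw [mem_reached] at hi ⊢
  exact pow_succ_le_transition hW hw hs (Or.inr rfl) hi

lemma self_mem_reached (hW : IsMixingNetwork G W w B) (hw : 0 ≤ w) {s : ℕ} (hs : 1 ≤ s)
    (j : Fin n) (k : ℕ) : j ∈ reached W w s j k := by
  apply reached_mono hW hw hs j (Nat.zero_le k)
  simp [mem_reached, transition]

/-- If the set did not grow within `B` steps, monotonicity would freeze it over the whole window.
Each edge of the union graph is active at some time of the window and pulls its head into the frozen
set, so strong connectivity would make the set everything. -/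
lemma reached_grows (hW : IsMixingNetwork G W w B) (hw : 0 ≤ w) {s : ℕ} (hs : 1 ≤ s)
    (j : Fin n) (k : ℕ) (hk : reached W w s j k ≠ Finset.univ) :
    (reached W w s j k).card + 1 ≤ (reached W w s j (k + B)).card := by
  by_contra hcon
  have hmono := reached_mono hW hw hs j
  have heq : reached W w s j k = reached W w s j (k + B) :=
    Finset.eq_of_subset_of_card_le (hmono (Nat.le_add_right _ _)) (by omega)
  apply hk
  rw [Finset.eq_univ_iff_forall]
  intro i
  induction hW.strongly_connected (s + k) (by omega) j i with
  | refl => exact self_mem_reached hW hw hs j k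
  | tail _ hstep ih =>
    obtain ⟨l, hl, hadj⟩ := hstep
    rw [heq]
    apply hmono (show k + l + 1 ≤ k + B by omega)
    rw [mem_reached]
    apply pow_succ_le_transition hW hw hs (Or.inl (by rwa [← add_assoc]))
    rw [← mem_reached]
    exact hmono (Nat.le_add_right k l) ih

lemma reached_eq_univ (hW : IsMixingNetwork G W w B) (hw : 0 ≤ w) {s : ℕ} (hs : 1 ≤ s)
    (j : Fin n) : reached W w s j (n * B) = Finset.univ := by
  have hmono := reached_mono hW hw hs j
  have h : ∀ k, reached W w s j (k * B) = Finset.univ ∨ k ≤ (reached W w s j (k * B)).card := by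
    intro k
    induction k with
    | zero => right; simp
    | succ k ih =>
      by_cases hk : reached W w s j (k * B) = Finset.univ
      · left
        rw [Finset.eq_univ_iff_forall] at hk ⊢
        exact fun i => hmono (Nat.mul_le_mul_right B (Nat.le_succ k)) (hk i)
      · right
        have h1 := reached_grows hW hw hs j _ hk
        have h2 := ih.resolve_left hk
        rw [Nat.succ_mul]
        omega
  rcases h n with h | h
  · exact h
  · apply Finset.eq_univ_of_card
    rw [Fintype.card_fin]
    exact le_antisymm (by simpa using Finset.card_le_univ (reached W w s j (n * B))) h

lemma pow_le_transition (hW : IsMixingNetwork G W w B) (hw : 0 ≤ w) {s : ℕ} (hs : 1 ≤ s)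
    (i j : Fin n) : w ^ (n * B) ≤ transition W s (n * B) i j := by
  rw [← mem_reached, reached_eq_univ hW hw hs j]
  exact Finset.mem_univ i

variable {F : Type*} [NormedAddCommGroup F] [NormedSpace ℝ F]

/-- A coupling argument: regard rows `i` and `k` as independent distributions. The difference of the
averages is the mean of `x j - x l`, and the pair `j = l = i`, of weight at least `η²`, contributes
nothing. -/
lemma norm_sum_smul_sub_le {M : Matrix (Fin n) (Fin n) ℝ} (hM : M ∈ doublyStochastic ℝ (Fin n))
    {η D : ℝ} (hη0 : 0 ≤ η) (hη : ∀ i j, η ≤ M i j) (x : Fin n → F)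
    (hD : ∀ i j, ‖x i - x j‖ ≤ D) (i k : Fin n) :
    ‖∑ j, M i j • x j - ∑ j, M k j • x j‖ ≤ (1 - η ^ 2) * D := by
  have hD0 : 0 ≤ D := (norm_nonneg _).trans (hD i i)
  have hs : ∀ i, ∑ j, M i j = 1 := fun i => sum_row_of_mem_doublyStochastic hM i
  have h0 : ∀ i j, 0 ≤ M i j := fun i j => nonneg_of_mem_doublyStochastic hM
  have h1 : ∑ j, M i j • x j - ∑ j, M k j • x j
      = ∑ j, ∑ l, (M i j * M k l) • (x j - x l) := by
    have e1 : ∑ j, M i j • x j = ∑ j, ∑ l, (M i j * M k l) • x j := by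
      refine Finset.sum_congr rfl fun j _ => ?_
      rw [← Finset.sum_smul, ← Finset.mul_sum, hs, mul_one]
    have e2 : ∑ j, M k j • x j = ∑ j, ∑ l, (M i j * M k l) • x l := by
      rw [Finset.sum_comm]
      refine Finset.sum_congr rfl fun j _ => ?_
      rw [← Finset.sum_smul, ← Finset.sum_mul, hs, one_mul]
    rw [e1, e2, ← Finset.sum_sub_distrib]
    refine Finset.sum_congr rfl fun j _ => ?_
    rw [← Finset.sum_sub_distrib]
    refine Finset.sum_congr rfl fun l _ => ?_
    rw [smul_sub]
  rw [h1]
  calc ‖∑ j, ∑ l, (M i j * M k l) • (x j - x l)‖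
      ≤ ∑ j, ∑ l, ‖(M i j * M k l) • (x j - x l)‖ :=
        (norm_sum_le _ _).trans (Finset.sum_le_sum fun j _ => norm_sum_le _ _)
    _ ≤ ∑ j, ∑ l, (M i j * M k l * D - if j = i then (if l = i then η ^ 2 * D else 0) else 0) := by
        refine Finset.sum_le_sum fun j _ => Finset.sum_le_sum fun l _ => ?_
        have hjl := mul_nonneg (h0 i j) (h0 k l)
        rw [norm_smul, Real.norm_of_nonneg hjl]
        by_cases hj : j = i
        · by_cases hl : l = i
          · rw [if_pos hj, if_pos hl, hj, hl, sub_self, norm_zero, mul_zero, sub_nonneg, pow_two]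
            exact mul_le_mul_of_nonneg_right (mul_le_mul (hη i i) (hη k i) hη0 (h0 i i)) hD0
          · rw [if_pos hj, if_neg hl, sub_zero]
            exact mul_le_mul_of_nonneg_left (hD _ _) hjl
        · rw [if_neg hj, sub_zero]
          exact mul_le_mul_of_nonneg_left (hD _ _) hjl
    _ = (1 - η ^ 2) * D := by
        simp only [Finset.sum_sub_distrib,
          ← Finset.sum_mul, ← Finset.mul_sum, hs, mul_one, one_mul]
        have : ∀ j, (∑ l : Fin n, if j = i then (if l = i then η ^ 2 * D else 0) else 0)
            = if j = i then η ^ 2 * D else 0 := fun j => by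
          by_cases hj : j = i <;> simp [hj]
        simp only [this, Finset.sum_ite_eq', Finset.mem_univ, if_true]
        ring

lemma norm_sum_smul_le {M : Matrix (Fin n) (Fin n) ℝ} (hM : M ∈ doublyStochastic ℝ (Fin n))
    (x : Fin n → F) {D : ℝ} (hD : ∀ i, ‖x i‖ ≤ D) (i : Fin n) : ‖∑ j, M i j • x j‖ ≤ D := by
  have hs : ∑ j, M i j = 1 := sum_row_of_mem_doublyStochastic hM i
  calc ‖∑ j, M i j • x j‖ ≤ ∑ j, M i j * D := by
        refine (norm_sum_le _ _).trans (Finset.sum_le_sum fun j _ => ?_)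
        have h0 : 0 ≤ M i j := nonneg_of_mem_doublyStochastic hM
        rw [norm_smul, Real.norm_of_nonneg h0]
        exact mul_le_mul_of_nonneg_left (hD j) h0
    _ = D := by rw [← Finset.sum_mul, hs, one_mul]

/-- Averaging is nonexpansive, so the one-step errors add up without amplification. -/
lemma norm_sub_transition_le (hW : IsMixingNetwork G W w B) {e : ℕ → Fin n → F} {s : ℕ}
    (hs : 1 ≤ s) {b : ℝ} (hb : ∀ t, s ≤ t → ∀ i, ‖e (t + 1) i - ∑ j, W t i j • e t j‖ ≤ b)
    (k : ℕ) : ∀ i, ‖e (s + k) i - ∑ j, transition W s k i j • e s j‖ ≤ k * b := by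
  induction k with
  | zero =>
    intro i
    simp [transition, Matrix.one_apply]
  | succ k ih =>
    intro i
    have h1 : ∑ j, transition W s (k + 1) i j • e s j
        = ∑ l, W (s + k) i l • ∑ j, transition W s k l j • e s j := by
      simp only [transition, Matrix.mul_apply, Finset.sum_smul, Finset.smul_sum, smul_smul]
      exact Finset.sum_comm
    have h2 := hb (s + k) (by omega) i
    have h3 := norm_sum_smul_le (hW.doubly_stochastic (s + k) (by omega))
      (fun l => e (s + k) l - ∑ j, transition W s k l j • e s j) ih i
    simp only [smul_sub, Finset.sum_sub_distrib, ← h1] at h3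
    have h4 : e (s + (k + 1)) i - ∑ j, transition W s (k + 1) i j • e s j
        = (e (s + k + 1) i - ∑ j, W (s + k) i j • e (s + k) j)
          + (∑ j, W (s + k) i j • e (s + k) j - ∑ j, transition W s (k + 1) i j • e s j) := by
      rw [← add_assoc]; abel
    rw [h4]
    refine (norm_add_le _ _).trans ?_
    push_cast
    linarith

lemma disagreement_step (hW : IsMixingNetwork G W w B) (hw : 0 ≤ w) {e : ℕ → Fin n → F} {s : ℕ}
    (hs : 1 ≤ s) {b D : ℝ} (hb : ∀ t, s ≤ t → ∀ i, ‖e (t + 1) i - ∑ j, W t i j • e t j‖ ≤ b)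
    (hD : ∀ i j, ‖e s i - e s j‖ ≤ D) (i j : Fin n) :
    ‖e (s + n * B) i - e (s + n * B) j‖
      ≤ (1 - (w ^ (n * B)) ^ 2) * D + 2 * ((n * B : ℕ) * b) := by
  have h1 := norm_sub_transition_le hW hs hb (n * B)
  have h2 := norm_sum_smul_sub_le (transition_mem hW hs (n * B)) (pow_nonneg hw _)
    (pow_le_transition hW hw hs) (e s) hD i j
  have h3 : e (s + n * B) i - e (s + n * B) j
      = (e (s + n * B) i - ∑ l, transition W s (n * B) i l • e s l)
        + (∑ l, transition W s (n * B) i l • e s l - ∑ l, transition W s (n * B) j l • e s l)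
        - (e (s + n * B) j - ∑ l, transition W s (n * B) j l • e s l) := by abel
  rw [h3]
  refine (norm_sub_le _ _).trans ?_
  have := norm_add_le (e (s + n * B) i - ∑ l, transition W s (n * B) i l • e s l)
    (∑ l, transition W s (n * B) i l • e s l - ∑ l, transition W s (n * B) j l • e s l)
  linarith [h1 i, h1 j]

/-- A number in `(0, 1]` is at most its power with exponent `σ ≤ 1`. Hence `s^(-σ)` loses little
over a window of length `L` once `s` is large. -/
lemma div_add_mul_rpow_neg_le {s L σ : ℝ} (hs : 0 < s) (hL : 0 ≤ L) (hσ1 : σ ≤ 1) :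
    s / (s + L) * s ^ (-σ) ≤ (s + L) ^ (-σ) := by
  have h1 : s / (s + L) ≤ (s / (s + L)) ^ σ := by
    have h := Real.rpow_le_rpow_of_exponent_ge (x := s / (s + L)) (by positivity)
      (by rw [div_le_one (by positivity)]; linarith) hσ1
    rwa [Real.rpow_one] at h
  calc s / (s + L) * s ^ (-σ) ≤ (s / (s + L)) ^ σ * s ^ (-σ) := by gcongr
    _ = (s + L) ^ (-σ) := by
      rw [Real.div_rpow hs.le (by positivity), Real.rpow_neg hs.le, Real.rpow_neg (by positivity)]
      have : s ^ σ ≠ 0 := (Real.rpow_pos_of_pos hs σ).ne'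
      field_simp

/-- If the perturbations of the averaging dynamics decay polynomially, then so does the
disagreement of the agents, with the same exponent. -/
theorem exists_disagreement_bound (F : Type*) [NormedAddCommGroup F] [NormedSpace ℝ F]
    (hn : 0 < n) (hB : 0 < B) (hw : w ∈ Set.Ioo (0 : ℝ) 1) {σ b R : ℝ}
    (hσ : σ ∈ Set.Icc (0 : ℝ) 1) (hb : 0 ≤ b) (hR : 0 ≤ R) :
    ∃ C : ℝ, 0 < C ∧ ∀ (G : ℕ → Digraph (Fin n)) (W : ℕ → Matrix (Fin n) (Fin n) ℝ)
      (e : ℕ → Fin n → F), IsMixingNetwork G W w B →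
      (∀ t, 1 ≤ t → ∀ i, ‖e t i‖ ≤ R) →
      (∀ t, 1 ≤ t → ∀ i, ‖e (t + 1) i - ∑ j, W t i j • e t j‖ ≤ b * (t : ℝ) ^ (-σ)) →
      ∀ t, 1 ≤ t → ∀ i j, ‖e t i - e t j‖ ≤ C * (t : ℝ) ^ (-σ) := by
  set L := n * B with hL
  have hL1 : 1 ≤ L := Nat.mul_pos hn hB
  set κ := (w ^ L) ^ 2 with hκ
  have hκ0 : 0 < κ := by have := hw.1; positivity
  have hκ1 : κ ≤ 1 := pow_le_one₀ (pow_nonneg hw.1.le _) (pow_le_one₀ hw.1.le hw.2.le)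
  -- For `s ≥ 2 L / κ` one has `s / (s + L) ≥ 1 - κ / 2`: over a window the power loses at most half
  -- of the contraction.
  obtain ⟨t₀, ht₀⟩ := exists_nat_ge (2 * L / κ)
  -- The first term covers the early times through the diameter `2 R`. The second gives `2 L b ≤ C κ
  -- / 2`, so the other half of the contraction pays for the perturbations.
  set C := 2 * R * ((t₀ + 1 + L : ℕ) : ℝ) ^ σ + 4 * L * b / κ + 1 with hC
  refine ⟨C, by positivity, fun G W e hW hR' hb' t => ?_⟩
  induction t using Nat.strong_induction_on with
  | _ t ih =>
  intro ht i j
  by_cases hlt : t < t₀ + 1 + L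
  · have htp : (0 : ℝ) < t := by exact_mod_cast ht
    have h1 : (t : ℝ) ^ σ ≤ ((t₀ + 1 + L : ℕ) : ℝ) ^ σ := by
      apply Real.rpow_le_rpow htp.le _ hσ.1
      exact_mod_cast hlt.le
    calc ‖e t i - e t j‖ ≤ R + R := (norm_sub_le _ _).trans (add_le_add (hR' t ht i) (hR' t ht j))
      _ = 2 * R * ((t : ℝ) ^ σ * (t : ℝ) ^ (-σ)) := by
        rw [← Real.rpow_add htp]; simp; ring
      _ ≤ 2 * R * (((t₀ + 1 + L : ℕ) : ℝ) ^ σ * (t : ℝ) ^ (-σ)) := by gcongr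
      _ ≤ C * (t : ℝ) ^ (-σ) := by
        rw [← mul_assoc]
        apply mul_le_mul_of_nonneg_right _ (by positivity)
        have : 0 ≤ 4 * L * b / κ := by positivity
        linarith
  · obtain ⟨s, rfl⟩ : ∃ s, t = s + L := ⟨t - L, by omega⟩
    have hs1 : 1 ≤ s := by omega
    have hsp : (0 : ℝ) < s := by exact_mod_cast hs1
    have hst : (t₀ : ℝ) ≤ s := by exact_mod_cast (by omega : t₀ ≤ s)
    have h1 := disagreement_step hW hw.1.le hs1 (b := b * (s : ℝ) ^ (-σ))
      (fun t hst i => (hb' t (hs1.trans hst) i).trans (mul_le_mul_of_nonneg_left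
        (Real.rpow_le_rpow_of_nonpos hsp (by exact_mod_cast hst) (by linarith [hσ.1])) hb))
      (ih s (by omega) hs1) i j
    rw [← hL, ← hκ] at h1
    have h2 : (1 - κ / 2) * (s : ℝ) ^ (-σ) ≤ ((s + L : ℕ) : ℝ) ^ (-σ) := by
      push_cast
      refine le_trans ?_ (div_add_mul_rpow_neg_le hsp (by positivity : (0 : ℝ) ≤ L) hσ.2)
      apply mul_le_mul_of_nonneg_right _ (by positivity)
      rw [le_div_iff₀ (by positivity)]
      rw [div_le_iff₀ hκ0] at ht₀
      nlinarith
    have h3 : 2 * (L * b) ≤ C * (κ / 2) := by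
      have h4 : 4 * L * b / κ ≤ C := by
        have : 0 ≤ 2 * R * ((t₀ + 1 + L : ℕ) : ℝ) ^ σ := by positivity
        linarith
      rw [div_le_iff₀ hκ0] at h4
      linarith
    have hC0 : 0 ≤ C := by positivity
    have h5 : (0 : ℝ) ≤ (s : ℝ) ^ (-σ) := by positivity
    calc _ ≤ _ := h1
      _ = ((1 - κ) * C + 2 * (L * b)) * (s : ℝ) ^ (-σ) := by ring
      _ ≤ (C * (1 - κ / 2)) * (s : ℝ) ^ (-σ) := by
        apply mul_le_mul_of_nonneg_right _ h5
        linarith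
      _ = C * ((1 - κ / 2) * (s : ℝ) ^ (-σ)) := by ring
      _ ≤ _ := mul_le_mul_of_nonneg_left h2 hC0

end Consensus

/-! ### Sums and increments of powers -/

section PowerSums

/-- Induction on `T`. Bernoulli's inequality with exponent `1 + a` in `(0, 1]` gives `T^(1+a) ≤
(T+1)^(1+a) - (1+a) (T+1)^a`. -/
lemma sum_rpow_le {a : ℝ} (ha : -1 < a) (ha0 : a ≤ 0) (T : ℕ) :
    ∑ t ∈ Finset.Icc 1 T, (t : ℝ) ^ a ≤ (T : ℝ) ^ (1 + a) / (1 + a) := by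
  have h1a : 0 < 1 + a := by linarith
  induction T with
  | zero => simp [Real.zero_rpow h1a.ne']
  | succ T ih =>
    rw [Finset.sum_Icc_succ_top (by omega)]
    have hT : (0 : ℝ) < ((T + 1 : ℕ) : ℝ) := by positivity
    have h1 : (T : ℝ) ^ (1 + a) ≤ ((T + 1 : ℕ) : ℝ) ^ (1 + a)
        * (1 + (1 + a) * (-1 / ((T + 1 : ℕ) : ℝ))) := by
      have hle : -1 ≤ -1 / ((T + 1 : ℕ) : ℝ) := by
        rw [le_div_iff₀ hT]; push_cast; linarith [(Nat.cast_nonneg T : (0 : ℝ) ≤ T)]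
      refine le_trans (le_of_eq ?_) (mul_le_mul_of_nonneg_left
        (rpow_one_add_le_one_add_mul_self hle h1a.le (by linarith)) (by positivity))
      rw [← Real.mul_rpow hT.le (by linarith)]
      congr 1
      field_simp
      push_cast; ring
    have h2 : ((T + 1 : ℕ) : ℝ) ^ (1 + a) = ((T + 1 : ℕ) : ℝ) * ((T + 1 : ℕ) : ℝ) ^ a := by
      rw [Real.rpow_add hT, Real.rpow_one]
    have h3 : ((T + 1 : ℕ) : ℝ) ^ (1 + a) * (1 + (1 + a) * (-1 / ((T + 1 : ℕ) : ℝ)))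
        = ((T + 1 : ℕ) : ℝ) ^ (1 + a) - (1 + a) * ((T + 1 : ℕ) : ℝ) ^ a := by
      rw [h2]; field_simp
      ring
    rw [le_div_iff₀ h1a] at ih ⊢
    linarith

lemma rpow_add_natCast_le {t : ℕ} (ht : 1 ≤ t) (k : ℕ) {a : ℝ} (ha : a ∈ Set.Icc (0 : ℝ) 1) :
    ((t : ℝ) + k) ^ a ≤ (1 + k) * (t : ℝ) ^ a := by
  have ht' : (1 : ℝ) ≤ t := by exact_mod_cast ht
  have h1 : (t : ℝ) + k ≤ (1 + k) * t := by nlinarith [(Nat.cast_nonneg k : (0 : ℝ) ≤ k)]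
  have h2 : (1 + k : ℝ) ^ a ≤ 1 + k := by
    have := Real.rpow_le_rpow_of_exponent_le (x := 1 + (k : ℝ)) (by simp) ha.2
    rwa [Real.rpow_one] at this
  calc ((t : ℝ) + k) ^ a ≤ ((1 + k) * t) ^ a := Real.rpow_le_rpow (by positivity) h1 ha.1
    _ = (1 + k) ^ a * (t : ℝ) ^ a := Real.mul_rpow (by positivity) (by positivity)
    _ ≤ _ := by gcongr

lemma rpow_neg_sub_le {s a : ℝ} (hs : 0 < s) (ha : a ≤ 1) :
    s ^ (-a) - (s + 1) ^ (-a) ≤ s ^ (-a) / (s + 1) := by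
  have h := div_add_mul_rpow_neg_le hs zero_le_one ha
  have : s / (s + 1) * s ^ (-a) = s ^ (-a) - s ^ (-a) / (s + 1) := by field_simp; ring
  linarith

lemma rpow_add_one_sub_le {s a : ℝ} (hs : 0 < s) (ha : a ≤ 1) :
    (s + 1) ^ a - s ^ a ≤ s ^ (a - 1) := by
  have h1 : ((s + 1) / s) ^ a ≤ (s + 1) / s := by
    have := Real.rpow_le_rpow_of_exponent_le (x := (s + 1) / s)
      (by rw [le_div_iff₀ hs]; linarith) ha
    rwa [Real.rpow_one] at this
  rw [Real.div_rpow (by linarith) hs.le, div_le_iff₀ (by positivity)] at h1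
  have : (s + 1) / s * s ^ a = s ^ a + s ^ (a - 1) := by
    rw [Real.rpow_sub_one hs.ne']; field_simp
  linarith

/-- A nonpositive power eventually drops below any threshold, with a summably small overshoot. -/
lemma exists_rpow_neg_sub_le {A μ a : ℝ} (hA : 0 ≤ A) (hμ : 0 < μ) (ha : 0 < a) :
    ∃ K : ℝ, 0 ≤ K ∧ ∀ t : ℕ, 1 ≤ t → A * (t : ℝ) ^ (-a) - μ ≤ K * (t : ℝ) ^ (-1 : ℝ) := by
  have h1 : Filter.Tendsto (fun t : ℕ => A * (t : ℝ) ^ (-a)) Filter.atTop (nhds (A * 0)) :=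
    ((tendsto_rpow_neg_atTop ha).comp tendsto_natCast_atTop_atTop).const_mul A
  rw [mul_zero] at h1
  obtain ⟨N, hN⟩ := Filter.eventually_atTop.1 (h1.eventually (gt_mem_nhds hμ))
  -- From `N` on the left side is negative; for smaller `t` the factor `N / t` is at least `1`.
  refine ⟨A * N, by positivity, fun t ht => ?_⟩
  have htp : (1 : ℝ) ≤ t := by exact_mod_cast ht
  rcases le_or_gt N t with h | h
  · have := hN t h
    have h2 : 0 ≤ A * N * (t : ℝ) ^ (-1 : ℝ) := by positivity
    linarith
  · have h2 : (t : ℝ) ^ (-a) ≤ 1 := Real.rpow_le_one_of_one_le_of_nonpos htp (by linarith)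
    have h3 : (t : ℝ) ≤ N := by exact_mod_cast h.le
    have h4 : A ≤ A * N * (t : ℝ) ^ (-1 : ℝ) := by
      rw [Real.rpow_neg_one, mul_assoc]
      apply le_mul_of_one_le_right hA
      rw [← div_eq_mul_inv, le_div_iff₀ (by linarith)]; linarith
    nlinarith

end PowerSums

/-! ### The componentwise positive part -/

section PosVec

variable {ι : Type*}

lemma posVec_nonneg (v : EuclideanSpace ℝ ι) (k : ι) : 0 ≤ posVec v k := le_max_right _ _

lemma posVec_of_nonneg {v : EuclideanSpace ℝ ι} (hv : ∀ k, 0 ≤ v k) : posVec v = v := by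
  ext k; exact max_eq_left (hv k)

lemma posVec_of_nonpos {v : EuclideanSpace ℝ ι} (hv : ∀ k, v k ≤ 0) : posVec v = 0 := by
  ext k; exact max_eq_right (hv k)

variable [Fintype ι]

lemma norm_le_norm_of_abs_le {v v' : EuclideanSpace ℝ ι} (h : ∀ k, |v k| ≤ |v' k|) :
    ‖v‖ ≤ ‖v'‖ := by
  rw [EuclideanSpace.norm_eq, EuclideanSpace.norm_eq]
  apply Real.sqrt_le_sqrt
  refine Finset.sum_le_sum fun k _ => ?_
  exact pow_le_pow_left₀ (norm_nonneg _) (h k) 2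

lemma norm_posVec_sub_le (v v' : EuclideanSpace ℝ ι) : ‖posVec v - posVec v'‖ ≤ ‖v - v'‖ := by
  apply norm_le_norm_of_abs_le
  intro k
  exact abs_max_sub_max_le_abs (v k) (v' k) 0

lemma norm_posVec_le (v : EuclideanSpace ℝ ι) : ‖posVec v‖ ≤ ‖v‖ := by
  have h := norm_posVec_sub_le v 0
  rwa [posVec_of_nonneg (v := (0 : EuclideanSpace ℝ ι)) fun k => le_refl _, sub_zero,
    sub_zero] at h

lemma inner_eq_sum_mul (v v' : EuclideanSpace ℝ ι) : inner ℝ v v' = ∑ k, v k * v' k := by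
  simp [PiLp.inner_apply, mul_comm]

lemma inner_nonneg_of_nonneg {v v' : EuclideanSpace ℝ ι} (h : ∀ k, 0 ≤ v k) (h' : ∀ k, 0 ≤ v' k) :
    0 ≤ inner ℝ v v' := by
  rw [inner_eq_sum_mul]
  exact Finset.sum_nonneg fun k _ => mul_nonneg (h k) (h' k)

lemma norm_le_sum_of_nonneg {v : EuclideanSpace ℝ ι} (h : ∀ k, 0 ≤ v k) : ‖v‖ ≤ ∑ k, v k := by
  rw [EuclideanSpace.norm_eq]
  apply Real.sqrt_le_iff.2 ⟨Finset.sum_nonneg fun k _ => h k, ?_⟩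
  simp only [Real.norm_eq_abs, sq_abs]
  exact Finset.sum_sq_le_sq_sum_of_nonneg fun k _ => h k

end PosVec

/-! ### Euclidean projection onto convex sets -/

section Projection

variable {d : ℕ} {K : Set (Vec d)}

lemma IsProjection.inner_le_zero (hK : Convex ℝ K) {w v : Vec d} (h : IsProjection K w v)
    {y : Vec d} (hy : y ∈ K) : inner ℝ (w - v) (y - v) ≤ 0 := by
  by_contra! hpos
  set c := inner ℝ (w - v) (y - v)
  have hN : 0 ≤ ‖y - v‖ ^ 2 := by positivity
  -- A step this short makes the gain `2 s c` exceed the quadratic loss `s² ‖y - v‖²`; the `+ 1`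
  -- keeps the denominator positive.
  set s := min 1 (c / (‖y - v‖ ^ 2 + 1)) with hs
  have hs0 : 0 < s := lt_min one_pos (by positivity)
  have hs1 : s ≤ 1 := min_le_left _ _
  have hs2 : s * (‖y - v‖ ^ 2 + 1) ≤ c := by
    rw [← le_div_iff₀ (by positivity)]; exact min_le_right _ _
  have hmem : v + s • (y - v) ∈ K := hK.add_smul_sub_mem h.1 hy ⟨hs0.le, hs1⟩
  have h1 : ‖w - v‖ ^ 2 ≤ ‖w - (v + s • (y - v))‖ ^ 2 := h.2 hmem
  rw [show w - (v + s • (y - v)) = (w - v) - s • (y - v) by abel, norm_sub_sq_real (w - v),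
    real_inner_smul_right, norm_smul, mul_pow, Real.norm_eq_abs, sq_abs] at h1
  nlinarith

lemma IsProjection.norm_sub_le (hK : Convex ℝ K) {w v w' v' : Vec d} (h : IsProjection K w v)
    (h' : IsProjection K w' v') : ‖v - v'‖ ≤ ‖w - w'‖ := by
  have h1 := h.inner_le_zero hK h'.1
  have h2 := h'.inner_le_zero hK h.1
  have h3 : ‖v - v'‖ ^ 2 ≤ inner ℝ (w - w') (v - v') := by
    have e1 : inner ℝ (w - v) (v' - v) = - inner ℝ (w - v) (v - v') := by
      rw [← inner_neg_right, neg_sub]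
    rw [e1] at h1
    rw [← real_inner_self_eq_norm_sq]
    have e2 : inner ℝ (w - w') (v - v') - inner ℝ (v - v') (v - v')
        = inner ℝ (w - v) (v - v') - inner ℝ (w' - v') (v - v') := by
      rw [← inner_sub_left, ← inner_sub_left]; congr 1; abel
    linarith
  have h4 := real_inner_le_norm (w - w') (v - v')
  by_contra! hcon
  have h5 : 0 < ‖v - v'‖ := (norm_nonneg _).trans_lt hcon
  nlinarith

lemma isProjection_self {y : Vec d} (hy : y ∈ K) : IsProjection K y y :=
  ⟨hy, fun v' _ => by simp⟩

lemma IsProjection.norm_sub_le_of_mem (hK : Convex ℝ K) {w v y : Vec d} (h : IsProjection K w v)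
    (hy : y ∈ K) : ‖v - y‖ ≤ ‖w - y‖ := h.norm_sub_le hK (isProjection_self hy)

end Projection

/-! ### Regularity of the Lagrangian and the one-point estimator -/

namespace OnlineProblem

variable {n p : ℕ} {m : Fin n → ℕ} {P : OnlineProblem n p m} {r R F₁ F₂ μ : ℝ}
  {dl : Fin n → ℕ → Vec p → Vec p} {dc : (i : Fin n) → ℕ → Vec p → (Vec p →L[ℝ] Vec (m i))}

/-- The local Lagrangian `l_{i,t}(x) + ⟪q, [c_{i,t}(x)]₊⟫`. -/
noncomputable def lagrangian (P : OnlineProblem n p m) (i : Fin n) (t : ℕ) (q : Vec (m i))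
    (x : Vec p) : ℝ :=
  P.loss i t x + inner ℝ q (posVec (P.con i t x))

/-- Both estimators are multiples of the same direction `u`, so together they form the one-point
estimator of the Lagrangian. -/
lemma estimator_eq (P : OnlineProblem n p m) (i : Fin n) (t : ℕ) (δ : ℝ) (q : Vec (m i))
    (e u : Vec p) :
    lossEstimator δ (P.loss i t) e u
      + WithLp.toLp 2 ((conEstimator δ (P.con i t) e u).mulVec q.ofLp)
      = ((p : ℝ) / δ * P.lagrangian i t q (e + δ • u)) • u := by
  ext k
  simp only [lossEstimator, conEstimator, lagrangian, PiLp.add_apply, PiLp.smul_apply, smul_eq_mul,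
    Matrix.mulVec, dotProduct, Matrix.smul_apply, Matrix.vecMulVec_apply, inner_eq_sum_mul]
  have : ∑ x, (p : ℝ) / δ * (u.ofLp k * (posVec (P.con i t (e + δ • u))).ofLp x) * q.ofLp x
      = (p : ℝ) / δ * u.ofLp k * ∑ x, q.ofLp x * (posVec (P.con i t (e + δ • u))).ofLp x := by
    rw [Finset.mul_sum]
    exact Finset.sum_congr rfl fun x _ => by ring
  rw [this]; ring

namespace IsRegular

lemma zero_mem (hP : P.IsRegular r R F₁ F₂ dl dc) (hr : 0 < r) : (0 : Vec p) ∈ P.X :=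
  hP.ball_subset (by simp [hr.le])

lemma norm_le (hP : P.IsRegular r R F₁ F₂ dl dc) {x : Vec p} (hx : x ∈ P.X) : ‖x‖ ≤ R := by
  simpa using hP.subset_ball hx

lemma R_nonneg (hP : P.IsRegular r R F₁ F₂ dl dc) (hr : 0 < r) : 0 ≤ R := by
  simpa using hP.norm_le (hP.zero_mem hr)

lemma abs_loss_sub_le (hP : P.IsRegular r R F₁ F₂ dl dc) (i : Fin n) {t : ℕ} (ht : 1 ≤ t)
    {x y : Vec p} (hx : x ∈ P.X) (hy : y ∈ P.X) :
    |P.loss i t x - P.loss i t y| ≤ F₂ * ‖x - y‖ := by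
  have key : ∀ {x y : Vec p}, x ∈ P.X → y ∈ P.X →
      P.loss i t x - P.loss i t y ≤ F₂ * ‖x - y‖ := fun {x y} hx hy => by
    have h1 := hP.subgrad_loss i t ht x hx y hy
    have h2 := neg_le_of_abs_le (abs_real_inner_le_norm (dl i t x) (y - x))
    have h3 := mul_le_mul_of_nonneg_right (hP.subgrad_loss_bound i t ht x hx) (norm_nonneg (y - x))
    rw [norm_sub_rev x y]
    linarith
  rw [abs_le]
  have := key hy hx
  rw [norm_sub_rev] at this
  exact ⟨by linarith, key hx hy⟩

/-- Depending on its sign, each component of the difference is dominated by the subgradient at `x`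
or by the one at `y`. Summing squares bounds the norm by `√2 F₂ ‖x - y‖`, rounded up to `2 F₂ ‖x -
y‖`. -/
lemma norm_con_sub_le (hP : P.IsRegular r R F₁ F₂ dl dc) (i : Fin n) {t : ℕ} (ht : 1 ≤ t)
    (hF₂ : 0 ≤ F₂) {x y : Vec p} (hx : x ∈ P.X) (hy : y ∈ P.X) :
    ‖P.con i t x - P.con i t y‖ ≤ 2 * F₂ * ‖x - y‖ := by
  have hsq : ∀ z : Vec p, z ∈ P.X → ‖dc i t z (x - y)‖ ^ 2 ≤ (F₂ * ‖x - y‖) ^ 2 := fun z hz => by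
    apply pow_le_pow_left₀ (norm_nonneg _)
    exact (ContinuousLinearMap.le_opNorm _ _).trans
      (mul_le_mul_of_nonneg_right (hP.subgrad_con_bound i t ht z hz) (norm_nonneg _))
  have h1 : ‖P.con i t x - P.con i t y‖ ^ 2
      ≤ ‖dc i t x (x - y)‖ ^ 2 + ‖dc i t y (x - y)‖ ^ 2 := by
    simp only [EuclideanSpace.norm_sq_eq, ← Finset.sum_add_distrib, Real.norm_eq_abs, sq_abs]
    refine Finset.sum_le_sum fun k _ => ?_
    have h2 := hP.subgrad_con i t ht x hx y hy k
    have h3 := hP.subgrad_con i t ht y hy x hx k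
    rw [← neg_sub x y, map_neg, PiLp.neg_apply] at h2
    rw [PiLp.sub_apply]
    rcases le_total 0 (P.con i t x k - P.con i t y k) with h | h
    · nlinarith [sq_nonneg ((dc i t y (x - y)) k)]
    · nlinarith [sq_nonneg ((dc i t x (x - y)) k)]
  apply le_of_sq_le_sq _ (by positivity)
  nlinarith [hsq x hx, hsq y hy]

lemma norm_posVec_con_le (hP : P.IsRegular r R F₁ F₂ dl dc) (i : Fin n) {t : ℕ} (ht : 1 ≤ t)
    {x : Vec p} (hx : x ∈ P.X) : ‖posVec (P.con i t x)‖ ≤ F₁ :=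
  (norm_posVec_le _).trans (hP.con_bound i t ht x hx)

lemma abs_inner_posVec_sub_le (hP : P.IsRegular r R F₁ F₂ dl dc) (i : Fin n) {t : ℕ} (ht : 1 ≤ t)
    (hF₂ : 0 ≤ F₂) (q : Vec (m i)) {x y : Vec p} (hx : x ∈ P.X) (hy : y ∈ P.X) :
    |inner ℝ q (posVec (P.con i t x)) - inner ℝ q (posVec (P.con i t y))|
      ≤ ‖q‖ * (2 * F₂ * ‖x - y‖) := by
  rw [← inner_sub_right]
  refine (abs_real_inner_le_norm _ _).trans (mul_le_mul_of_nonneg_left ?_ (norm_nonneg _))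
  exact (norm_posVec_sub_le _ _).trans (hP.norm_con_sub_le i ht hF₂ hx hy)

lemma abs_lagrangian_sub_le (hP : P.IsRegular r R F₁ F₂ dl dc) (i : Fin n) {t : ℕ} (ht : 1 ≤ t)
    (hF₂ : 0 ≤ F₂) (q : Vec (m i)) {x y : Vec p} (hx : x ∈ P.X) (hy : y ∈ P.X) :
    |P.lagrangian i t q x - P.lagrangian i t q y| ≤ (F₂ + 2 * F₂ * ‖q‖) * ‖x - y‖ := by
  have h1 := hP.abs_loss_sub_le i ht hx hy
  have h2 := hP.abs_inner_posVec_sub_le i ht hF₂ q hx hy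
  simp only [lagrangian]
  rw [abs_le] at *
  constructor <;> nlinarith

lemma abs_lagrangian_le (hP : P.IsRegular r R F₁ F₂ dl dc) (i : Fin n) {t : ℕ} (ht : 1 ≤ t)
    (q : Vec (m i)) {x : Vec p} (hx : x ∈ P.X) :
    |P.lagrangian i t q x| ≤ F₁ + ‖q‖ * F₁ := by
  refine (abs_add_le _ _).trans (add_le_add (hP.loss_bound i t ht x hx) ?_)
  exact (abs_real_inner_le_norm _ _).trans
    (mul_le_mul_of_nonneg_left (hP.norm_posVec_con_le i ht hx) (norm_nonneg _))

/-- Strong convexity at the intermediate point is tested against both end points: with weights `1 -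
s` and `s` the linear terms cancel and the quadratic ones combine to `s (1 - s)`. The penalty is
convex because `q ≥ 0` and positive parts of convex functions are convex. -/
lemma lagrangian_segment_le (hP : P.IsRegular r R F₁ F₂ dl dc)
    (hμ : P.LossStronglyConvex μ dl) (i : Fin n) {t : ℕ} (ht : 1 ≤ t)
    {q : Vec (m i)} (hq : ∀ k, 0 ≤ q k) {x y : Vec p} (hx : x ∈ P.X) (hy : y ∈ P.X) {s : ℝ}
    (hs : s ∈ Set.Icc (0 : ℝ) 1) :
    P.lagrangian i t q (x + s • (y - x)) ≤ (1 - s) * P.lagrangian i t q x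
      + s * P.lagrangian i t q y - s * (1 - s) * (μ / 2 * ‖y - x‖ ^ 2) := by
  set z := x + s • (y - x) with hz
  have hzX : z ∈ P.X := hP.convex_X.add_smul_sub_mem hx hy hs
  have h1 := hμ i t ht x hx z hzX
  have h2 := hμ i t ht y hy z hzX
  have ex : x - z = (-s) • (y - x) := by rw [hz, neg_smul]; abel
  have ey : y - z = (1 - s) • (y - x) := by rw [hz, sub_smul, one_smul]; abel
  rw [ex, real_inner_smul_left, norm_smul, mul_pow, Real.norm_eq_abs, sq_abs] at h1
  rw [ey, real_inner_smul_left, norm_smul, mul_pow, Real.norm_eq_abs, sq_abs] at h2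
  have h1' := mul_le_mul_of_nonneg_left h1 (sub_nonneg.2 hs.2)
  have h2' := mul_le_mul_of_nonneg_left h2 hs.1
  have hl : P.loss i t z ≤ (1 - s) * P.loss i t x + s * P.loss i t y
      - s * (1 - s) * (μ / 2 * ‖y - x‖ ^ 2) := by
    nlinarith
  have hc : inner ℝ q (posVec (P.con i t z)) ≤ (1 - s) * inner ℝ q (posVec (P.con i t x))
      + s * inner ℝ q (posVec (P.con i t y)) := by
    simp only [inner_eq_sum_mul, Finset.mul_sum, ← Finset.sum_add_distrib]
    refine Finset.sum_le_sum fun k _ => ?_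
    have h3 := (hP.convex_con i t ht k).2 hx hy (sub_nonneg.2 hs.2) hs.1 (by ring)
    have h4 : (1 - s) • x + s • y = z := by rw [hz, sub_smul, one_smul, smul_sub]; abel
    simp only [h4, smul_eq_mul] at h3
    have h5 : posVec (P.con i t z) k ≤ (1 - s) * posVec (P.con i t x) k
        + s * posVec (P.con i t y) k := by
      apply max_le
      · refine h3.trans (add_le_add ?_ ?_)
        · exact mul_le_mul_of_nonneg_left (le_max_left _ _) (sub_nonneg.2 hs.2)
        · exact mul_le_mul_of_nonneg_left (le_max_left _ _) hs.1
      · exact add_nonneg (mul_nonneg (sub_nonneg.2 hs.2) (posVec_nonneg _ _))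
          (mul_nonneg hs.1 (posVec_nonneg _ _))
    have := mul_le_mul_of_nonneg_left h5 (hq k)
    linarith
  simp only [lagrangian]
  linarith

/-- `X` is convex and contains `0`. As the shrinkage decreases in time, averages and comparators
admissible at time `t` stay admissible at time `t + 1`. -/
lemma smul_subset (hP : P.IsRegular r R F₁ F₂ dl dc) (hr : 0 < r) {ξ ξ' : ℝ}
    (hξ : ξ ≤ 1) (h : ξ' ≤ ξ) : (1 - ξ) • P.X ⊆ (1 - ξ') • P.X := by
  rintro _ ⟨x, hx, rfl⟩
  rcases eq_or_lt_of_le (h.trans hξ) with h1 | h1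
  · have : ξ = ξ' := by linarith
    rw [this]; exact ⟨x, hx, rfl⟩
  · refine ⟨((1 - ξ) / (1 - ξ')) • x, ?_, ?_⟩
    · have h2 : (0 : ℝ) < 1 - ξ' := by linarith
      apply hP.convex_X.smul_mem_of_zero_mem (hP.zero_mem hr) hx
      exact ⟨div_nonneg (by linarith) h2.le, by rw [div_le_one h2]; linarith⟩
    · have h2 : (1 : ℝ) - ξ' ≠ 0 := by linarith
      simp only [smul_smul]
      rw [mul_div_cancel₀ _ h2]

lemma smul_subset_self (hP : P.IsRegular r R F₁ F₂ dl dc) (hr : 0 < r) {ξ : ℝ}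
    (hξ : ξ ∈ Set.Icc (0 : ℝ) 1) : (1 - ξ) • P.X ⊆ P.X := by
  have := hP.smul_subset hr hξ.2 hξ.1
  simpa using this

/-- The point is a convex combination, with weights `1 - ξ` and `ξ`, of a point of `X` and a point
of the ball of radius `r`; this is why the exploration radius is `r ξ`. -/
lemma add_smul_mem (hP : P.IsRegular r R F₁ F₂ dl dc) (hr : 0 < r) {ξ : ℝ}
    (hξ : ξ ∈ Set.Icc (0 : ℝ) 1) {e v : Vec p} (he : e ∈ (1 - ξ) • P.X) (hv : ‖v‖ ≤ 1) :
    e + (r * ξ) • v ∈ P.X := by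
  obtain ⟨x, hx, rfl⟩ := he
  have h1 : r • v ∈ P.X := by
    apply hP.ball_subset
    simp only [Metric.mem_closedBall, dist_zero_right, norm_smul, Real.norm_of_nonneg hr.le]
    nlinarith
  have := hP.convex_X hx h1 (sub_nonneg.2 hξ.2) hξ.1 (by ring)
  rwa [smul_smul, mul_comm ξ r] at this

/-- The one-point estimator is, in expectation over the sphere, a subgradient of the Lagrangian at
`e` up to an error of the order of the smoothing radius. -/
theorem lagrangian_sub_le_integral_estimator (hP : P.IsRegular r R F₁ F₂ dl dc)
    (hμ : P.LossStronglyConvex μ dl) (hp : 0 < p) (hr : 0 < r) (hF₂ : 0 ≤ F₂) (i : Fin n)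
    {t : ℕ} (ht : 1 ≤ t) {q : Vec (m i)} (hq : ∀ k, 0 ≤ q k) {ξ : ℝ}
    (hξ : ξ ∈ Set.Ioc (0 : ℝ) 1) {e y : Vec p} (he : e ∈ (1 - ξ) • P.X)
    (hy : y ∈ (1 - ξ) • P.X) :
    P.lagrangian i t q e - P.lagrangian i t q y + μ / 2 * ‖e - y‖ ^ 2
        - 2 * ((F₂ + 2 * F₂ * ‖q‖) * (r * ξ))
      ≤ ∫ u, (p : ℝ) / (r * ξ) * P.lagrangian i t q (e + (r * ξ) • (u : Vec p))
          * inner ℝ (u : Vec p) (e - y) ∂(uniformSphere p) := by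
  set δ := r * ξ with hδ
  have hδ0 : 0 < δ := mul_pos hr hξ.1
  have hξ' : ξ ∈ Set.Icc (0 : ℝ) 1 := ⟨hξ.1.le, hξ.2⟩
  set K := F₂ + 2 * F₂ * ‖q‖ with hK
  have hK0 : 0 ≤ K := by positivity
  have hlip : LipschitzOnWith K.toNNReal (P.lagrangian i t q) P.X := by
    apply LipschitzOnWith.of_dist_le_mul
    intro x hx x' hx'
    rw [Real.coe_toNNReal _ hK0, Real.dist_eq, dist_eq_norm]
    exact hP.abs_lagrangian_sub_le i ht hF₂ q hx hx'
  -- The Lagrangian is controlled on `X` only, whereas the sphere inequality is for functions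
  -- Lipschitz on the whole space.
  obtain ⟨H, hHlip, hH⟩ := hlip.extend_real
  have hf : LipschitzWith (K.toNNReal * δ.toNNReal) (fun v => H (e + δ • v)) := by
    apply hHlip.comp
    apply LipschitzWith.of_dist_le_mul
    intro x x'
    rw [Real.coe_toNNReal _ hδ0.le, dist_add_left, dist_eq_norm, ← smul_sub, norm_smul,
      Real.norm_of_nonneg hδ0.le, dist_eq_norm]
  have hyX := hP.smul_subset_self hr hξ' hy
  have heX := hP.smul_subset_self hr hξ' he
  have hev : ∀ v : Vec p, ‖v‖ ≤ 1 → e + δ • v ∈ P.X := fun v hv => hP.add_smul_mem hr hξ' he hv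
  have hyv : ∀ v : Vec p, ‖v‖ ≤ 1 → y + δ • v ∈ P.X := fun v hv => hP.add_smul_mem hr hξ' hy hv
  have hsh : ∀ v : Vec p, e + δ • (v + δ⁻¹ • (y - e)) = y + δ • v := fun v => by
    rw [smul_add, smul_smul, mul_inv_cancel₀ hδ0.ne', one_smul]; abel
  have hsh2 : ∀ (v : Vec p) (s : ℝ), e + δ • (v + s • δ⁻¹ • (y - e))
      = (e + δ • v) + s • ((y + δ • v) - (e + δ • v)) := fun v s => by
    rw [smul_add, smul_comm s, smul_smul δ, mul_inv_cancel₀ hδ0.ne', one_smul,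
      add_sub_add_right_eq_sub]; abel
  -- The shift `(y - e)/δ` carries the `δ`-ball around `e` onto the one around `y`, both inside `X`.
  -- Recentering the values at `y` and at `e` costs `K δ` each.
  have key := integral_uniformSphere_mul_inner_le hp hf (h := δ⁻¹ • (y - e))
    (d := P.lagrangian i t q y - P.lagrangian i t q e + 2 * (K * δ)) (κ := μ / 2 * ‖e - y‖ ^ 2)
    (by
      intro v hv s hs
      have hs' : s ∈ Set.Icc (0 : ℝ) 1 := ⟨hs.1.le, hs.2.le⟩
      rw [hsh, hsh2, ← hH (hP.convex_X.add_smul_sub_mem (hev v hv.le) (hyv v hv.le) hs'),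
        ← hH (hev v hv.le), ← hH (hyv v hv.le)]
      have := hP.lagrangian_segment_le hμ i ht hq (hev v hv.le) (hyv v hv.le) hs'
      rw [add_sub_add_right_eq_sub, norm_sub_rev y e] at this
      rwa [add_sub_add_right_eq_sub])
    (by
      intro v hv
      rw [hsh, ← hH (hev v hv.le), ← hH (hyv v hv.le)]
      have hnv : ‖δ • v‖ ≤ δ := by
        rw [norm_smul, Real.norm_of_nonneg hδ0.le]; nlinarith
      have h1 := (abs_le.1 (hP.abs_lagrangian_sub_le i ht hF₂ q (hyv v hv.le) hyX)).2
      have h2 := (abs_le.1 (hP.abs_lagrangian_sub_le i ht hF₂ q (hev v hv.le) heX)).1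
      rw [add_sub_cancel_left] at h1 h2
      have := mul_le_mul_of_nonneg_left hnv hK0
      linarith)
  have hint : ∫ u, (p : ℝ) / δ * P.lagrangian i t q (e + δ • (u : Vec p))
          * inner ℝ (u : Vec p) (e - y) ∂(uniformSphere p)
      = -(p * ∫ u, H (e + δ • (u : Vec p)) * inner ℝ (u : Vec p) (δ⁻¹ • (y - e))
          ∂(uniformSphere p)) := by
    rw [← integral_const_mul, ← integral_neg]
    congr 1
    ext u
    have hu : ‖(u : Vec p)‖ ≤ 1 := by simp
    rw [← hH (hev u hu), real_inner_smul_right, ← neg_sub e y, inner_neg_right]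
    ring
  rw [hint]
  linarith

end IsRegular

end OnlineProblem

/-! ### Parameter sequences and sample paths -/

/-- The step size `α_t = r² / (20 p² F₁² (t + 1)^{g₁})`. -/
noncomputable def stepSize (p : ℕ) (r F₁ g₁ : ℝ) (t : ℕ) : ℝ :=
  r ^ 2 / (20 * (p : ℝ) ^ 2 * F₁ ^ 2 * ((t : ℝ) + 1) ^ g₁)

/-- The shrinkage parameter `ξ_t = (t + 1)^{-g₃}`. -/
noncomputable def shrinkage (g₃ : ℝ) (t : ℕ) : ℝ := 1 / ((t : ℝ) + 1) ^ g₃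

/-- A sample path of the algorithm with the polynomial parameter sequences, together with the
standing assumptions on the problem and the network. -/
structure IsPolyRun {n p : ℕ} {m : Fin n → ℕ} (r R F₁ F₂ w : ℝ) (B : ℕ) (g₁ g₂ g₃ : ℝ)
    (P : OnlineProblem n p m) (dl : Fin n → ℕ → Vec p → Vec p)
    (dc : (i : Fin n) → ℕ → Vec p → (Vec p →L[ℝ] Vec (m i)))
    (G : ℕ → Digraph (Fin n)) (W : ℕ → Matrix (Fin n) (Fin n) ℝ) (e₁ : Fin n → Vec p)
    (u : ℕ → Fin n → Vec p) (S : Trajectory n p m) : Prop where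
  p_pos : 0 < p
  r_pos : 0 < r
  F₁_pos : 0 < F₁
  F₂_pos : 0 < F₂
  g₁_mem : g₁ ∈ Set.Ioo (0 : ℝ) 1
  g₂_mem : g₂ ∈ Set.Ioo (0 : ℝ) (g₁ / 4)
  g₃_mem : g₃ ∈ Set.Ioo g₂ ((g₁ - 2 * g₂) / 2)
  regular : P.IsRegular r R F₁ F₂ dl dc
  mixing : IsMixingNetwork G W w B
  unit : ∀ t i, ‖u t i‖ = 1
  run : IsRun P W (stepSize p r F₁ g₁) (fun t => 2 / (t : ℝ) ^ g₂)
    (fun t => 1 / (t : ℝ) ^ (1 - g₂)) (shrinkage g₃) (fun t => r / ((t : ℝ) + 1) ^ g₃) e₁ u S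

section Parameters

lemma shrinkage_eq (g₃ : ℝ) (t : ℕ) : shrinkage g₃ t = ((t : ℝ) + 1) ^ (-g₃) := by
  rw [shrinkage, Real.rpow_neg (by positivity), one_div]

lemma shrinkage_pos (g₃ : ℝ) (t : ℕ) : 0 < shrinkage g₃ t := by
  rw [shrinkage]; positivity

lemma shrinkage_le_one {g₃ : ℝ} (h : 0 ≤ g₃) (t : ℕ) : shrinkage g₃ t ≤ 1 := by
  rw [shrinkage_eq]
  exact Real.rpow_le_one_of_one_le_of_nonpos (by simp) (by linarith)

lemma shrinkage_succ_le {g₃ : ℝ} (h : 0 ≤ g₃) (t : ℕ) : shrinkage g₃ (t + 1) ≤ shrinkage g₃ t := by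
  rw [shrinkage_eq, shrinkage_eq]
  exact Real.rpow_le_rpow_of_nonpos (by positivity) (by push_cast; linarith) (by linarith)

lemma shrinkage_le_rpow {g₃ : ℝ} (h : 0 ≤ g₃) {t : ℕ} (ht : 1 ≤ t) :
    shrinkage g₃ t ≤ (t : ℝ) ^ (-g₃) := by
  have : (0 : ℝ) < t := by exact_mod_cast ht
  rw [shrinkage_eq]
  exact Real.rpow_le_rpow_of_nonpos this (by linarith) (by linarith)

end Parameters

/-! ### Pathwise bounds for the primal and dual iterates -/

namespace IsPolyRun

variable {n p : ℕ} {m : Fin n → ℕ} {r R F₁ F₂ w : ℝ} {B : ℕ} {g₁ g₂ g₃ : ℝ}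
  {P : OnlineProblem n p m} {dl : Fin n → ℕ → Vec p → Vec p}
  {dc : (i : Fin n) → ℕ → Vec p → (Vec p →L[ℝ] Vec (m i))}
  {G : ℕ → Digraph (Fin n)} {W : ℕ → Matrix (Fin n) (Fin n) ℝ} {e₁ : Fin n → Vec p}
  {u : ℕ → Fin n → Vec p} {S : Trajectory n p m}

section

variable (h : IsPolyRun r R F₁ F₂ w B g₁ g₂ g₃ P dl dc G W e₁ u S)
include h

lemma g₃_pos : 0 < g₃ := h.g₂_mem.1.trans h.g₃_mem.1

lemma g₃_lt_one : g₃ < 1 := by linarith [h.g₃_mem.2, h.g₂_mem.1, h.g₁_mem.2]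

lemma g₂_lt_one : g₂ < 1 := h.g₃_mem.1.trans h.g₃_lt_one

lemma shrinkage_mem (t : ℕ) : shrinkage g₃ t ∈ Set.Ioc (0 : ℝ) 1 :=
  ⟨shrinkage_pos _ _, shrinkage_le_one h.g₃_pos.le _⟩

lemma e_mem {t : ℕ} (ht : 1 ≤ t) (i : Fin n) : S.e t i ∈ (1 - shrinkage g₃ t) • P.X := by
  rcases Nat.exists_eq_add_of_le' ht with ⟨k, rfl⟩
  rcases Nat.eq_zero_or_pos k with rfl | hk
  · rw [zero_add, h.run.init_e]; exact h.run.init_mem i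
  · exact (h.run.step_e k hk i).1

lemma e_mem_X {t : ℕ} (ht : 1 ≤ t) (i : Fin n) : S.e t i ∈ P.X :=
  h.regular.smul_subset_self h.r_pos (Set.Ioc_subset_Icc_self (h.shrinkage_mem t)) (h.e_mem ht i)

lemma norm_e_le {t : ℕ} (ht : 1 ≤ t) (i : Fin n) : ‖S.e t i‖ ≤ R :=
  h.regular.norm_le (h.e_mem_X ht i)

lemma x_eq {t : ℕ} (ht : 1 ≤ t) (i : Fin n) :
    S.x t i = S.e t i + (r * shrinkage g₃ t) • u t i := by
  rw [shrinkage, mul_one_div]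
  rcases Nat.exists_eq_add_of_le' ht with ⟨k, rfl⟩
  rcases Nat.eq_zero_or_pos k with rfl | hk
  · exact h.run.init_x i
  · exact h.run.step_x k hk i

lemma x_mem {t : ℕ} (ht : 1 ≤ t) (i : Fin n) : S.x t i ∈ P.X := by
  rw [h.x_eq ht]
  exact h.regular.add_smul_mem h.r_pos (Set.Ioc_subset_Icc_self (h.shrinkage_mem t))
    (h.e_mem ht i) (h.unit t i).le

lemma norm_x_sub_e_le {t : ℕ} (ht : 1 ≤ t) (i : Fin n) :
    ‖S.x t i - S.e t i‖ ≤ r * (t : ℝ) ^ (-g₃) := by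
  rw [h.x_eq ht, add_sub_cancel_left, norm_smul, h.unit, mul_one,
    Real.norm_of_nonneg (mul_nonneg h.r_pos.le (shrinkage_pos _ _).le)]
  exact mul_le_mul_of_nonneg_left (shrinkage_le_rpow h.g₃_pos.le ht) h.r_pos.le

lemma q_nonneg {t : ℕ} (ht : 1 ≤ t) (i : Fin n) (k : Fin (m i)) : 0 ≤ S.q t i k := by
  rcases Nat.exists_eq_add_of_le' ht with ⟨k, rfl⟩
  rcases Nat.eq_zero_or_pos k with rfl | hk
  · rw [zero_add, h.run.init_q]; exact le_refl _
  · rw [h.run.step_q k hk i]; exact posVec_nonneg _ _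

omit h in
lemma two_div_mul_one_div (g₂ : ℝ) {s : ℝ} (hs : 0 < s) :
    2 / s ^ g₂ * (1 / s ^ (1 - g₂)) = 2 / s := by
  rw [div_mul_div_comm, mul_one, ← Real.rpow_add hs]; simp

/-- For `t ≥ 1` the factor `1 - 2/(t+1)` is nonnegative, so the outer positive part of the update
acts trivially. -/
lemma q_step {t : ℕ} (ht : 1 ≤ t) (i : Fin n) :
    S.q (t + 1) i = (1 - 2 / ((t : ℝ) + 1)) • S.q t i
      + (1 / ((t : ℝ) + 1) ^ (1 - g₂)) • posVec (P.con i t (S.x t i)) := by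
  have hs := h.run.step_q t ht i
  have htp : (0 : ℝ) < (t : ℝ) + 1 := by positivity
  have ht1 : (1 : ℝ) ≤ t := by exact_mod_cast ht
  push_cast at hs
  rw [two_div_mul_one_div g₂ htp] at hs
  rw [hs]
  apply posVec_of_nonneg
  intro k
  simp only [PiLp.add_apply, PiLp.smul_apply, smul_eq_mul]
  apply add_nonneg
  · apply mul_nonneg _ (h.q_nonneg ht i k)
    rw [sub_nonneg, div_le_one htp]; linarith
  · exact mul_nonneg (by positivity) (posVec_nonneg _ _)

/-- The bound reproduces itself exactly: with `s = t + 1`, `(1 - 2/s) (F₁/2) s^g₂ + F₁ s^g₂ / s =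
(F₁/2) s^g₂`. -/
lemma norm_q_le {t : ℕ} (ht : 1 ≤ t) (i : Fin n) : ‖S.q t i‖ ≤ F₁ / 2 * (t : ℝ) ^ g₂ := by
  induction t, ht using Nat.le_induction with
  | base =>
    rw [h.run.init_q, norm_zero]
    have := h.F₁_pos
    positivity
  | succ t ht ih =>
    have htp : (0 : ℝ) < (t : ℝ) + 1 := by positivity
    have ht1 : (1 : ℝ) ≤ t := by exact_mod_cast ht
    have hc : 0 ≤ 1 - 2 / ((t : ℝ) + 1) := by rw [sub_nonneg, div_le_one htp]; linarith
    have hF := h.F₁_pos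
    rw [h.q_step ht]
    refine (norm_add_le _ _).trans ?_
    rw [norm_smul, norm_smul, Real.norm_of_nonneg hc, Real.norm_of_nonneg (by positivity)]
    have h1 : (t : ℝ) ^ g₂ ≤ ((t : ℝ) + 1) ^ g₂ :=
      Real.rpow_le_rpow (by positivity) (by linarith) h.g₂_mem.1.le
    have h2 := h.regular.norm_posVec_con_le i ht (h.x_mem ht i)
    have h3 : 1 / ((t : ℝ) + 1) ^ (1 - g₂) = ((t : ℝ) + 1) ^ g₂ / ((t : ℝ) + 1) := by
      rw [Real.rpow_sub htp, Real.rpow_one, one_div_div]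
    rw [h3]
    push_cast
    calc _ ≤ (1 - 2 / ((t : ℝ) + 1)) * (F₁ / 2 * ((t : ℝ) + 1) ^ g₂)
          + ((t : ℝ) + 1) ^ g₂ / ((t : ℝ) + 1) * F₁ := by
          apply add_le_add
          · apply mul_le_mul_of_nonneg_left _ hc
            exact ih.trans (mul_le_mul_of_nonneg_left h1 (by positivity))
          · exact mul_le_mul_of_nonneg_left h2 (by positivity)
      _ = F₁ / 2 * ((t : ℝ) + 1) ^ g₂ := by field_simp; ring

lemma dir_eq {t : ℕ} (ht : 1 ≤ t) (i : Fin n) :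
    S.dir (t + 1) i = ((p : ℝ) / (r * shrinkage g₃ t)
      * P.lagrangian i t (S.q t i) (S.x t i)) • u t i := by
  rw [h.run.step_dir t ht i, OnlineProblem.estimator_eq, h.x_eq ht, shrinkage, mul_one_div]

lemma norm_dir_le {t : ℕ} (ht : 1 ≤ t) (i : Fin n) :
    ‖S.dir (t + 1) i‖ ≤ 2 * p / r * (F₁ + F₁ ^ 2) * (t : ℝ) ^ (g₂ + g₃) := by
  have htp : (0 : ℝ) < t := by exact_mod_cast ht
  have ht1 : (1 : ℝ) ≤ t := by exact_mod_cast ht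
  have hF := h.F₁_pos
  have hr := h.r_pos
  rw [h.dir_eq ht, norm_smul, h.unit, mul_one, Real.norm_eq_abs, abs_mul,
    abs_of_nonneg (div_nonneg (Nat.cast_nonneg p) (mul_nonneg hr.le (shrinkage_pos _ _).le))]
  have h1 := h.regular.abs_lagrangian_le i ht (S.q t i) (h.x_mem ht i)
  have h2 := h.norm_q_le ht i
  have h3 : 1 ≤ (t : ℝ) ^ g₂ := Real.one_le_rpow ht1 h.g₂_mem.1.le
  have h4 : |P.lagrangian i t (S.q t i) (S.x t i)| ≤ (F₁ + F₁ ^ 2) * (t : ℝ) ^ g₂ := by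
    nlinarith [mul_le_mul_of_nonneg_right h2 hF.le]
  have h5 : (p : ℝ) / (r * shrinkage g₃ t) ≤ 2 * p / r * (t : ℝ) ^ g₃ := by
    have h6 := rpow_add_natCast_le ht 1 (a := g₃) ⟨h.g₃_pos.le, h.g₃_lt_one.le⟩
    push_cast at h6
    rw [shrinkage, mul_one_div, div_div_eq_mul_div, div_mul_eq_mul_div, div_le_div_iff_of_pos_right hr]
    nlinarith [mul_le_mul_of_nonneg_left h6 (Nat.cast_nonneg (α := ℝ) p)]
  calc _ ≤ (2 * p / r * (t : ℝ) ^ g₃) * ((F₁ + F₁ ^ 2) * (t : ℝ) ^ g₂) :=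
        mul_le_mul h5 h4 (abs_nonneg _) (by positivity)
    _ = _ := by rw [Real.rpow_add htp]; ring

lemma stepSize_pos (t : ℕ) : 0 < stepSize p r F₁ g₁ t := by
  have h1 := h.F₁_pos
  have h2 := h.r_pos
  have h3 : (0 : ℝ) < p := by exact_mod_cast h.p_pos
  rw [stepSize]; positivity

lemma stepSize_succ_le {t : ℕ} (ht : 1 ≤ t) :
    stepSize p r F₁ g₁ (t + 1) ≤ r ^ 2 / (20 * (p : ℝ) ^ 2 * F₁ ^ 2) * (t : ℝ) ^ (-g₁) := by
  have h1 := h.F₁_pos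
  have h2 := h.r_pos
  have h3 : (0 : ℝ) < p := by exact_mod_cast h.p_pos
  have htp : (0 : ℝ) < t := by exact_mod_cast ht
  rw [stepSize, Real.rpow_neg htp.le, ← div_eq_mul_inv, div_div]
  have h4 : (t : ℝ) ^ g₁ ≤ (((t + 1 : ℕ) : ℝ) + 1) ^ g₁ :=
    Real.rpow_le_rpow htp.le (by push_cast; linarith) h.g₁_mem.1.le
  gcongr

/-- The average already lies in the next constraint set, so nonexpansiveness leaves only the length
of the descent step. -/
lemma norm_e_sub_sum_le {t : ℕ} (ht : 1 ≤ t) (i : Fin n) :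
    ‖S.e (t + 1) i - ∑ j, W t i j • S.e t j‖
      ≤ stepSize p r F₁ g₁ (t + 1) * ‖S.dir (t + 1) i‖ := by
  rw [← h.run.step_z t ht i]
  have hK : Convex ℝ ((1 - shrinkage g₃ (t + 1)) • P.X) := h.regular.convex_X.smul _
  have hz : S.z (t + 1) i ∈ (1 - shrinkage g₃ (t + 1)) • P.X := by
    apply h.regular.smul_subset h.r_pos (h.shrinkage_mem t).2 (shrinkage_succ_le h.g₃_pos.le t)
    rw [h.run.step_z t ht i]
    have hW := h.mixing.doubly_stochastic t ht
    exact (h.regular.convex_X.smul _).sum_mem (fun j _ => nonneg_of_mem_doublyStochastic hW)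
      (sum_row_of_mem_doublyStochastic hW i) (fun j _ => h.e_mem ht j)
  refine ((h.run.step_e t ht i).norm_sub_le_of_mem hK hz).trans ?_
  rw [sub_sub_cancel_left, norm_neg, norm_smul, Real.norm_of_nonneg (h.stepSize_pos _).le]

lemma norm_e_sub_sum_le_rpow {t : ℕ} (ht : 1 ≤ t) (i : Fin n) :
    ‖S.e (t + 1) i - ∑ j, W t i j • S.e t j‖
      ≤ (r ^ 2 / (20 * (p : ℝ) ^ 2 * F₁ ^ 2) * (2 * p / r * (F₁ + F₁ ^ 2)))
        * (t : ℝ) ^ (-(g₁ - g₂ - g₃)) := by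
  have htp : (0 : ℝ) < t := by exact_mod_cast ht
  have hF := h.F₁_pos
  have hr := h.r_pos
  refine (h.norm_e_sub_sum_le ht i).trans ?_
  refine (mul_le_mul (h.stepSize_succ_le ht) (h.norm_dir_le ht i) (norm_nonneg _)
    (by positivity)).trans (le_of_eq ?_)
  rw [show -(g₁ - g₂ - g₃) = -g₁ + (g₂ + g₃) by ring,
    Real.rpow_add htp (-g₁) (g₂ + g₃)]
  ring

end

/-- Half the inverse step size at time `t + 1`, `1 / (2 α_{t+1})`. -/
noncomputable def invStep (p : ℕ) (r F₁ g₁ : ℝ) (t : ℕ) : ℝ :=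
  10 * (p : ℝ) ^ 2 * F₁ ^ 2 / r ^ 2 * ((t : ℝ) + 2) ^ g₁

section

variable (h : IsPolyRun r R F₁ F₂ w B g₁ g₂ g₃ P dl dc G W e₁ u S)
include h

lemma invStep_mul_stepSize (t : ℕ) :
    invStep p r F₁ g₁ t * (2 * stepSize p r F₁ g₁ (t + 1)) = 1 := by
  have h1 := h.F₁_pos
  have h2 := h.r_pos
  have h3 : (0 : ℝ) < p := by exact_mod_cast h.p_pos
  rw [invStep, stepSize, show (((t + 1 : ℕ) : ℝ) + 1) = (t : ℝ) + 2 by push_cast; ring]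
  have h4 : 0 < ((t : ℝ) + 2) ^ g₁ := by positivity
  field_simp
  norm_num

/-- Jensen's inequality along the rows of `W t`, then column sums equal to one: both halves of
double stochasticity are needed. -/
lemma sum_norm_sum_sub_sq_le {t : ℕ} (ht : 1 ≤ t) (y : Vec p) :
    ∑ i, ‖∑ j, W t i j • S.e t j - y‖ ^ 2 ≤ ∑ j, ‖S.e t j - y‖ ^ 2 := by
  have hW := h.mixing.doubly_stochastic t ht
  have h1 : ∀ i, ‖∑ j, W t i j • S.e t j - y‖ ^ 2 ≤ ∑ j, W t i j * ‖S.e t j - y‖ ^ 2 := by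
    intro i
    have h2 : ∑ j, W t i j • S.e t j - y = ∑ j, W t i j • (S.e t j - y) := by
      simp only [smul_sub, Finset.sum_sub_distrib, ← Finset.sum_smul,
        sum_row_of_mem_doublyStochastic hW i, one_smul]
    rw [h2]
    have h3 : ConvexOn ℝ Set.univ (fun v : Vec p => ‖v‖ ^ 2) :=
      convexOn_univ_norm.pow (fun _ _ => norm_nonneg _) 2
    exact h3.map_sum_le (fun j _ => nonneg_of_mem_doublyStochastic hW)
      (sum_row_of_mem_doublyStochastic hW i) (fun j _ => Set.mem_univ _)
  refine (Finset.sum_le_sum fun i _ => h1 i).trans (le_of_eq ?_)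
  rw [Finset.sum_comm]
  refine Finset.sum_congr rfl fun j _ => ?_
  rw [← Finset.sum_mul, sum_col_of_mem_doublyStochastic hW j, one_mul]

/-- One step of the primal update, summed over the agents. -/
lemma sum_inner_dir_le {CΔ : ℝ}
    (hΔ : ∀ t, 1 ≤ t → ∀ i j, ‖S.e t i - S.e t j‖ ≤ CΔ * (t : ℝ) ^ (-(g₁ - g₂ - g₃)))
    {t : ℕ} (ht : 1 ≤ t) {y : Vec p} (hy : y ∈ (1 - shrinkage g₃ t) • P.X) :
    ∑ i, inner ℝ (S.dir (t + 1) i) (S.e t i - y)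
      ≤ invStep p r F₁ g₁ t * (∑ i, ‖S.e t i - y‖ ^ 2 - ∑ i, ‖S.e (t + 1) i - y‖ ^ 2)
        + n * (2 * p / r * (F₁ + F₁ ^ 2)
          * (r ^ 2 / (20 * (p : ℝ) ^ 2 * F₁ ^ 2) * (2 * p / r * (F₁ + F₁ ^ 2)) + CΔ))
          * (t : ℝ) ^ (-g₁ + 2 * g₂ + 2 * g₃) := by
  set α := stepSize p r F₁ g₁ (t + 1) with hα
  set a := invStep p r F₁ g₁ t with ha
  set σ := -(g₁ - g₂ - g₃) with hσ
  set D := 2 * p / r * (F₁ + F₁ ^ 2) with hD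
  set A := r ^ 2 / (20 * (p : ℝ) ^ 2 * F₁ ^ 2) with hA
  have haα : a * (2 * α) = 1 := h.invStep_mul_stepSize t
  have hα0 : 0 < α := h.stepSize_pos _
  have ha0 : 0 < a := by
    by_contra! hcon
    nlinarith
  have htp : (0 : ℝ) < t := by exact_mod_cast ht
  have hr := h.r_pos
  have hF := h.F₁_pos
  have hD0 : 0 ≤ D := by positivity
  have hy' : y ∈ (1 - shrinkage g₃ (t + 1)) • P.X :=
    h.regular.smul_subset h.r_pos (h.shrinkage_mem t).2 (shrinkage_succ_le h.g₃_pos.le t) hy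
  have hW := h.mixing.doubly_stochastic t ht
  have key : ∀ i, inner ℝ (S.dir (t + 1) i) (S.e t i - y)
      ≤ a * (‖∑ j, W t i j • S.e t j - y‖ ^ 2 - ‖S.e (t + 1) i - y‖ ^ 2)
        + D * (A * D + CΔ) * (t : ℝ) ^ (-g₁ + 2 * g₂ + 2 * g₃) := by
    intro i
    set d := S.dir (t + 1) i
    set z := ∑ j, W t i j • S.e t j with hz
    have h1 := (h.run.step_e t ht i).norm_sub_le_of_mem (h.regular.convex_X.smul _) hy'
    rw [h.run.step_z t ht i, ← hz, ← hα,
      show z - α • d - y = (z - y) - α • d by abel] at h1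
    have h2 := pow_le_pow_left₀ (norm_nonneg _) h1 2
    rw [norm_sub_sq_real (z - y), real_inner_smul_right, norm_smul, mul_pow, Real.norm_eq_abs,
      sq_abs] at h2
    have h3 : ‖S.e t i - z‖ ≤ CΔ * (t : ℝ) ^ σ := by
      have := norm_sum_smul_le hW (fun j => S.e t i - S.e t j) (fun j => hΔ t ht i j) i
      simpa only [smul_sub, Finset.sum_sub_distrib, ← Finset.sum_smul,
        sum_row_of_mem_doublyStochastic hW i, one_smul] using this
    -- Splitting at the averaged point `z`: the projection inequality governs the part at `z`, the
    -- disagreement bound the remainder.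
    have h4 : inner ℝ d (S.e t i - y) = inner ℝ (z - y) d + inner ℝ d (S.e t i - z) := by
      rw [real_inner_comm d (z - y), ← inner_add_right]; congr 1; abel
    have h5 : inner ℝ d (S.e t i - z) ≤ ‖d‖ * (CΔ * (t : ℝ) ^ σ) :=
      (real_inner_le_norm _ _).trans (mul_le_mul_of_nonneg_left h3 (norm_nonneg _))
    have h6 : inner ℝ (z - y) d ≤ a * (‖z - y‖ ^ 2 - ‖S.e (t + 1) i - y‖ ^ 2) + α * ‖d‖ ^ 2 := by
      have h7 := mul_le_mul_of_nonneg_left h2 ha0.le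
      have h8 : a * (2 * (α * inner ℝ (z - y) d)) = inner ℝ (z - y) d := by
        rw [show a * (2 * (α * inner ℝ (z - y) d)) = (a * (2 * α)) * inner ℝ (z - y) d by ring,
          haα, one_mul]
      have h9 : a * (α ^ 2 * ‖d‖ ^ 2) = α * ‖d‖ ^ 2 / 2 := by
        rw [show a * (α ^ 2 * ‖d‖ ^ 2) = (a * (2 * α)) * (α * ‖d‖ ^ 2 / 2) by ring, haα, one_mul]
      have h10 : 0 ≤ α * ‖d‖ ^ 2 := by positivity
      nlinarith
    have h11 : ‖d‖ ≤ D * (t : ℝ) ^ (g₂ + g₃) := h.norm_dir_le ht i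
    have h12 : α ≤ A * (t : ℝ) ^ (-g₁) := h.stepSize_succ_le ht
    have hCΔ : 0 ≤ CΔ * (t : ℝ) ^ σ := (norm_nonneg _).trans h3
    -- This term and the quadratic one below share an exponent, because a descent step and the
    -- disagreement have the same rate.
    have h13 : ‖d‖ * (CΔ * (t : ℝ) ^ σ) ≤ D * CΔ * (t : ℝ) ^ (-g₁ + 2 * g₂ + 2 * g₃) := by
      refine (mul_le_mul_of_nonneg_right h11 hCΔ).trans (le_of_eq ?_)
      rw [show -g₁ + 2 * g₂ + 2 * g₃ = (g₂ + g₃) + σ by rw [hσ]; ring,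
        Real.rpow_add htp (g₂ + g₃) σ]
      ring
    have h14 : α * ‖d‖ ^ 2 ≤ D * (A * D) * (t : ℝ) ^ (-g₁ + 2 * g₂ + 2 * g₃) := by
      refine (mul_le_mul h12 (pow_le_pow_left₀ (norm_nonneg _) h11 2) (by positivity)
        (by positivity)).trans (le_of_eq ?_)
      rw [show -g₁ + 2 * g₂ + 2 * g₃ = -g₁ + ((g₂ + g₃) + (g₂ + g₃)) by ring,
        Real.rpow_add htp (-g₁) (g₂ + g₃ + (g₂ + g₃)), Real.rpow_add htp (g₂ + g₃) (g₂ + g₃)]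
      ring
    rw [h4]
    linarith
  refine (Finset.sum_le_sum fun i _ => key i).trans ?_
  rw [Finset.sum_add_distrib, ← Finset.mul_sum, Finset.sum_sub_distrib, Finset.sum_const,
    Finset.card_univ, Fintype.card_fin, nsmul_eq_mul, mul_assoc (n : ℝ)]
  have := mul_le_mul_of_nonneg_left (h.sum_norm_sum_sub_sq_le ht y) ha0.le
  linarith

/-- One step of the dual update, compared with a fixed multiplier `v ≥ 0`. -/
lemma dual_step {t : ℕ} (ht : 1 ≤ t) (i : Fin n) (v : Vec (m i)) :
    inner ℝ v (posVec (P.con i t (S.x t i)))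
        + ((t : ℝ) + 1) ^ (1 - g₂) / 2 * ‖S.q (t + 1) i - v‖ ^ 2
      ≤ inner ℝ (S.q t i) (posVec (P.con i t (S.x t i)))
        + (t : ℝ) ^ (1 - g₂) / 2 * ‖S.q t i - v‖ ^ 2
        + (t : ℝ) ^ (-g₂) * ‖v‖ ^ 2 + 2 * F₁ ^ 2 := by
  set q := S.q t i
  set c := posVec (P.con i t (S.x t i))
  set s : ℝ := (t : ℝ) + 1 with hs
  have ht1 : (1 : ℝ) ≤ t := by exact_mod_cast ht
  have hs0 : 0 < s := by positivity
  set Γ := s ^ (1 - g₂) with hΓ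
  set b := s ^ (-g₂) with hb
  have hΓ0 : 0 < Γ := by positivity
  have hb0 : 0 < b := by positivity
  have hΓb : Γ = s * b := by
    rw [hΓ, hb, show 1 - g₂ = 1 + -g₂ by ring, Real.rpow_add hs0, Real.rpow_one]
  have hF := h.F₁_pos
  have hg := h.g₂_mem.1
  have hΓ1 : 1 ≤ Γ := Real.one_le_rpow (by linarith) (by linarith [h.g₂_lt_one])
  have hq1 : S.q (t + 1) i - v = (q - v) + (1 / Γ) • (c - (2 * b) • q) := by
    rw [h.q_step ht, smul_sub, smul_smul, sub_smul, one_smul,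
      show 1 / Γ * (2 * b) = 2 / s by rw [hΓb]; field_simp]
    abel
  have hbt : b ≤ (t : ℝ) ^ (-g₂) := Real.rpow_le_rpow_of_nonpos (by linarith) (by linarith)
    (by linarith)
  have hcb : ‖c - (2 * b) • q‖ ≤ 2 * F₁ := by
    have h1 : ‖c‖ ≤ F₁ := h.regular.norm_posVec_con_le i ht (h.x_mem ht i)
    have h2 : ‖q‖ ≤ F₁ / 2 * (t : ℝ) ^ g₂ := h.norm_q_le ht i
    have h3 : (t : ℝ) ^ g₂ * (t : ℝ) ^ (-g₂) = 1 := by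
      rw [← Real.rpow_add (by linarith)]; simp
    have h4 : b * ‖q‖ ≤ (t : ℝ) ^ (-g₂) * (F₁ / 2 * (t : ℝ) ^ g₂) :=
      mul_le_mul hbt h2 (norm_nonneg _) (by positivity)
    refine (norm_sub_le _ _).trans ?_
    rw [norm_smul, Real.norm_of_nonneg (by positivity)]
    nlinarith
  have hexp : ‖S.q (t + 1) i - v‖ ^ 2 = ‖q - v‖ ^ 2
      + 2 * (1 / Γ * inner ℝ (q - v) (c - (2 * b) • q)) + (1 / Γ) ^ 2 * ‖c - (2 * b) • q‖ ^ 2 := by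
    rw [hq1, norm_add_sq_real, real_inner_smul_right, norm_smul, mul_pow, Real.norm_eq_abs, sq_abs]
  -- From `2 ⟪q - v, q⟫ = ‖q‖² + ‖q - v‖² - ‖v‖²`: the regularization of the dual update yields a
  -- negative multiple of `‖q - v‖²`.
  have hinner : inner ℝ (q - v) (c - (2 * b) • q)
      = inner ℝ q c - inner ℝ v c - b * (‖q‖ ^ 2 + ‖q - v‖ ^ 2 - ‖v‖ ^ 2) := by
    rw [inner_sub_right, inner_sub_left, real_inner_smul_right, inner_sub_left,
      real_inner_self_eq_norm_sq, norm_sub_sq_real q v, real_inner_comm v q]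
    ring
  have h5 : Γ / 2 * ‖S.q (t + 1) i - v‖ ^ 2 = Γ / 2 * ‖q - v‖ ^ 2
      + inner ℝ (q - v) (c - (2 * b) • q) + 1 / Γ / 2 * ‖c - (2 * b) • q‖ ^ 2 := by
    rw [hexp]; field_simp
  have h6 : 1 / Γ / 2 * ‖c - (2 * b) • q‖ ^ 2 ≤ 2 * F₁ ^ 2 := by
    have h7 : ‖c - (2 * b) • q‖ ^ 2 ≤ (2 * F₁) ^ 2 := pow_le_pow_left₀ (norm_nonneg _) hcb 2
    have h8 : 1 / Γ ≤ 1 := by rw [div_le_one hΓ0]; exact hΓ1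
    have h9 : 0 < 1 / Γ := by positivity
    nlinarith [mul_nonneg (sub_nonneg.2 h8) (sq_nonneg ‖c - (2 * b) • q‖)]
  -- Since `Γ = (t + 1) b`, the left side is `(t - 1) b / 2`. The regularization thus pays for the
  -- growth of the weight, and the inequality telescopes.
  have h10 : Γ / 2 - b ≤ (t : ℝ) ^ (1 - g₂) / 2 := by
    have h11 : (t : ℝ) ^ (1 - g₂) = t * (t : ℝ) ^ (-g₂) := by
      rw [show 1 - g₂ = 1 + -g₂ by ring, Real.rpow_add (by linarith), Real.rpow_one]
    rw [h11, hΓb, hs]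
    nlinarith
  rw [h5, hinner]
  have h12 := mul_le_mul_of_nonneg_right h10 (sq_nonneg ‖q - v‖)
  have h13 := mul_le_mul_of_nonneg_right hbt (sq_nonneg ‖v‖)
  have h14 : 0 ≤ b * ‖q‖ ^ 2 := by positivity
  linarith

/-- Telescoping of `dual_step`; the extra `1` pays for the initial distance from `q = 0` to `v`. -/
lemma dual_sum (i : Fin n) (v : Vec (m i)) (T : ℕ) :
    ∑ t ∈ Finset.Icc 1 T, inner ℝ v (posVec (P.con i t (S.x t i)))
        + ((T : ℝ) + 1) ^ (1 - g₂) / 2 * ‖S.q (T + 1) i - v‖ ^ 2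
      ≤ ∑ t ∈ Finset.Icc 1 T, inner ℝ (S.q t i) (posVec (P.con i t (S.x t i)))
        + (1 + ∑ t ∈ Finset.Icc 1 T, (t : ℝ) ^ (-g₂)) * ‖v‖ ^ 2 + 2 * F₁ ^ 2 * T := by
  induction T with
  | zero =>
    rw [zero_add, h.run.init_q]
    simp only [zero_lt_one, Finset.Icc_eq_empty_of_lt, Finset.sum_empty, Nat.cast_zero, zero_add,
      Real.one_rpow, zero_sub, norm_neg, mul_zero, add_zero, one_mul]
    nlinarith [sq_nonneg ‖v‖]
  | succ T ih =>
    have h1 := h.dual_step (t := T + 1) (by omega) i v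
    rw [Finset.sum_Icc_succ_top (by omega), Finset.sum_Icc_succ_top (by omega),
      Finset.sum_Icc_succ_top (by omega)]
    push_cast at h1 ⊢
    linarith

/-- A constant multiplier suffices because a nonnegative vector has norm at most the sum of its
components; `m i * V ^ 2` is its squared norm. -/
lemma norm_con_sum_le (i : Fin n) {V : ℝ} (hV : 0 ≤ V) (T : ℕ) :
    V * ∑ t ∈ Finset.Icc 1 T, ‖posVec (P.con i t (S.x t i))‖
      ≤ ∑ t ∈ Finset.Icc 1 T, inner ℝ (S.q t i) (posVec (P.con i t (S.x t i)))
        + (1 + ∑ t ∈ Finset.Icc 1 T, (t : ℝ) ^ (-g₂)) * (m i * V ^ 2) + 2 * F₁ ^ 2 * T := by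
  set v : Vec (m i) := WithLp.toLp 2 fun _ => V with hv
  have h1 := h.dual_sum i v T
  have h2 : ‖v‖ ^ 2 = m i * V ^ 2 := by
    rw [EuclideanSpace.norm_sq_eq]
    simp [hv]
  have h3 : V * ∑ t ∈ Finset.Icc 1 T, ‖posVec (P.con i t (S.x t i))‖
      ≤ ∑ t ∈ Finset.Icc 1 T, inner ℝ v (posVec (P.con i t (S.x t i))) := by
    rw [Finset.mul_sum]
    refine Finset.sum_le_sum fun t _ => ?_
    rw [inner_eq_sum_mul]
    simp only [hv, ← Finset.mul_sum]
    exact mul_le_mul_of_nonneg_left (norm_le_sum_of_nonneg (posVec_nonneg _)) hV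
  rw [h2] at h1
  have h4 : 0 ≤ ((T : ℝ) + 1) ^ (1 - g₂) / 2 * ‖S.q (T + 1) i - v‖ ^ 2 := by positivity
  linarith

end

end IsPolyRun

/-! ### Weighted distances to a moving comparator -/

/-- Telescoping of the weighted squared distances to a moving comparator; strong convexity absorbs
the growth of the weights. -/
lemma sum_weighted_dist_sub_le {E : Type*} [NormedAddCommGroup E] [NormedSpace ℝ E]
    {A R K μ g₁ g₂ g₃ : ℝ} (hA : 0 ≤ A) (hR : 0 ≤ R) (hK : 0 ≤ K) (hμ : 0 ≤ μ)
    (hg₁ : g₁ ∈ Set.Ioo (0 : ℝ) 1)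
    (hg₂ : 0 < g₂) (hg₃ : 0 < g₃) (hg₃' : g₃ < 1)
    (hK' : ∀ t : ℕ, 1 ≤ t → A * (t : ℝ) ^ (-(1 - g₁)) - μ / 2 ≤ K * (t : ℝ) ^ (-1 : ℝ))
    {e y : ℕ → E} (he : ∀ t, 1 ≤ t → ‖e t‖ ≤ R) {T : ℕ} (hT : 1 ≤ T)
    (hy : ∀ t ∈ Finset.Icc 1 T, ‖y t‖ ≤ R) :
    ∑ t ∈ Finset.Icc 1 T, (A * ((t : ℝ) + 2) ^ g₁ * (‖e t - (1 - shrinkage g₃ t) • y t‖ ^ 2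
          - ‖e (t + 1) - (1 - shrinkage g₃ t) • y t‖ ^ 2)
          - μ / 2 * ‖e t - (1 - shrinkage g₃ t) • y t‖ ^ 2)
      + A * ((T : ℝ) + 2) ^ g₁ * ‖e (T + 1) - (1 - shrinkage g₃ T) • y T‖ ^ 2
      ≤ (16 * A * R ^ 2 + 4 * R ^ 2 * K) * ∑ t ∈ Finset.Icc 1 T, (t : ℝ) ^ (g₂ - g₃)
        + 12 * A * R * ∑ t ∈ Finset.Ico 1 T, (t : ℝ) ^ g₁ * ‖y (t + 1) - y t‖ := by
  have hyt : ∀ t ∈ Finset.Icc 1 T, ‖(1 - shrinkage g₃ t) • y t‖ ≤ R := fun t ht => by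
    have h1 := shrinkage_pos g₃ t
    have h2 := shrinkage_le_one hg₃.le t
    rw [norm_smul, Real.norm_of_nonneg (by linarith)]
    nlinarith [hy t ht, norm_nonneg (y t)]
  have hN : ∀ t ∈ Finset.Icc 1 T, ∀ s, 1 ≤ s → ‖e s - (1 - shrinkage g₃ t) • y t‖ ≤ 2 * R :=
    fun t ht s hs => (norm_sub_le _ _).trans (by linarith [he s hs, hyt t ht])
  have hN2 : ∀ t ∈ Finset.Icc 1 T, ∀ s, 1 ≤ s →
      ‖e s - (1 - shrinkage g₃ t) • y t‖ ^ 2 ≤ 4 * R ^ 2 := fun t ht s hs => by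
    have := pow_le_pow_left₀ (norm_nonneg _) (hN t ht s hs) 2
    linarith
  -- The last summand on the left is the potential carried by the induction: the next round changes
  -- weight and comparator, but starts from the same point `e (T + 1)`.
  induction T, hT using Nat.le_induction with
  | base =>
    have h1 := hN2 1 (by simp) 1 le_rfl
    have h3 : (3 : ℝ) ^ g₁ ≤ 3 := by
      have := Real.rpow_le_rpow_of_exponent_le (x := 3) (by norm_num) hg₁.2.le
      rwa [Real.rpow_one] at this
    simp only [Finset.Icc_self, Finset.sum_singleton, Nat.cast_one, Real.one_rpow, mul_one,
      Finset.Ico_self, Finset.sum_empty, mul_zero, add_zero]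
    rw [show (1 : ℝ) + 2 = 3 by norm_num]
    have h4 := mul_le_mul (mul_le_mul_of_nonneg_left h3 hA) h1 (sq_nonneg _) (by positivity)
    have h5 : 0 ≤ μ / 2 * ‖e 1 - (1 - shrinkage g₃ 1) • y 1‖ ^ 2 := by positivity
    have h6 : 0 ≤ 4 * R ^ 2 * K := by positivity
    have h7 : 0 ≤ A * R ^ 2 := by positivity
    linarith
  | succ T hT ih =>
    have hsub : ∀ t ∈ Finset.Icc 1 T, t ∈ Finset.Icc 1 (T + 1) := fun t ht => by
      simp only [Finset.mem_Icc] at ht ⊢; omega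
    have ih := ih (fun t ht => hy t (hsub t ht)) (fun t ht => hyt t (hsub t ht))
      (fun t ht => hN t (hsub t ht)) (fun t ht => hN2 t (hsub t ht))
    have hmem : T ∈ Finset.Icc 1 (T + 1) := by simp only [Finset.mem_Icc]; omega
    have hmem' : T + 1 ∈ Finset.Icc 1 (T + 1) := by simp only [Finset.mem_Icc]; omega
    rw [Finset.sum_Icc_succ_top (by omega), Finset.sum_Icc_succ_top (by omega),
      Finset.sum_Ico_succ_top hT]
    have hT1 : (1 : ℝ) ≤ T := by exact_mod_cast hT
    have hTp : (0 : ℝ) < (T : ℝ) + 1 := by positivity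
    set N := ‖e (T + 1) - (1 - shrinkage g₃ (T + 1)) • y (T + 1)‖ with hNdef
    set N' := ‖e (T + 1) - (1 - shrinkage g₃ T) • y T‖ with hN'def
    have hN4 : N ^ 2 ≤ 4 * R ^ 2 := hN2 _ hmem' _ (by omega)
    have hNR : N ≤ 2 * R := hN _ hmem' _ (by omega)
    have hNR' : N' ≤ 2 * R := hN _ hmem _ (by omega)
    set a := A * ((T : ℝ) + 2) ^ g₁ with ha
    set a' := A * (((T + 1 : ℕ) : ℝ) + 2) ^ g₁ with ha'
    have hpow : ((T : ℝ) + 1) ^ (-1 : ℝ) ≤ ((T : ℝ) + 1) ^ (g₂ - g₃) :=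
      Real.rpow_le_rpow_of_exponent_le (by linarith) (by linarith)
    have h1 : a' - a ≤ A * ((T : ℝ) + 1) ^ (-(1 - g₁)) := by
      rw [ha, ha', ← mul_sub]
      apply mul_le_mul_of_nonneg_left _ hA
      have h2 := rpow_add_one_sub_le (s := (T : ℝ) + 2) (by positivity) hg₁.2.le
      have h3 : ((T : ℝ) + 2) ^ (g₁ - 1) ≤ ((T : ℝ) + 1) ^ (g₁ - 1) :=
        Real.rpow_le_rpow_of_nonpos hTp (by linarith) (by linarith [hg₁.2])
      rw [show -(1 - g₁) = g₁ - 1 by ring]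
      rw [show (((T + 1 : ℕ) : ℝ) + 2) = (T : ℝ) + 2 + 1 by push_cast; ring]
      linarith
    -- Here strong convexity cancels the growth of the weights, which would otherwise sum to order
    -- `T^g₁`.
    have h4 : (a' - a - μ / 2) * N ^ 2 ≤ 4 * R ^ 2 * K * ((T : ℝ) + 1) ^ (g₂ - g₃) := by
      have h5 := hK' (T + 1) (by omega)
      push_cast at h5
      have h6 : a' - a - μ / 2 ≤ K * ((T : ℝ) + 1) ^ (g₂ - g₃) := by
        have := mul_le_mul_of_nonneg_left hpow hK
        linarith
      have h7 : 0 ≤ K * ((T : ℝ) + 1) ^ (g₂ - g₃) := by positivity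
      nlinarith [mul_le_mul_of_nonneg_right h6 (sq_nonneg N), mul_le_mul_of_nonneg_left hN4 h7]
    -- The comparator moves for two reasons: the benchmark moves, and the shrinkage changes.
    have hdiff : N - N' ≤ ‖y (T + 1) - y T‖ + R * (shrinkage g₃ T - shrinkage g₃ (T + 1)) := by
      have h5 : N - N' ≤ ‖(1 - shrinkage g₃ (T + 1)) • (y (T + 1) - y T)
          + (shrinkage g₃ T - shrinkage g₃ (T + 1)) • y T‖ := by
        refine (norm_sub_norm_le _ _).trans (le_of_eq ?_)
        rw [← norm_neg]
        congr 1
        simp only [sub_smul, smul_sub, one_smul]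
        abel
      refine h5.trans ((norm_add_le _ _).trans ?_)
      have h6 := shrinkage_pos g₃ (T + 1)
      have h7 := shrinkage_le_one hg₃.le (T + 1)
      have h8 := shrinkage_succ_le hg₃.le T
      rw [norm_smul, norm_smul, Real.norm_of_nonneg (by linarith),
        Real.norm_of_nonneg (by linarith)]
      nlinarith [hy T hmem, norm_nonneg (y (T + 1) - y T)]
    have ha3 : a ≤ 3 * A * (T : ℝ) ^ g₁ := by
      have h5 := rpow_add_natCast_le hT 2 (a := g₁) ⟨hg₁.1.le, hg₁.2.le⟩
      push_cast at h5
      rw [ha]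
      have := mul_le_mul_of_nonneg_left h5 hA
      linarith
    -- The weight is at most `A (T + 2)` and the shrinkage drops by at most `(T + 1)^(-g₃) / (T +
    -- 2)`, so the product is of order `(T + 1)^(-g₃)`.
    have haξ : a * (shrinkage g₃ T - shrinkage g₃ (T + 1)) ≤ A * ((T : ℝ) + 1) ^ (g₂ - g₃) := by
      have h5 := rpow_neg_sub_le (s := (T : ℝ) + 1) (a := g₃) hTp hg₃'.le
      rw [shrinkage_eq, shrinkage_eq, ha]
      push_cast
      rw [mul_assoc]
      apply mul_le_mul_of_nonneg_left _ hA
      have h6 : ((T : ℝ) + 2) ^ g₁ ≤ (T : ℝ) + 2 := by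
        have := Real.rpow_le_rpow_of_exponent_le (x := (T : ℝ) + 2) (by linarith) hg₁.2.le
        rwa [Real.rpow_one] at this
      have h7 : ((T : ℝ) + 1) ^ (-g₃) ≤ ((T : ℝ) + 1) ^ (g₂ - g₃) :=
        Real.rpow_le_rpow_of_exponent_le (by linarith) (by linarith)
      refine le_trans ?_ h7
      calc _ ≤ ((T : ℝ) + 2) ^ g₁ * (((T : ℝ) + 1) ^ (-g₃) / ((T : ℝ) + 1 + 1)) :=
            mul_le_mul_of_nonneg_left h5 (by positivity)
        _ ≤ ((T : ℝ) + 2) * (((T : ℝ) + 1) ^ (-g₃) / ((T : ℝ) + 1 + 1)) :=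
            mul_le_mul_of_nonneg_right h6 (by positivity)
        _ = ((T : ℝ) + 1) ^ (-g₃) := by field_simp; ring
    have ha0 : 0 ≤ a := by positivity
    have hsq : a * (N ^ 2 - N' ^ 2) ≤ 4 * R * (3 * A * (T : ℝ) ^ g₁ * ‖y (T + 1) - y T‖
        + R * (A * ((T : ℝ) + 1) ^ (g₂ - g₃))) := by
      set Δ := ‖y (T + 1) - y T‖ + R * (shrinkage g₃ T - shrinkage g₃ (T + 1)) with hΔ
      have hΔ0 : 0 ≤ Δ :=
        add_nonneg (norm_nonneg _) (mul_nonneg hR (sub_nonneg.2 (shrinkage_succ_le hg₃.le T)))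
      have h5 : N ^ 2 - N' ^ 2 ≤ 4 * R * Δ := by
        have h6 : 0 ≤ N + N' := add_nonneg (norm_nonneg _) (norm_nonneg _)
        nlinarith
      have h7 : a * Δ ≤ 3 * A * (T : ℝ) ^ g₁ * ‖y (T + 1) - y T‖
          + R * (A * ((T : ℝ) + 1) ^ (g₂ - g₃)) := by
        rw [hΔ]
        nlinarith [mul_le_mul_of_nonneg_right ha3 (norm_nonneg (y (T + 1) - y T)),
          mul_le_mul_of_nonneg_left haξ hR]
      have h8 := mul_le_mul_of_nonneg_left h5 ha0
      have h9 := mul_le_mul_of_nonneg_left h7 (by positivity : 0 ≤ 4 * R)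
      linarith
    have h12 : 0 ≤ A * R ^ 2 * ((T : ℝ) + 1) ^ (g₂ - g₃) := by positivity
    rw [show (((T + 1 : ℕ) : ℝ)) ^ (g₂ - g₃) = ((T : ℝ) + 1) ^ (g₂ - g₃) by push_cast; rfl]
    linarith

/-! ### The filtration of past directions -/

section Past

variable {n p : ℕ} {Ω : Type*}

/-- The σ-algebra generated by the directions sampled before time `t`. -/
@[reducible] def pastSigma (u : ℕ → Fin n → Ω → Metric.sphere (0 : Vec p) 1) (t : ℕ) : MeasurableSpace Ω :=
  ⨆ k ∈ {k : ℕ × Fin n | k.1 + 1 < t}, MeasurableSpace.comap (u (k.1 + 1) k.2) inferInstance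

variable {u : ℕ → Fin n → Ω → Metric.sphere (0 : Vec p) 1}

lemma pastSigma_mono {s t : ℕ} (h : s ≤ t) : pastSigma u s ≤ pastSigma u t :=
  biSup_mono fun _ hk => lt_of_lt_of_le hk h

lemma measurable_pastSigma {s t : ℕ} (hs : 1 ≤ s) (hst : s < t) (i : Fin n) :
    Measurable[pastSigma u t] (u s i) := by
  obtain ⟨k, rfl⟩ := Nat.exists_eq_add_of_le' hs
  rw [measurable_iff_comap_le]
  exact le_biSup (fun k : ℕ × Fin n =>
    MeasurableSpace.comap (u (k.1 + 1) k.2) inferInstance) (i := ((k, i) : ℕ × Fin n)) hst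

variable [mΩ : MeasurableSpace Ω] {Pr : Measure Ω}

lemma pastSigma_le (hu : IsUniformSampling Pr u) (t : ℕ) : pastSigma u t ≤ mΩ :=
  iSup₂_le fun k _ => (hu.meas (k.1 + 1) (by omega) k.2).comap_le

lemma indep_pastSigma (hu : IsUniformSampling Pr u) {t : ℕ} (ht : 1 ≤ t) (i : Fin n) :
    Indep (pastSigma u t) (MeasurableSpace.comap (u t i) inferInstance) Pr := by
  obtain ⟨k, rfl⟩ := Nat.exists_eq_add_of_le' ht
  have h1 := indep_iSup_of_disjoint
    (m := fun j : ℕ × Fin n => MeasurableSpace.comap (u (j.1 + 1) j.2) inferInstance) (S := {j : ℕ × Fin n | j.1 + 1 < k + 1}) (T := {(k, i)})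
    (fun j => (hu.meas (j.1 + 1) (by omega) j.2).comap_le) hu.indep.iIndep
    (by simp [Set.disjoint_singleton_right])
  simpa [pastSigma] using h1

end Past

/-! ### Measurability through Lipschitz dependence -/

section LipschitzFactor

/-- A map that is dominated by a measurable map in the Lipschitz sense is measurable. -/
lemma Measurable.of_norm_sub_le {Ω V V' : Type*} {mΩ : MeasurableSpace Ω}
    [NormedAddCommGroup V] [MeasurableSpace V] [BorelSpace V]
    [NormedAddCommGroup V'] [NormedSpace ℝ V'] [FiniteDimensional ℝ V'] [MeasurableSpace V']
    [BorelSpace V'] {f : Ω → V} {g : Ω → V'} (hf : Measurable f) {K : ℝ} (hK : 0 ≤ K)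
    (h : ∀ a b, ‖g a - g b‖ ≤ K * ‖f a - f b‖) : Measurable g := by
  have hfac : Function.FactorsThrough g f := fun a b hab => by
    have := h a b
    rw [hab, sub_self, norm_zero, mul_zero] at this
    exact sub_eq_zero.1 (norm_le_zero_iff.1 this)
  have hlip : LipschitzOnWith K.toNNReal (Function.extend f g 0) (Set.range f) := by
    apply LipschitzOnWith.of_dist_le_mul
    rintro _ ⟨a, rfl⟩ _ ⟨b, rfl⟩
    rw [hfac.extend_apply, hfac.extend_apply, Real.coe_toNNReal _ hK, dist_eq_norm, dist_eq_norm]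
    exact h a b
  obtain ⟨ψ, hψ, heq⟩ := hlip.extend_finite_dimension
  have : g = ψ ∘ f := by
    ext a
    rw [Function.comp_apply, ← heq ⟨a, rfl⟩, hfac.extend_apply]
  rw [this]
  exact hψ.continuous.measurable.comp hf

lemma posVec_lipschitz {ι : Type*} [Fintype ι] :
    LipschitzWith 1 (posVec : EuclideanSpace ℝ ι → EuclideanSpace ℝ ι) := by
  apply LipschitzWith.of_dist_le_mul
  intro x y
  simpa [dist_eq_norm] using norm_posVec_sub_le x y

end LipschitzFactor

/-! ### Random runs and the conditional mean of the estimator -/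

section RandomRun

variable {n p : ℕ} {m : Fin n → ℕ} {r R F₁ F₂ w : ℝ} {B : ℕ} {g₁ g₂ g₃ : ℝ}
  {P : OnlineProblem n p m} {dl : Fin n → ℕ → Vec p → Vec p}
  {dc : (i : Fin n) → ℕ → Vec p → (Vec p →L[ℝ] Vec (m i))}
  {G : ℕ → Digraph (Fin n)} {W : ℕ → Matrix (Fin n) (Fin n) ℝ} {e₁ : Fin n → Vec p}
  {Ω : Type*} {u : ℕ → Fin n → Ω → Metric.sphere (0 : Vec p) 1} {S : Ω → Trajectory n p m}

/-- All sample paths are runs of the algorithm. -/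
abbrev IsPolyRunFamily (r R F₁ F₂ w : ℝ) (B : ℕ) (g₁ g₂ g₃ : ℝ)
    (P : OnlineProblem n p m) (dl : Fin n → ℕ → Vec p → Vec p)
    (dc : (i : Fin n) → ℕ → Vec p → (Vec p →L[ℝ] Vec (m i)))
    (G : ℕ → Digraph (Fin n)) (W : ℕ → Matrix (Fin n) (Fin n) ℝ) (e₁ : Fin n → Vec p)
    (u : ℕ → Fin n → Ω → Metric.sphere (0 : Vec p) 1) (S : Ω → Trajectory n p m) : Prop :=
  ∀ a, IsPolyRun r R F₁ F₂ w B g₁ g₂ g₃ P dl dc G W e₁ (fun t i => (u t i a : Vec p)) (S a)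

namespace IsPolyRunFamily

section Measurability

variable (h : IsPolyRunFamily r R F₁ F₂ w B g₁ g₂ g₃ P dl dc G W e₁ u S)
include h

/-- The loss is arbitrary off `X`, so measurability of the composite is drawn from the Lipschitz
bound on the range of `f`. -/
lemma measurable_loss {mΩ : MeasurableSpace Ω} {t : ℕ} (ht : 1 ≤ t) (i : Fin n)
    {f : Ω → Vec p} (hf : Measurable f) (hfX : ∀ a, f a ∈ P.X) :
    Measurable fun a => P.loss i t (f a) := by
  by_cases hΩ : Nonempty Ω
  · obtain ⟨a₀⟩ := hΩ
    exact hf.of_norm_sub_le (h a₀).F₂_pos.le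
      fun a b => (h a).regular.abs_loss_sub_le i ht (hfX a) (hfX b)
  · have := not_nonempty_iff.1 hΩ
    exact measurable_of_empty _

lemma measurable_posVec_con {mΩ : MeasurableSpace Ω} {t : ℕ} (ht : 1 ≤ t) (i : Fin n)
    {f : Ω → Vec p} (hf : Measurable f) (hfX : ∀ a, f a ∈ P.X) :
    Measurable fun a => posVec (P.con i t (f a)) := by
  by_cases hΩ : Nonempty Ω
  · obtain ⟨a₀⟩ := hΩ
    exact hf.of_norm_sub_le (by have := (h a₀).F₂_pos; positivity : 0 ≤ 2 * F₂)
      fun a b => (norm_posVec_sub_le _ _).trans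
        ((h a).regular.norm_con_sub_le i ht (h a).F₂_pos.le (hfX a) (hfX b))
  · have := not_nonempty_iff.1 hΩ
    exact measurable_of_empty _

lemma measurable_lagrangian {mΩ : MeasurableSpace Ω} {t : ℕ} (ht : 1 ≤ t) (i : Fin n)
    {f : Ω → Vec p} (hf : Measurable f) (hfX : ∀ a, f a ∈ P.X) {q : Ω → Vec (m i)}
    (hq : Measurable q) : Measurable fun a => P.lagrangian i t (q a) (f a) :=
  (measurable_loss h ht i hf hfX).add (hq.inner (measurable_posVec_con h ht i hf hfX))

lemma measurable_x_of_e {mΩ : MeasurableSpace Ω} {t : ℕ} (ht : 1 ≤ t) (i : Fin n)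
    (he : Measurable fun a => (S a).e t i) (hu : Measurable (u t i)) :
    Measurable fun a => (S a).x t i := by
  have h1 : (fun a => (S a).x t i)
      = fun a => (S a).e t i + (r * shrinkage g₃ t) • (u t i a : Vec p) :=
    funext fun a => (h a).x_eq ht i
  rw [h1]
  exact he.add ((measurable_subtype_coe.comp hu).fun_const_smul _)

lemma measurable_dir_of {mΩ : MeasurableSpace Ω} {t : ℕ} (ht : 1 ≤ t) (i : Fin n)
    (he : Measurable fun a => (S a).e t i) (hq : Measurable fun a => (S a).q t i)
    (hu : Measurable (u t i)) : Measurable fun a => (S a).dir (t + 1) i := by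
  have h1 : (fun a => (S a).dir (t + 1) i) = fun a => ((p : ℝ) / (r * shrinkage g₃ t)
      * P.lagrangian i t ((S a).q t i) ((S a).x t i)) • (u t i a : Vec p) :=
    funext fun a => (h a).dir_eq ht i
  rw [h1]
  exact ((measurable_lagrangian h ht i (measurable_x_of_e h ht i he hu)
    (fun a => (h a).x_mem ht i) hq).const_mul _).smul (measurable_subtype_coe.comp hu)

/-- The iterates at time `t` only depend on the directions sampled before time `t`. -/
lemma measurable_e_q_past {t : ℕ} (ht : 1 ≤ t) :
    (∀ i, Measurable[pastSigma u t] fun a => (S a).e t i) ∧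
      ∀ i, Measurable[pastSigma u t] fun a => (S a).q t i := by
  induction t, ht using Nat.le_induction with
  | base =>
    refine ⟨fun i => ?_, fun i => ?_⟩
    · have : (fun a => (S a).e 1 i) = fun _ => e₁ i := funext fun a => (h a).run.init_e i
      rw [this]; exact measurable_const
    · have : (fun a => (S a).q 1 i) = fun _ => 0 := funext fun a => (h a).run.init_q i
      rw [this]; exact measurable_const
  | succ t ht ih =>
    have he : ∀ i, Measurable[pastSigma u (t + 1)] fun a => (S a).e t i :=
      fun i => (ih.1 i).mono (pastSigma_mono (Nat.le_succ t)) le_rfl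
    have hq : ∀ i, Measurable[pastSigma u (t + 1)] fun a => (S a).q t i :=
      fun i => (ih.2 i).mono (pastSigma_mono (Nat.le_succ t)) le_rfl
    have hu : ∀ i, Measurable[pastSigma u (t + 1)] (u t i) :=
      fun i => measurable_pastSigma ht (Nat.lt_succ_self t) i
    refine ⟨fun i => ?_, fun i => ?_⟩
    · have hz : Measurable[pastSigma u (t + 1)] fun a => (S a).z (t + 1) i := by
        have : (fun a => (S a).z (t + 1) i) = fun a => ∑ j, W t i j • (S a).e t j :=
          funext fun a => (h a).run.step_z t ht i
        rw [this]
        exact Finset.measurable_fun_sum _ fun j _ => (he j).fun_const_smul _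
      have hd := measurable_dir_of h ht i (he i) (hq i) (hu i)
      -- The new iterate is specified only as a projection; nonexpansiveness makes it a Lipschitz
      -- function of the point being projected.
      have hw := hz.sub (hd.const_smul (stepSize p r F₁ g₁ (t + 1)))
      refine hw.of_norm_sub_le zero_le_one fun a b => ?_
      rw [one_mul]
      exact ((h a).run.step_e t ht i).norm_sub_le ((h a).regular.convex_X.smul _)
        ((h b).run.step_e t ht i)
    · have h1 : (fun a => (S a).q (t + 1) i) = fun a => (1 - 2 / ((t : ℝ) + 1)) • (S a).q t i
          + (1 / ((t : ℝ) + 1) ^ (1 - g₂)) • posVec (P.con i t ((S a).x t i)) :=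
        funext fun a => (h a).q_step ht i
      rw [h1]
      exact ((hq i).fun_const_smul _).add ((measurable_posVec_con h ht i
        (measurable_x_of_e h ht i (he i) (hu i)) fun a => (h a).x_mem ht i).fun_const_smul _)

variable [mΩ : MeasurableSpace Ω] {Pr : Measure Ω} (hu : IsUniformSampling Pr u)
include hu

lemma measurable_e {t : ℕ} (ht : 1 ≤ t) (i : Fin n) : Measurable fun a => (S a).e t i :=
  ((measurable_e_q_past h ht).1 i).mono (pastSigma_le hu t) le_rfl

lemma measurable_q {t : ℕ} (ht : 1 ≤ t) (i : Fin n) : Measurable fun a => (S a).q t i :=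
  ((measurable_e_q_past h ht).2 i).mono (pastSigma_le hu t) le_rfl

lemma measurable_x {t : ℕ} (ht : 1 ≤ t) (i : Fin n) : Measurable fun a => (S a).x t i :=
  measurable_x_of_e h ht i (measurable_e h hu ht i) (hu.meas t ht i)

lemma measurable_dir {t : ℕ} (ht : 1 ≤ t) (i : Fin n) : Measurable fun a => (S a).dir (t + 1) i :=
  measurable_dir_of h ht i (measurable_e h hu ht i) (measurable_q h hu ht i) (hu.meas t ht i)

lemma indepFun_e_q {t : ℕ} (ht : 1 ≤ t) (i : Fin n) :
    IndepFun (fun a => ((S a).e t i, (S a).q t i)) (u t i) Pr := by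
  rw [IndepFun_iff_Indep]
  refine indep_of_indep_of_le_left (indep_pastSigma hu ht i) ?_
  rw [← measurable_iff_comap_le]
  exact ((measurable_e_q_past h ht).1 i).prodMk ((measurable_e_q_past h ht).2 i)

end Measurability

section Expectation

variable [mΩ : MeasurableSpace Ω] {Pr : Measure Ω} [IsProbabilityMeasure Pr]

lemma integrable_inner_dir (h : IsPolyRunFamily r R F₁ F₂ w B g₁ g₂ g₃ P dl dc G W e₁ u S)
    (hu : IsUniformSampling Pr u) {t : ℕ} (ht : 1 ≤ t) (i : Fin n) (y : Vec p) :
    Integrable (fun a => inner ℝ ((S a).dir (t + 1) i) ((S a).e t i - y)) Pr := by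
  apply Integrable.of_bound ((measurable_dir h hu ht i).inner
    ((measurable_e h hu ht i).sub_const y)).aestronglyMeasurable
    (2 * p / r * (F₁ + F₁ ^ 2) * (t : ℝ) ^ (g₂ + g₃) * (R + ‖y‖))
  refine .of_forall fun a => (norm_inner_le_norm _ _).trans ?_
  have hd := (h a).norm_dir_le ht i
  apply mul_le_mul hd _ (norm_nonneg _) ((norm_nonneg _).trans hd)
  exact (norm_sub_le _ _).trans (add_le_add ((h a).norm_e_le ht i) le_rfl)

lemma integrable_lagrangian (h : IsPolyRunFamily r R F₁ F₂ w B g₁ g₂ g₃ P dl dc G W e₁ u S)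
    (hu : IsUniformSampling Pr u) {t : ℕ} (ht : 1 ≤ t) (i : Fin n) {f : Ω → Vec p}
    (hf : Measurable f) (hfX : ∀ a, f a ∈ P.X) :
    Integrable (fun a => P.lagrangian i t ((S a).q t i) (f a)) Pr := by
  apply Integrable.of_bound (measurable_lagrangian h ht i hf hfX
    (measurable_q h hu ht i)).aestronglyMeasurable
    (F₁ + F₁ / 2 * (t : ℝ) ^ g₂ * F₁)
  refine .of_forall fun a => ((h a).regular.abs_lagrangian_le i ht _ (hfX a)).trans ?_
  have := mul_le_mul_of_nonneg_right ((h a).norm_q_le ht i) (h a).F₁_pos.le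
  linarith

lemma integrable_norm_sub_sq (h : IsPolyRunFamily r R F₁ F₂ w B g₁ g₂ g₃ P dl dc G W e₁ u S)
    (hu : IsUniformSampling Pr u) {t : ℕ} (ht : 1 ≤ t) (i : Fin n) (y : Vec p) :
    Integrable (fun a => ‖(S a).e t i - y‖ ^ 2) Pr := by
  apply Integrable.of_bound
    (((measurable_e h hu ht i).sub_const y).norm.pow_const 2).aestronglyMeasurable
    ((R + ‖y‖) ^ 2)
  refine .of_forall fun a => ?_
  rw [Real.norm_of_nonneg (by positivity)]
  apply pow_le_pow_left₀ (norm_nonneg _)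
  exact (norm_sub_le _ _).trans (add_le_add ((h a).norm_e_le ht i) le_rfl)

/-- The estimated direction is in expectation a subgradient of the Lagrangian. -/
theorem integral_lagrangian_sub_le
    (h : IsPolyRunFamily r R F₁ F₂ w B g₁ g₂ g₃ P dl dc G W e₁ u S)
    (hu : IsUniformSampling Pr u) {μ : ℝ} (hμ : P.LossStronglyConvex μ dl)
    {t : ℕ} (ht : 1 ≤ t) (i : Fin n) {y : Vec p} (hy : y ∈ (1 - shrinkage g₃ t) • P.X) :
    ∫ a, (P.lagrangian i t ((S a).q t i) ((S a).e t i) - P.lagrangian i t ((S a).q t i) y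
        + μ / 2 * ‖(S a).e t i - y‖ ^ 2
        - 2 * ((F₂ + 2 * F₂ * (F₁ / 2 * (t : ℝ) ^ g₂)) * (r * shrinkage g₃ t))) ∂Pr
      ≤ ∫ a, inner ℝ ((S a).dir (t + 1) i) ((S a).e t i - y) ∂Pr := by
  obtain ⟨a₀⟩ : Nonempty Ω := Pr.nonempty_of_neZero
  have hreg := (h a₀).regular
  have hF₂ := (h a₀).F₂_pos.le
  have hr := (h a₀).r_pos
  have hξ := (h a₀).shrinkage_mem t
  have hyX : y ∈ P.X := hreg.smul_subset_self hr (Set.Ioc_subset_Icc_self hξ) hy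
  have := isProbabilityMeasure_uniformSphere (h a₀).p_pos
  set δ := r * shrinkage g₃ t with hδ
  have hll : LipschitzOnWith F₂.toNNReal (P.loss i t) P.X := by
    apply LipschitzOnWith.of_dist_le_mul
    intro x hx x' hx'
    rw [Real.coe_toNNReal _ hF₂, Real.dist_eq, dist_eq_norm]
    exact hreg.abs_loss_sub_le i ht hx hx'
  have hlc : LipschitzOnWith (2 * F₂).toNNReal (P.con i t) P.X := by
    apply LipschitzOnWith.of_dist_le_mul
    intro x hx x' hx'
    rw [Real.coe_toNNReal _ (by positivity), dist_eq_norm, dist_eq_norm]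
    exact hreg.norm_con_sub_le i ht hF₂ hx hx'
  -- Extending loss and constraint beyond `X` gives an integrand continuous on the whole product
  -- space, which agrees with the estimator at the sampled points.
  obtain ⟨l', hl'lip, hl'⟩ := hll.extend_real
  obtain ⟨c', hc'lip, hc'⟩ := hlc.extend_finite_dimension
  set g : (Vec p × Vec (m i)) × Metric.sphere (0 : Vec p) 1 → ℝ := fun z =>
    (p : ℝ) / δ * (l' (z.1.1 + δ • (z.2 : Vec p))
      + inner ℝ z.1.2 (posVec (c' (z.1.1 + δ • (z.2 : Vec p)))))
      * inner ℝ (z.2 : Vec p) (z.1.1 - y) with hg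
  have hgc : Continuous g := by
    have hl'c := hl'lip.continuous
    have hc'c := hc'lip.continuous
    have hpc := (posVec_lipschitz (ι := Fin (m i))).continuous
    have h1 : Continuous fun z : (Vec p × Vec (m i)) × Metric.sphere (0 : Vec p) 1 =>
      z.1.1 + δ • (z.2 : Vec p) := by fun_prop
    exact (continuous_const.mul ((hl'c.comp h1).add
      (Continuous.inner (by fun_prop) (hpc.comp (hc'c.comp h1))))).mul
      (Continuous.inner (by fun_prop) (by fun_prop))
  have hgval : ∀ a (v : Metric.sphere (0 : Vec p) 1), g (((S a).e t i, (S a).q t i), v)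
      = (p : ℝ) / δ * P.lagrangian i t ((S a).q t i) ((S a).e t i + δ • (v : Vec p))
        * inner ℝ (v : Vec p) ((S a).e t i - y) := fun a v => by
    have hmem : (S a).e t i + δ • (v : Vec p) ∈ P.X :=
      hreg.add_smul_mem hr (Set.Ioc_subset_Icc_self hξ) ((h a).e_mem ht i) (by simp)
    simp only [hg, OnlineProblem.lagrangian]
    rw [← hl' hmem, ← hc' hmem]
  set X : Ω → Vec p × Vec (m i) := fun a => ((S a).e t i, (S a).q t i) with hX
  have hXm : Measurable X := (measurable_e h hu ht i).prodMk (measurable_q h hu ht i)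
  have hUm := hu.meas t ht i
  have hdir : ∀ a, inner ℝ ((S a).dir (t + 1) i) ((S a).e t i - y) = g (X a, u t i a) := fun a => by
    rw [hgval, (h a).dir_eq ht i, real_inner_smul_left, (h a).x_eq ht i]
  -- The iterates depend on earlier directions only, so the joint law with the current direction is
  -- a product and Fubini integrates over the sphere first.
  have hmap : Pr.map (fun a => (X a, u t i a)) = (Pr.map X).prod (uniformSphere p) := by
    rw [(indepFun_iff_map_prod_eq_prod_map_map hXm.aemeasurable hUm.aemeasurable).1
      (indepFun_e_q h hu ht i), hu.law t ht i]
  have hXU : AEMeasurable (fun a => (X a, u t i a)) Pr := (hXm.prodMk hUm).aemeasurable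
  have hgi : Integrable g ((Pr.map X).prod (uniformSphere p)) := by
    rw [← hmap, integrable_map_measure hgc.aestronglyMeasurable hXU]
    exact (integrable_inner_dir h hu ht i y).congr (.of_forall hdir)
  have hfub : ∫ a, inner ℝ ((S a).dir (t + 1) i) ((S a).e t i - y) ∂Pr
      = ∫ a, ∫ v, g (X a, v) ∂(uniformSphere p) ∂Pr := by
    have : IsProbabilityMeasure (Pr.map X) := Measure.isProbabilityMeasure_map hXm.aemeasurable
    simp_rw [hdir]
    rw [← integral_map hXU hgc.aestronglyMeasurable, hmap, integral_prod g hgi,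
      integral_map hXm.aemeasurable hgi.integral_prod_left.aestronglyMeasurable]
  rw [hfub]
  have : IsProbabilityMeasure (Pr.map X) := Measure.isProbabilityMeasure_map hXm.aemeasurable
  apply integral_mono
  · exact (((integrable_lagrangian h hu ht i (measurable_e h hu ht i)
      fun a => (h a).e_mem_X ht i).sub (integrable_lagrangian h hu ht i measurable_const
      fun _ => hyX)).add ((integrable_norm_sub_sq h hu ht i y).const_mul _)).sub
      (integrable_const _)
  · exact (integrable_map_measure hgi.integral_prod_left.aestronglyMeasurable
      hXm.aemeasurable).1 hgi.integral_prod_left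
  · intro a
    have h1 := hreg.lagrangian_sub_le_integral_estimator hμ (h a).p_pos hr hF₂ i ht
      ((h a).q_nonneg ht i) hξ ((h a).e_mem ht i) hy
    simp only [hX, hgval]
    refine le_trans ?_ h1
    have h2 := (h a).norm_q_le ht i
    have h3 : 0 ≤ δ := mul_nonneg hr.le hξ.1.le
    have h4 := mul_le_mul_of_nonneg_right (mul_le_mul_of_nonneg_left h2
      (by positivity : 0 ≤ 2 * F₂)) h3
    linarith

end Expectation

end IsPolyRunFamily

end RandomRun

/-! ### From local penalized gaps to regret and violation -/

namespace OnlineProblem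

variable {n p : ℕ} {m : Fin n → ℕ} {P : OnlineProblem n p m}

lemma norm_posVec_globalCon_sq (P : OnlineProblem n p m) (t : ℕ) (x : Vec p) :
    ‖posVec (P.globalCon t x)‖ ^ 2 = ∑ j, ‖posVec (P.con j t x)‖ ^ 2 := by
  simp only [EuclideanSpace.norm_sq_eq, Fintype.sum_sigma]
  rfl

lemma norm_posVec_globalCon_le (P : OnlineProblem n p m) (t : ℕ) (x : Vec p) :
    ‖posVec (P.globalCon t x)‖ ≤ ∑ j, ‖posVec (P.con j t x)‖ := by
  apply le_of_sq_le_sq _ (Finset.sum_nonneg fun j _ => norm_nonneg _)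
  rw [norm_posVec_globalCon_sq]
  exact Finset.sum_sq_le_sq_sum_of_nonneg fun j _ => norm_nonneg _

lemma IsFeasible.posVec_con_eq_zero {T : ℕ} {y : ℕ → Vec p} (hy : P.IsFeasible T y) {t : ℕ}
    (ht : t ∈ Finset.Icc 1 T) (i : Fin n) : posVec (P.con i t (y t)) = 0 :=
  posVec_of_nonpos fun k => (hy t ht).2 ⟨i, k⟩

/-- The local loss increment at `e` over the benchmark `y` plus the penalty of the violation at
`e`. -/
noncomputable def penalizedGap (P : OnlineProblem n p m) (i : Fin n) (t : ℕ) (q : Vec (m i))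
    (e y : Vec p) : ℝ :=
  P.loss i t e - P.loss i t y + inner ℝ q (posVec (P.con i t e))

end OnlineProblem

namespace IsPolyRun

variable {n p : ℕ} {m : Fin n → ℕ} {r R F₁ F₂ w : ℝ} {B : ℕ} {g₁ g₂ g₃ : ℝ}
  {P : OnlineProblem n p m} {dl : Fin n → ℕ → Vec p → Vec p}
  {dc : (i : Fin n) → ℕ → Vec p → (Vec p →L[ℝ] Vec (m i))}
  {G : ℕ → Digraph (Fin n)} {W : ℕ → Matrix (Fin n) (Fin n) ℝ} {e₁ : Fin n → Vec p}
  {u : ℕ → Fin n → Vec p} {S : Trajectory n p m}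
  (h : IsPolyRun r R F₁ F₂ w B g₁ g₂ g₃ P dl dc G W e₁ u S)
include h

/-- The Lipschitz constant of the Lagrangian grows like `t^g₂`, displacements by shrinkage and
smoothing decay like `t^(-g₃)`: the source of the exponent `g₂ - g₃`. -/
lemma rpow_mul_shrinkage_le {t : ℕ} (ht : 1 ≤ t) :
    (F₂ + F₂ * F₁ * (t : ℝ) ^ g₂) * shrinkage g₃ t ≤ F₂ * (1 + F₁) * (t : ℝ) ^ (g₂ - g₃) := by
  have ht1 : (1 : ℝ) ≤ t := by exact_mod_cast ht
  have hF₁ := h.F₁_pos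
  have hF₂ := h.F₂_pos
  have h1 : 1 ≤ (t : ℝ) ^ g₂ := Real.one_le_rpow ht1 h.g₂_mem.1.le
  have h2 := shrinkage_le_rpow h.g₃_pos.le ht
  calc _ ≤ (F₂ * (1 + F₁) * (t : ℝ) ^ g₂) * (t : ℝ) ^ (-g₃) := by
        apply mul_le_mul _ h2 (shrinkage_pos _ _).le (by positivity)
        nlinarith
    _ = _ := by
        rw [sub_eq_add_neg g₂ g₃, Real.rpow_add (by linarith)]; ring

/-- The penalty vanishes at a feasible benchmark, and moving to the shrunk comparator costs the
Lipschitz constant times `R ξ`. -/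
lemma penalizedGap_le {T t : ℕ} {y : ℕ → Vec p} (hy : P.IsFeasible T y)
    (ht : t ∈ Finset.Icc 1 T) (i : Fin n) :
    P.penalizedGap i t (S.q t i) (S.e t i) (y t)
      ≤ P.lagrangian i t (S.q t i) (S.e t i)
        - P.lagrangian i t (S.q t i) ((1 - shrinkage g₃ t) • y t)
        + R * (F₂ * (1 + F₁) * (t : ℝ) ^ (g₂ - g₃)) := by
  have ht1 : 1 ≤ t := (Finset.mem_Icc.1 ht).1
  have hyX := (hy t ht).1
  have hF₂ := h.F₂_pos
  have hξ := h.shrinkage_mem t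
  have hR := h.regular.R_nonneg h.r_pos
  have hyX' := h.regular.smul_subset_self h.r_pos (Set.Ioc_subset_Icc_self hξ)
    (Set.smul_mem_smul_set (a := 1 - shrinkage g₃ t) hyX)
  have h1 := (abs_le.1 (h.regular.abs_lagrangian_sub_le i ht1 hF₂.le (S.q t i) hyX' hyX)).2
  have h2 : ‖(1 - shrinkage g₃ t) • y t - y t‖ ≤ shrinkage g₃ t * R := by
    rw [show (1 - shrinkage g₃ t) • y t - y t = -(shrinkage g₃ t • y t) by
      rw [sub_smul, one_smul]; abel, norm_neg, norm_smul, Real.norm_of_nonneg hξ.1.le]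
    exact mul_le_mul_of_nonneg_left (h.regular.norm_le hyX) hξ.1.le
  have h3 : P.lagrangian i t (S.q t i) (y t) = P.loss i t (y t) := by
    rw [OnlineProblem.lagrangian, hy.posVec_con_eq_zero ht, inner_zero_right, add_zero]
  have h4 : (F₂ + 2 * F₂ * ‖S.q t i‖) * ‖(1 - shrinkage g₃ t) • y t - y t‖
      ≤ R * (F₂ * (1 + F₁) * (t : ℝ) ^ (g₂ - g₃)) := by
    have h5 := h.rpow_mul_shrinkage_le ht1
    have h6 := h.norm_q_le ht1 i
    calc _ ≤ (F₂ + F₂ * F₁ * (t : ℝ) ^ g₂) * (shrinkage g₃ t * R) := by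
          apply mul_le_mul _ h2 (norm_nonneg _)
          · have := h.F₁_pos; positivity
          · nlinarith
      _ = R * ((F₂ + F₂ * F₁ * (t : ℝ) ^ g₂) * shrinkage g₃ t) := by ring
      _ ≤ _ := mul_le_mul_of_nonneg_left h5 hR
  rw [OnlineProblem.penalizedGap]
  rw [h3] at h1
  simp only [OnlineProblem.lagrangian] at h1 ⊢
  linarith

lemma norm_x_sub_x_le {CΔ : ℝ}
    (hΔ : ∀ t, 1 ≤ t → ∀ i j, ‖S.e t i - S.e t j‖ ≤ CΔ * (t : ℝ) ^ (-(g₁ - g₂ - g₃)))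
    {t : ℕ} (ht : 1 ≤ t) (i j : Fin n) :
    ‖S.x t i - S.x t j‖ ≤ 2 * r * (t : ℝ) ^ (-g₃) + CΔ * (t : ℝ) ^ (-(g₁ - g₂ - g₃)) := by
  have h1 : S.x t i - S.x t j = (S.x t i - S.e t i) + (S.e t i - S.e t j)
      - (S.x t j - S.e t j) := by abel
  rw [h1]
  refine (norm_sub_le _ _).trans ?_
  have := norm_add_le (S.x t i - S.e t i) (S.e t i - S.e t j)
  linarith [h.norm_x_sub_e_le ht i, h.norm_x_sub_e_le ht j, hΔ t ht i j]

/-- Each `l_j` at `x_i` is compared with its value at `e_j`, through exploration radius and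
disagreement. Only local gaps remain, and the penalty may be added since it is nonnegative. -/
lemma netReg_le (hn : 0 < n) {CΔ : ℝ}
    (hΔ : ∀ t, 1 ≤ t → ∀ i j, ‖S.e t i - S.e t j‖ ≤ CΔ * (t : ℝ) ^ (-(g₁ - g₂ - g₃)))
    (T : ℕ) (y : ℕ → Vec p) :
    P.netReg S.x y T
      ≤ 1 / (n : ℝ) * (∑ t ∈ Finset.Icc 1 T, ∑ i, P.penalizedGap i t (S.q t i) (S.e t i) (y t))
        + ∑ t ∈ Finset.Icc 1 T, F₂ * (r * (t : ℝ) ^ (-g₃) + CΔ * (t : ℝ) ^ (-(g₁ - g₂ - g₃))) := by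
  have hn' : (0 : ℝ) < n := by exact_mod_cast hn
  have hF₂ := h.F₂_pos
  rw [OnlineProblem.netReg, Finset.sum_comm, Finset.mul_sum, Finset.mul_sum,
    ← Finset.sum_sub_distrib, ← Finset.sum_add_distrib]
  refine Finset.sum_le_sum fun t ht => ?_
  have ht1 : 1 ≤ t := (Finset.mem_Icc.1 ht).1
  set ε := F₂ * (r * (t : ℝ) ^ (-g₃) + CΔ * (t : ℝ) ^ (-(g₁ - g₂ - g₃))) with hε
  have h1 : ∀ i, P.globalLoss t (S.x t i) ≤ 1 / (n : ℝ) * ∑ j, P.loss j t (S.e t j) + ε := by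
    intro i
    have h2 : ∑ j, P.loss j t (S.x t i) ≤ ∑ j, (P.loss j t (S.e t j) + ε) := by
      refine Finset.sum_le_sum fun j _ => ?_
      have h3 := (abs_le.1 (h.regular.abs_loss_sub_le j ht1 (h.x_mem ht1 i)
        (h.e_mem_X ht1 j))).2
      have h4 : ‖S.x t i - S.e t j‖ ≤ r * (t : ℝ) ^ (-g₃) + CΔ * (t : ℝ) ^ (-(g₁ - g₂ - g₃)) := by
        rw [show S.x t i - S.e t j = (S.x t i - S.e t i) + (S.e t i - S.e t j) by abel]
        exact (norm_add_le _ _).trans (add_le_add (h.norm_x_sub_e_le ht1 i) (hΔ t ht1 i j))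
      have := mul_le_mul_of_nonneg_left h4 hF₂.le
      linarith
    rw [Finset.sum_add_distrib, Finset.sum_const, Finset.card_univ, Fintype.card_fin,
      nsmul_eq_mul] at h2
    have h5 := mul_le_mul_of_nonneg_left h2 (by positivity : 0 ≤ 1 / (n : ℝ))
    rw [OnlineProblem.globalLoss]
    have h6 : 1 / (n : ℝ) * (∑ j, P.loss j t (S.e t j) + n * ε)
        = 1 / (n : ℝ) * ∑ j, P.loss j t (S.e t j) + ε := by field_simp
    linarith
  have h7 : 1 / (n : ℝ) * ∑ i, P.globalLoss t (S.x t i)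
      ≤ 1 / (n : ℝ) * ∑ j, P.loss j t (S.e t j) + ε := by
    have h8 := Finset.sum_le_sum fun i (_ : i ∈ Finset.univ) => h1 i
    rw [Finset.sum_const, Finset.card_univ, Fintype.card_fin, nsmul_eq_mul] at h8
    rw [one_div, inv_mul_le_iff₀ hn', ← one_div]
    exact h8
  have h9 : ∑ i, (P.loss i t (S.e t i) - P.loss i t (y t))
      ≤ ∑ i, P.penalizedGap i t (S.q t i) (S.e t i) (y t) := by
    refine Finset.sum_le_sum fun i _ => ?_
    have := inner_nonneg_of_nonneg (h.q_nonneg ht1 i) (posVec_nonneg (P.con i t (S.e t i)))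
    rw [OnlineProblem.penalizedGap]; linarith
  rw [Finset.sum_sub_distrib] at h9
  have h10 := mul_le_mul_of_nonneg_left h9 (by positivity : 0 ≤ 1 / (n : ℝ))
  rw [show P.globalLoss t (y t) = 1 / (n : ℝ) * ∑ i, P.loss i t (y t) from rfl]
  linarith

/-- The violation of agent `j`'s constraint at `x_i` is compared with that at agent `j`'s own
decision. -/
lemma netCCV_le (hn : 0 < n) {CΔ : ℝ}
    (hΔ : ∀ t, 1 ≤ t → ∀ i j, ‖S.e t i - S.e t j‖ ≤ CΔ * (t : ℝ) ^ (-(g₁ - g₂ - g₃)))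
    (T : ℕ) :
    P.netCCV S.x T
      ≤ ∑ j, ∑ t ∈ Finset.Icc 1 T, ‖posVec (P.con j t (S.x t j))‖
        + n * (2 * F₂) * ∑ t ∈ Finset.Icc 1 T,
          (2 * r * (t : ℝ) ^ (-g₃) + CΔ * (t : ℝ) ^ (-(g₁ - g₂ - g₃))) := by
  have hn' : (0 : ℝ) < n := by exact_mod_cast hn
  have hF₂ := h.F₂_pos
  rw [OnlineProblem.netCCV, one_div, inv_mul_le_iff₀ hn']
  have key : ∀ i, ∑ t ∈ Finset.Icc 1 T, ‖posVec (P.globalCon t (S.x t i))‖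
      ≤ ∑ j, ∑ t ∈ Finset.Icc 1 T, ‖posVec (P.con j t (S.x t j))‖
        + n * (2 * F₂) * ∑ t ∈ Finset.Icc 1 T,
          (2 * r * (t : ℝ) ^ (-g₃) + CΔ * (t : ℝ) ^ (-(g₁ - g₂ - g₃))) := by
    intro i
    rw [Finset.sum_comm, Finset.mul_sum, ← Finset.sum_add_distrib]
    refine Finset.sum_le_sum fun t ht => ?_
    have ht1 : 1 ≤ t := (Finset.mem_Icc.1 ht).1
    refine (P.norm_posVec_globalCon_le t _).trans ?_
    have h1 : ∀ j, ‖posVec (P.con j t (S.x t i))‖ ≤ ‖posVec (P.con j t (S.x t j))‖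
        + 2 * F₂ * (2 * r * (t : ℝ) ^ (-g₃) + CΔ * (t : ℝ) ^ (-(g₁ - g₂ - g₃))) := by
      intro j
      have h2 := norm_le_norm_add_norm_sub' (posVec (P.con j t (S.x t i)))
        (posVec (P.con j t (S.x t j)))
      have h3 := (norm_posVec_sub_le _ _).trans
        (h.regular.norm_con_sub_le j ht1 hF₂.le (h.x_mem ht1 i) (h.x_mem ht1 j))
      have h4 := mul_le_mul_of_nonneg_left (h.norm_x_sub_x_le hΔ ht1 i j)
        (by positivity : 0 ≤ 2 * F₂)
      linarith
    refine (Finset.sum_le_sum fun j _ => h1 j).trans (le_of_eq ?_)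
    rw [Finset.sum_add_distrib, Finset.sum_const, Finset.card_univ, Fintype.card_fin,
      nsmul_eq_mul]
    ring
  have := Finset.sum_le_sum fun i (_ : i ∈ Finset.univ) => key i
  rwa [Finset.sum_const, Finset.card_univ, Fintype.card_fin, nsmul_eq_mul] at this

/-- The violations along a path, weighted by a multiplier `V`, are controlled by the penalized
gaps. -/
lemma mul_sum_norm_con_le {V : ℝ} (hV : 0 ≤ V) {T : ℕ} {y : ℕ → Vec p}
    (hy : P.IsFeasible T y) :
    V * ∑ i, ∑ t ∈ Finset.Icc 1 T, ‖posVec (P.con i t (S.x t i))‖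
      ≤ ∑ t ∈ Finset.Icc 1 T, ∑ i, P.penalizedGap i t (S.q t i) (S.e t i) (y t)
        + (1 + ∑ t ∈ Finset.Icc 1 T, (t : ℝ) ^ (-g₂)) * ((∑ i, (m i : ℝ)) * V ^ 2)
        + n * (2 * F₁ + F₁ * F₂ * r + 2 * F₁ ^ 2) * T := by
  have hF₁ := h.F₁_pos
  have hF₂ := h.F₂_pos
  have hr := h.r_pos
  have h1 : ∀ i, ∑ t ∈ Finset.Icc 1 T, inner ℝ (S.q t i) (posVec (P.con i t (S.x t i)))
      ≤ ∑ t ∈ Finset.Icc 1 T, P.penalizedGap i t (S.q t i) (S.e t i) (y t)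
        + (2 * F₁ + F₁ * F₂ * r) * T := by
    intro i
    -- Loss differences are at least `-2 F₁`, so the penalty at `e` exceeds the gap by at most `2
    -- F₁`; the other term moves the penalty from `e` to `x`.
    have h2 : ∀ t ∈ Finset.Icc 1 T, inner ℝ (S.q t i) (posVec (P.con i t (S.x t i)))
        ≤ P.penalizedGap i t (S.q t i) (S.e t i) (y t) + (2 * F₁ + F₁ * F₂ * r) := by
      intro t ht
      have ht1 : 1 ≤ t := (Finset.mem_Icc.1 ht).1
      have htp : (1 : ℝ) ≤ t := by exact_mod_cast ht1
      have h3 := (abs_le.1 (h.regular.abs_inner_posVec_sub_le i ht1 hF₂.le (S.q t i)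
        (h.x_mem ht1 i) (h.e_mem_X ht1 i))).2
      have h4 := (abs_le.1 (h.regular.loss_bound i t ht1 _ (h.e_mem_X ht1 i))).1
      have h5 := (abs_le.1 (h.regular.loss_bound i t ht1 _ (hy t ht).1)).2
      have h6 : ‖S.q t i‖ * (2 * F₂ * ‖S.x t i - S.e t i‖) ≤ F₁ * F₂ * r := by
        -- By `g₂ < g₃`, the decay of the exploration radius beats the growth of the multiplier.
        have h7 : (t : ℝ) ^ g₂ * (t : ℝ) ^ (-g₃) ≤ 1 := by
          rw [← Real.rpow_add (by linarith)]
          exact Real.rpow_le_one_of_one_le_of_nonpos htp (by linarith [h.g₃_mem.1])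
        calc _ ≤ (F₁ / 2 * (t : ℝ) ^ g₂) * (2 * F₂ * (r * (t : ℝ) ^ (-g₃))) := by
              apply mul_le_mul (h.norm_q_le ht1 i) _ (by positivity) (by positivity)
              exact mul_le_mul_of_nonneg_left (h.norm_x_sub_e_le ht1 i) (by positivity)
          _ = F₁ * F₂ * r * ((t : ℝ) ^ g₂ * (t : ℝ) ^ (-g₃)) := by ring
          _ ≤ F₁ * F₂ * r * 1 := mul_le_mul_of_nonneg_left h7 (by positivity)
          _ = _ := mul_one _
      rw [OnlineProblem.penalizedGap]
      linarith
    refine (Finset.sum_le_sum h2).trans (le_of_eq ?_)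
    rw [Finset.sum_add_distrib, Finset.sum_const, Nat.card_Icc, nsmul_eq_mul]
    simp only [Nat.add_sub_cancel]
    ring
  rw [Finset.mul_sum, Finset.sum_comm]
  have h2 := Finset.sum_le_sum fun i (_ : i ∈ Finset.univ) =>
    (h.norm_con_sum_le i hV T).trans (add_le_add (add_le_add (h1 i) le_rfl) le_rfl)
  refine h2.trans (le_of_eq ?_)
  rw [Finset.sum_add_distrib, Finset.sum_add_distrib, Finset.sum_add_distrib, Finset.sum_const,
    Finset.sum_const, Finset.card_univ, Fintype.card_fin, nsmul_eq_mul, nsmul_eq_mul,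
    ← Finset.mul_sum, Finset.sum_mul]
  ring

end IsPolyRun

/-! ### The expected penalized gap of one round -/

namespace IsPolyRunFamily

variable {n p : ℕ} {m : Fin n → ℕ} {r R F₁ F₂ w : ℝ} {B : ℕ} {g₁ g₂ g₃ : ℝ}
  {P : OnlineProblem n p m} {dl : Fin n → ℕ → Vec p → Vec p}
  {dc : (i : Fin n) → ℕ → Vec p → (Vec p →L[ℝ] Vec (m i))}
  {G : ℕ → Digraph (Fin n)} {W : ℕ → Matrix (Fin n) (Fin n) ℝ} {e₁ : Fin n → Vec p}
  {Ω : Type*} {u : ℕ → Fin n → Ω → Metric.sphere (0 : Vec p) 1} {S : Ω → Trajectory n p m}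
  [mΩ : MeasurableSpace Ω] {Pr : Measure Ω} [IsProbabilityMeasure Pr]

section Integrability

variable (h : IsPolyRunFamily r R F₁ F₂ w B g₁ g₂ g₃ P dl dc G W e₁ u S)
  (hu : IsUniformSampling Pr u)
include h hu

lemma integrable_penalizedGap {t : ℕ} (ht : 1 ≤ t) (i : Fin n) (y : Vec p) :
    Integrable (fun a => P.penalizedGap i t ((S a).q t i) ((S a).e t i) y) Pr := by
  have h1 := (integrable_lagrangian h hu ht i (measurable_e h hu ht i)
    fun a => (h a).e_mem_X ht i).sub (integrable_const (P.loss i t y))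
  refine h1.congr (.of_forall fun a => ?_)
  simp only [Pi.sub_apply, OnlineProblem.lagrangian, OnlineProblem.penalizedGap]
  ring

lemma integrable_netReg (T : ℕ) (y : ℕ → Vec p) :
    Integrable (fun a => P.netReg (S a).x y T) Pr := by
  simp only [OnlineProblem.netReg, OnlineProblem.globalLoss]
  refine ((integrable_finsetSum _ fun i _ => integrable_finsetSum _ fun t ht =>
    (integrable_finsetSum _ fun j _ => ?_).const_mul _).const_mul _).sub (integrable_const _)
  have ht1 : 1 ≤ t := (Finset.mem_Icc.1 ht).1
  exact Integrable.of_bound (measurable_loss h ht1 j (measurable_x h hu ht1 i)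
    fun a => (h a).x_mem ht1 i).aestronglyMeasurable F₁
    (.of_forall fun a => (h a).regular.loss_bound j t ht1 _ ((h a).x_mem ht1 i))

lemma integrable_netCCV (T : ℕ) : Integrable (fun a => P.netCCV (S a).x T) Pr := by
  simp only [OnlineProblem.netCCV]
  refine (integrable_finsetSum _ fun i _ => integrable_finsetSum _ fun t ht => ?_).const_mul _
  have ht1 : 1 ≤ t := (Finset.mem_Icc.1 ht).1
  have h1 : (fun a => ‖posVec (P.globalCon t ((S a).x t i))‖)
      = fun a => √(∑ j, ‖posVec (P.con j t ((S a).x t i))‖ ^ 2) := by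
    ext a
    rw [← P.norm_posVec_globalCon_sq, Real.sqrt_sq (norm_nonneg _)]
  have hm : Measurable fun a => ‖posVec (P.globalCon t ((S a).x t i))‖ := by
    rw [h1]
    exact (Finset.measurable_fun_sum _ fun j _ => ((measurable_posVec_con h ht1 j
      (measurable_x h hu ht1 i) fun a => (h a).x_mem ht1 i).norm.pow_const 2)).sqrt
  apply Integrable.of_bound hm.aestronglyMeasurable (∑ _j : Fin n, F₁)
  refine .of_forall fun a => ?_
  rw [norm_norm]
  exact (P.norm_posVec_globalCon_le t _).trans (Finset.sum_le_sum fun j _ =>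
    (h a).regular.norm_posVec_con_le j ht1 ((h a).x_mem ht1 i))

/-- The expected penalized gap of one round, bounded by the decrease of the squared distances to
the shrunk benchmark. -/
lemma integral_sum_penalizedGap_le {μ : ℝ} (hμ : P.LossStronglyConvex μ dl) {CΔ : ℝ}
    (hΔ : ∀ a t, 1 ≤ t → ∀ i j,
      ‖(S a).e t i - (S a).e t j‖ ≤ CΔ * (t : ℝ) ^ (-(g₁ - g₂ - g₃)))
    {T t : ℕ} {y : ℕ → Vec p} (hy : P.IsFeasible T y) (ht : t ∈ Finset.Icc 1 T) :
    ∫ a, ∑ i, P.penalizedGap i t ((S a).q t i) ((S a).e t i) (y t) ∂Pr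
      ≤ ∫ a, ∑ i, (IsPolyRun.invStep p r F₁ g₁ t
            * (‖(S a).e t i - (1 - shrinkage g₃ t) • y t‖ ^ 2
              - ‖(S a).e (t + 1) i - (1 - shrinkage g₃ t) • y t‖ ^ 2)
            - μ / 2 * ‖(S a).e t i - (1 - shrinkage g₃ t) • y t‖ ^ 2) ∂Pr
        + (n * (2 * p / r * (F₁ + F₁ ^ 2)
          * (r ^ 2 / (20 * (p : ℝ) ^ 2 * F₁ ^ 2) * (2 * p / r * (F₁ + F₁ ^ 2)) + CΔ))
          * (t : ℝ) ^ (-g₁ + 2 * g₂ + 2 * g₃)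
        + n * ((2 * r + R) * (F₂ * (1 + F₁))) * (t : ℝ) ^ (g₂ - g₃)) := by
  have ht1 : 1 ≤ t := (Finset.mem_Icc.1 ht).1
  set y' := (1 - shrinkage g₃ t) • y t with hy'
  have hy'mem : y' ∈ (1 - shrinkage g₃ t) • P.X := Set.smul_mem_smul_set (hy t ht).1
  have hN := fun i => integrable_norm_sub_sq h hu ht1 i y'
  have hN' := fun i => integrable_norm_sub_sq h hu (Nat.le_add_left 1 t) i y'
  have hI := fun i => integrable_inner_dir h hu ht1 i y'
  -- `R` stems from shrinking the benchmark, `2 r` from the smoothing error of the estimator.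
  set c := (2 * r + R) * (F₂ * (1 + F₁)) * (t : ℝ) ^ (g₂ - g₃) with hc
  have hone : ∀ i, ∫ a, P.penalizedGap i t ((S a).q t i) ((S a).e t i) (y t) ∂Pr
      ≤ ∫ a, (inner ℝ ((S a).dir (t + 1) i) ((S a).e t i - y')
        - μ / 2 * ‖(S a).e t i - y'‖ ^ 2 + c) ∂Pr := by
    intro i
    have h1 := integral_lagrangian_sub_le h hu hμ ht1 i hy'mem
    have hy'X : y' ∈ P.X := by
      obtain ⟨a₀⟩ : Nonempty Ω := Pr.nonempty_of_neZero
      exact (h a₀).regular.smul_subset_self (h a₀).r_pos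
        (Set.Ioc_subset_Icc_self ((h a₀).shrinkage_mem t)) hy'mem
    have hL := ((((integrable_lagrangian h hu ht1 i (measurable_e h hu ht1 i)
      fun a => (h a).e_mem_X ht1 i).sub (integrable_lagrangian h hu ht1 i measurable_const
      fun _ => hy'X)).add ((hN i).const_mul (μ / 2))).sub
      (integrable_const (2 * ((F₂ + 2 * F₂ * (F₁ / 2 * (t : ℝ) ^ g₂)) * (r * shrinkage g₃ t)))))
    -- The strong convexity term is added to the bracket, as the mean estimate requires, and
    -- subtracted here; it survives to absorb the growth of the weights.
    have hν : Integrable (fun a => c - μ / 2 * ‖(S a).e t i - y'‖ ^ 2) Pr :=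
      (integrable_const c).sub ((hN i).const_mul (μ / 2))
    calc _ ≤ ∫ a, ((P.lagrangian i t ((S a).q t i) ((S a).e t i)
            - P.lagrangian i t ((S a).q t i) y' + μ / 2 * ‖(S a).e t i - y'‖ ^ 2
            - 2 * ((F₂ + 2 * F₂ * (F₁ / 2 * (t : ℝ) ^ g₂)) * (r * shrinkage g₃ t)))
            + (c - μ / 2 * ‖(S a).e t i - y'‖ ^ 2)) ∂Pr := by
          apply integral_mono (integrable_penalizedGap h hu ht1 i _) (hL.add hν)
          intro a
          have h2 := (h a).penalizedGap_le hy ht i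
          have h3 := mul_le_mul_of_nonneg_left ((h a).rpow_mul_shrinkage_le ht1)
            (by have := (h a).r_pos; positivity : 0 ≤ 2 * r)
          simp only [Pi.add_apply, Pi.sub_apply]
          simp only [hc]
          rw [← hy'] at h2
          linarith
      _ = (∫ a, (P.lagrangian i t ((S a).q t i) ((S a).e t i)
            - P.lagrangian i t ((S a).q t i) y' + μ / 2 * ‖(S a).e t i - y'‖ ^ 2
            - 2 * ((F₂ + 2 * F₂ * (F₁ / 2 * (t : ℝ) ^ g₂)) * (r * shrinkage g₃ t))) ∂Pr)
            + ∫ a, (c - μ / 2 * ‖(S a).e t i - y'‖ ^ 2) ∂Pr := integral_add hL hν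
      _ ≤ (∫ a, inner ℝ ((S a).dir (t + 1) i) ((S a).e t i - y') ∂Pr)
            + ∫ a, (c - μ / 2 * ‖(S a).e t i - y'‖ ^ 2) ∂Pr := add_le_add h1 le_rfl
      _ = _ := by
          rw [← integral_add (hI i) hν]
          congr 1
          ext a
          ring
  have hJ : ∀ i, Integrable (fun a => inner ℝ ((S a).dir (t + 1) i) ((S a).e t i - y')
        - μ / 2 * ‖(S a).e t i - y'‖ ^ 2 + c) Pr := fun i =>
    ((hI i).sub ((hN i).const_mul _)).add (integrable_const _)
  have hZ : Integrable (fun a => ∑ i, (IsPolyRun.invStep p r F₁ g₁ t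
      * (‖(S a).e t i - y'‖ ^ 2 - ‖(S a).e (t + 1) i - y'‖ ^ 2)
      - μ / 2 * ‖(S a).e t i - y'‖ ^ 2)) Pr :=
    integrable_finsetSum _ fun i _ =>
      (((hN i).sub (hN' i)).const_mul _).sub ((hN i).const_mul _)
  rw [integral_finsetSum _ fun i _ => integrable_penalizedGap h hu ht1 i _]
  refine (Finset.sum_le_sum fun i _ => hone i).trans ?_
  rw [← integral_finsetSum _ fun i _ => hJ i]
  have hconst := integral_const (μ := Pr) (n * (2 * p / r * (F₁ + F₁ ^ 2)
          * (r ^ 2 / (20 * (p : ℝ) ^ 2 * F₁ ^ 2) * (2 * p / r * (F₁ + F₁ ^ 2)) + CΔ))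
          * (t : ℝ) ^ (-g₁ + 2 * g₂ + 2 * g₃)
        + n * ((2 * r + R) * (F₂ * (1 + F₁))) * (t : ℝ) ^ (g₂ - g₃))
  rw [probReal_univ, one_smul] at hconst
  rw [← hconst, ← integral_add hZ (integrable_const _)]
  apply integral_mono (integrable_finsetSum _ fun i _ => hJ i) (hZ.add (integrable_const _))
  intro a
  have h2 := (h a).sum_inner_dir_le (hΔ a) ht1 hy'mem
  simp only [Finset.sum_add_distrib, Finset.sum_sub_distrib, ← Finset.mul_sum, Finset.sum_const,
    Finset.card_univ, Fintype.card_fin, nsmul_eq_mul, Pi.add_apply, hc]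
  linarith

end Integrability

end IsPolyRunFamily

/-! ### Summation over the rounds and expected rates -/

lemma sum_rpow_le_mul_rpow {a b : ℝ} (ha : -1 < a) (ha0 : a ≤ 0) (hb : 1 + a ≤ b) {T : ℕ}
    (hT : 1 ≤ T) : ∑ t ∈ Finset.Icc 1 T, (t : ℝ) ^ a ≤ 1 / (1 + a) * (T : ℝ) ^ b := by
  refine (sum_rpow_le ha ha0 T).trans ?_
  rw [div_eq_mul_one_div, mul_comm]
  apply mul_le_mul_of_nonneg_left _ (one_div_nonneg.2 (by linarith))
  exact Real.rpow_le_rpow_of_exponent_le (by exact_mod_cast hT) hb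

lemma sum_rpow_mul_le_pathLength {p : ℕ} {g : ℝ} (hg : 0 ≤ g) (y : ℕ → Vec p) (T : ℕ) :
    ∑ t ∈ Finset.Ico 1 T, (t : ℝ) ^ g * ‖y (t + 1) - y t‖ ≤ (T : ℝ) ^ g * pathLength y T := by
  rw [pathLength, Finset.mul_sum]
  refine Finset.sum_le_sum fun t ht => mul_le_mul_of_nonneg_right ?_ (norm_nonneg _)
  exact Real.rpow_le_rpow (by positivity)
    (by exact_mod_cast (Finset.mem_Ico.1 ht).2.le) hg

lemma pathLength_nonneg {p : ℕ} (y : ℕ → Vec p) (T : ℕ) : 0 ≤ pathLength y T :=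
  Finset.sum_nonneg fun _ _ => norm_nonneg _

lemma pathLength_const {p : ℕ} (y₀ : Vec p) (T : ℕ) : pathLength (fun _ => y₀) T = 0 := by
  simp [pathLength]

namespace IsPolyRunFamily

/-- The expected cumulative penalized gap, for given rates of the disagreement and of the growth
of the inverse step sizes. -/
lemma integral_penalizedGap_le {n p : ℕ} {m : Fin n → ℕ} {r R F₁ F₂ w : ℝ} {B : ℕ} {g₁ g₂ g₃ : ℝ}
    {P : OnlineProblem n p m} {dl : Fin n → ℕ → Vec p → Vec p}
    {dc : (i : Fin n) → ℕ → Vec p → (Vec p →L[ℝ] Vec (m i))}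
    {G : ℕ → Digraph (Fin n)} {W : ℕ → Matrix (Fin n) (Fin n) ℝ} {e₁ : Fin n → Vec p}
    {Ω : Type*} {u : ℕ → Fin n → Ω → Metric.sphere (0 : Vec p) 1} {S : Ω → Trajectory n p m}
    [mΩ : MeasurableSpace Ω] {Pr : Measure Ω} [IsProbabilityMeasure Pr]
    (h : IsPolyRunFamily r R F₁ F₂ w B g₁ g₂ g₃ P dl dc G W e₁ u S)
    (hu : IsUniformSampling Pr u) {μ : ℝ} (hμ0 : 0 ≤ μ) (hμ : P.LossStronglyConvex μ dl)
    {CΔ : ℝ} (hCΔ : 0 ≤ CΔ)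
    (hΔ : ∀ a t, 1 ≤ t → ∀ i j,
      ‖(S a).e t i - (S a).e t j‖ ≤ CΔ * (t : ℝ) ^ (-(g₁ - g₂ - g₃)))
    {A K : ℝ} (hA : A = 10 * (p : ℝ) ^ 2 * F₁ ^ 2 / r ^ 2) (hK : 0 ≤ K)
    (hK' : ∀ t : ℕ, 1 ≤ t → A * (t : ℝ) ^ (-(1 - g₁)) - μ / 2 ≤ K * (t : ℝ) ^ (-1 : ℝ))
    {T : ℕ} (hT : 1 ≤ T) {y : ℕ → Vec p} (hy : P.IsFeasible T y) :
    ∫ a, ∑ t ∈ Finset.Icc 1 T, ∑ i,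
        P.penalizedGap i t ((S a).q t i) ((S a).e t i) (y t) ∂Pr
      ≤ (n * (16 * A * R ^ 2 + 4 * R ^ 2 * K) * (1 / (1 + (g₂ - g₃))) + n * (12 * A * R)
          + n * (2 * p / r * (F₁ + F₁ ^ 2)
          * (r ^ 2 / (20 * (p : ℝ) ^ 2 * F₁ ^ 2) * (2 * p / r * (F₁ + F₁ ^ 2)) + CΔ))
            * (1 / (1 + (-g₁ + 2 * g₂ + 2 * g₃)))
          + n * ((2 * r + R) * (F₂ * (1 + F₁))) * (1 / (1 + (g₂ - g₃))))
        * ((T : ℝ) ^ max (1 - g₁ + 2 * g₂ + 2 * g₃) (1 + g₂ - g₃)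
          + (T : ℝ) ^ g₁ * pathLength y T) := by
  obtain ⟨a₀⟩ : Nonempty Ω := Pr.nonempty_of_neZero
  have h₀ := h a₀
  have hR := h₀.regular.R_nonneg h₀.r_pos
  have hr := h₀.r_pos
  have hF₁ := h₀.F₁_pos
  have hF₂ := h₀.F₂_pos
  have hg₁ := h₀.g₁_mem
  have hg₂ := h₀.g₂_mem
  have hg₃ := h₀.g₃_mem
  have hg₃1 := h₀.g₃_lt_one
  have hA0 : 0 ≤ A := by rw [hA]; positivity
  set M := max (1 - g₁ + 2 * g₂ + 2 * g₃) (1 + g₂ - g₃) with hM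
  set D₁ := n * (2 * p / r * (F₁ + F₁ ^ 2)
          * (r ^ 2 / (20 * (p : ℝ) ^ 2 * F₁ ^ 2) * (2 * p / r * (F₁ + F₁ ^ 2)) + CΔ)) with hD₁
  set D₂ := n * ((2 * r + R) * (F₂ * (1 + F₁))) with hD₂
  set K₁ := 16 * A * R ^ 2 + 4 * R ^ 2 * K with hK₁
  set K₂ := 12 * A * R with hK₂
  have hD₁0 : 0 ≤ D₁ := by positivity
  have hD₂0 : 0 ≤ D₂ := by positivity
  have hK₁0 : 0 ≤ K₁ := by positivity
  have hK₂0 : 0 ≤ K₂ := by positivity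
  set Q₁ := 1 / (1 + (g₂ - g₃)) with hQ₁
  set Q₂ := 1 / (1 + (-g₁ + 2 * g₂ + 2 * g₃)) with hQ₂
  have hQ₁0 : 0 ≤ Q₁ := one_div_nonneg.2 (by linarith [hg₂.1])
  have hQ₂0 : 0 ≤ Q₂ := one_div_nonneg.2 (by linarith [hg₁.2, hg₂.1, hg₃.1])
  have s₁ : ∑ t ∈ Finset.Icc 1 T, (t : ℝ) ^ (g₂ - g₃) ≤ Q₁ * (T : ℝ) ^ M :=
    sum_rpow_le_mul_rpow (by linarith [hg₂.1]) (by linarith [hg₃.1])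
      (by rw [hM]; exact le_max_of_le_right (by linarith)) hT
  have s₂ : ∑ t ∈ Finset.Icc 1 T, (t : ℝ) ^ (-g₁ + 2 * g₂ + 2 * g₃) ≤ Q₂ * (T : ℝ) ^ M :=
    sum_rpow_le_mul_rpow (by linarith [hg₁.2, hg₂.1, hg₃.1]) (by linarith [hg₃.2])
      (by rw [hM]; exact le_max_of_le_left (by linarith)) hT
  have s₃ := sum_rpow_mul_le_pathLength hg₁.1.le y T
  have hPL := pathLength_nonneg y T
  rw [integral_finsetSum _ fun t ht => integrable_finsetSum _ fun i _ =>
    integrable_penalizedGap h hu (Finset.mem_Icc.1 ht).1 i (y t)]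
  have step := Finset.sum_le_sum fun t ht => integral_sum_penalizedGap_le h hu hμ hΔ hy ht
  refine step.trans ?_
  rw [Finset.sum_add_distrib, ← integral_finsetSum]
  swap
  · intro t ht
    have ht1 : 1 ≤ t := (Finset.mem_Icc.1 ht).1
    exact integrable_finsetSum _ fun i _ =>
      (((integrable_norm_sub_sq h hu ht1 i _).sub
        (integrable_norm_sub_sq h hu (Nat.le_add_left 1 t) i _)).const_mul _).sub
        ((integrable_norm_sub_sq h hu ht1 i _).const_mul _)
  have hpath : ∀ a, ∑ t ∈ Finset.Icc 1 T, ∑ i, (IsPolyRun.invStep p r F₁ g₁ t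
            * (‖(S a).e t i - (1 - shrinkage g₃ t) • y t‖ ^ 2
              - ‖(S a).e (t + 1) i - (1 - shrinkage g₃ t) • y t‖ ^ 2)
            - μ / 2 * ‖(S a).e t i - (1 - shrinkage g₃ t) • y t‖ ^ 2)
      ≤ n * (K₁ * (Q₁ * (T : ℝ) ^ M) + K₂ * ((T : ℝ) ^ g₁ * pathLength y T)) := by
    intro a
    rw [Finset.sum_comm]
    have h1 : ∀ i : Fin n, ∑ t ∈ Finset.Icc 1 T, (IsPolyRun.invStep p r F₁ g₁ t
            * (‖(S a).e t i - (1 - shrinkage g₃ t) • y t‖ ^ 2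
              - ‖(S a).e (t + 1) i - (1 - shrinkage g₃ t) • y t‖ ^ 2)
            - μ / 2 * ‖(S a).e t i - (1 - shrinkage g₃ t) • y t‖ ^ 2)
        ≤ K₁ * (Q₁ * (T : ℝ) ^ M) + K₂ * ((T : ℝ) ^ g₁ * pathLength y T) := by
      intro i
      have h2 := sum_weighted_dist_sub_le hA0 hR hK hμ0 hg₁ hg₂.1 h₀.g₃_pos hg₃1 hK'
        (e := fun t => (S a).e t i) (fun t ht => (h a).norm_e_le ht i) hT
        (fun t ht => h₀.regular.norm_le (hy t ht).1)
      have h3 : 0 ≤ A * ((T : ℝ) + 2) ^ g₁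
          * ‖(S a).e (T + 1) i - (1 - shrinkage g₃ T) • y T‖ ^ 2 := by positivity
      have h4 := mul_le_mul_of_nonneg_left s₁ hK₁0
      have h5 := mul_le_mul_of_nonneg_left s₃ hK₂0
      simp only [IsPolyRun.invStep, ← hA]
      linarith
    have h2 := Finset.sum_le_sum fun i (_ : i ∈ Finset.univ) => h1 i
    rwa [Finset.sum_const, Finset.card_univ, Fintype.card_fin, nsmul_eq_mul] at h2
  have hint : ∫ a, ∑ t ∈ Finset.Icc 1 T, ∑ i, (IsPolyRun.invStep p r F₁ g₁ t
            * (‖(S a).e t i - (1 - shrinkage g₃ t) • y t‖ ^ 2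
              - ‖(S a).e (t + 1) i - (1 - shrinkage g₃ t) • y t‖ ^ 2)
            - μ / 2 * ‖(S a).e t i - (1 - shrinkage g₃ t) • y t‖ ^ 2) ∂Pr
      ≤ n * (K₁ * (Q₁ * (T : ℝ) ^ M) + K₂ * ((T : ℝ) ^ g₁ * pathLength y T)) := by
    refine (integral_mono (integrable_finsetSum _ fun t ht => integrable_finsetSum _ fun i _ => ?_)
      (integrable_const _) hpath).trans (le_of_eq ?_)
    · have ht1 : 1 ≤ t := (Finset.mem_Icc.1 ht).1
      exact (((integrable_norm_sub_sq h hu ht1 i _).sub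
        (integrable_norm_sub_sq h hu (Nat.le_add_left 1 t) i _)).const_mul _).sub
        ((integrable_norm_sub_sq h hu ht1 i _).const_mul _)
    · rw [integral_const, probReal_univ, one_smul]
  rw [Finset.sum_add_distrib, ← Finset.mul_sum, ← Finset.mul_sum]
  have e₁ := mul_le_mul_of_nonneg_left s₂ hD₁0
  have e₂ := mul_le_mul_of_nonneg_left s₁ hD₂0
  have hX : 0 ≤ (T : ℝ) ^ M := by positivity
  have hY : 0 ≤ (T : ℝ) ^ g₁ * pathLength y T := by positivity
  -- The cross terms missing from the product of the total constant with the sum of the two rates.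
  have c₁ : 0 ≤ (n : ℝ) * K₂ * (T : ℝ) ^ M := by positivity
  have c₂ : 0 ≤ (n * K₁ * Q₁ + D₁ * Q₂ + D₂ * Q₁) * ((T : ℝ) ^ g₁ * pathLength y T) := by
    positivity
  linarith

/-- The expected regret in terms of a bound on the expected penalized gap. -/
lemma integral_netReg_le
    {n p : ℕ} {m : Fin n → ℕ} {r R F₁ F₂ w : ℝ} {B : ℕ} {g₁ g₂ g₃ : ℝ}
    {P : OnlineProblem n p m} {dl : Fin n → ℕ → Vec p → Vec p}
    {dc : (i : Fin n) → ℕ → Vec p → (Vec p →L[ℝ] Vec (m i))}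
    {G : ℕ → Digraph (Fin n)} {W : ℕ → Matrix (Fin n) (Fin n) ℝ} {e₁ : Fin n → Vec p}
    {Ω : Type*} {u : ℕ → Fin n → Ω → Metric.sphere (0 : Vec p) 1} {S : Ω → Trajectory n p m}
    [mΩ : MeasurableSpace Ω] {Pr : Measure Ω} [IsProbabilityMeasure Pr]
    (h : IsPolyRunFamily r R F₁ F₂ w B g₁ g₂ g₃ P dl dc G W e₁ u S)
    (hu : IsUniformSampling Pr u) (hn : 0 < n) {CΔ : ℝ} (hCΔ : 0 ≤ CΔ)
    (hΔ : ∀ a t, 1 ≤ t → ∀ i j,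
      ‖(S a).e t i - (S a).e t j‖ ≤ CΔ * (t : ℝ) ^ (-(g₁ - g₂ - g₃)))
    {T : ℕ} (hT : 1 ≤ T) {C₀ : ℝ} (hC₀ : 0 ≤ C₀)
    (y : ℕ → Vec p)
    (hgap : ∫ a, ∑ t ∈ Finset.Icc 1 T, ∑ i,
        P.penalizedGap i t ((S a).q t i) ((S a).e t i) (y t) ∂Pr
      ≤ C₀ * ((T : ℝ) ^ max (1 - g₁ + 2 * g₂ + 2 * g₃) (1 + g₂ - g₃)
          + (T : ℝ) ^ g₁ * pathLength y T)) :
    ∫ a, P.netReg (S a).x y T ∂Pr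
      ≤ (C₀ + F₂ * (r * (1 / (1 + (g₂ - g₃))) + CΔ * (1 / (1 + (-g₁ + 2 * g₂ + 2 * g₃)))))
        * ((T : ℝ) ^ max (1 - g₁ + 2 * g₂ + 2 * g₃) (1 + g₂ - g₃)
          + (T : ℝ) ^ g₁ * pathLength y T) := by
  obtain ⟨a₀⟩ : Nonempty Ω := Pr.nonempty_of_neZero
  have hr := (h a₀).r_pos
  have hF₁ := (h a₀).F₁_pos
  have hF₂ := (h a₀).F₂_pos
  have hg₁ := (h a₀).g₁_mem
  have hg₂ := (h a₀).g₂_mem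
  have hg₃ := (h a₀).g₃_mem
  have hg₃0 := (h a₀).g₃_pos
  have hg₃1 := (h a₀).g₃_lt_one
  have hT1 : (1 : ℝ) ≤ T := by exact_mod_cast hT
  set M := max (1 - g₁ + 2 * g₂ + 2 * g₃) (1 + g₂ - g₃) with hM
  set Q₁ := 1 / (1 + (g₂ - g₃)) with hQ₁
  set Q₂ := 1 / (1 + (-g₁ + 2 * g₂ + 2 * g₃)) with hQ₂
  have hQ₁0 : 0 ≤ Q₁ := one_div_nonneg.2 (by linarith [hg₂.1])
  have hQ₂0 : 0 ≤ Q₂ := one_div_nonneg.2 (by linarith [hg₁.2, hg₂.1, hg₃.1])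
  set E₁ := F₂ * (r * Q₁ + CΔ * Q₂) with hE₁
  have hE₁0 : 0 ≤ E₁ := by positivity
  have hgapi : Integrable (fun a => ∑ t ∈ Finset.Icc 1 T, ∑ i,
      P.penalizedGap i t ((S a).q t i) ((S a).e t i) (y t)) Pr :=
    integrable_finsetSum _ fun t ht => integrable_finsetSum _ fun i _ =>
      integrable_penalizedGap h hu (Finset.mem_Icc.1 ht).1 i (y t)
  have hsum : ∑ t ∈ Finset.Icc 1 T, F₂ * (r * (t : ℝ) ^ (-g₃)
      + CΔ * (t : ℝ) ^ (-(g₁ - g₂ - g₃))) ≤ E₁ * (T : ℝ) ^ M := by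
    have s₁ : ∑ t ∈ Finset.Icc 1 T, (t : ℝ) ^ (-g₃) ≤ Q₁ * (T : ℝ) ^ M := by
      refine le_trans (Finset.sum_le_sum fun t ht => ?_)
        (sum_rpow_le_mul_rpow (a := g₂ - g₃) (by linarith [hg₂.1]) (by linarith [hg₃.1])
        (by rw [hM]; exact le_max_of_le_right (by linarith)) hT)
      exact Real.rpow_le_rpow_of_exponent_le
        (by exact_mod_cast (Finset.mem_Icc.1 ht).1) (by linarith [hg₂.1, hg₃0])
    have s₂ : ∑ t ∈ Finset.Icc 1 T, (t : ℝ) ^ (-(g₁ - g₂ - g₃)) ≤ Q₂ * (T : ℝ) ^ M := by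
      refine le_trans (Finset.sum_le_sum fun t ht => ?_)
        (sum_rpow_le_mul_rpow (a := -g₁ + 2 * g₂ + 2 * g₃)
        (by linarith [hg₁.2, hg₂.1, hg₃.1]) (by linarith [hg₃.2])
        (by rw [hM]; exact le_max_of_le_left (by linarith)) hT)
      exact Real.rpow_le_rpow_of_exponent_le
        (by exact_mod_cast (Finset.mem_Icc.1 ht).1) (by linarith [hg₂.1, hg₃0])
    rw [← Finset.mul_sum, Finset.sum_add_distrib, ← Finset.mul_sum, ← Finset.mul_sum, hE₁,
      mul_assoc F₂]
    apply mul_le_mul_of_nonneg_left _ hF₂.le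
    nlinarith [mul_le_mul_of_nonneg_left s₁ hr.le, mul_le_mul_of_nonneg_left s₂ hCΔ]
  set X := (T : ℝ) ^ M + (T : ℝ) ^ g₁ * pathLength y T with hX
  have hPL := pathLength_nonneg y T
  have hY0 : 0 ≤ (T : ℝ) ^ g₁ * pathLength y T := by positivity
  have hX0 : 0 ≤ X := by positivity
  have hmono := integral_mono (h.integrable_netReg hu T y)
    (((hgapi).const_mul (1 / (n : ℝ))).add (integrable_const
      (∑ t ∈ Finset.Icc 1 T, F₂ * (r * (t : ℝ) ^ (-g₃) + CΔ * (t : ℝ) ^ (-(g₁ - g₂ - g₃))))))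
    (fun a => (h a).netReg_le hn (hΔ a) T y)
  simp only [Pi.add_apply] at hmono
  rw [integral_add ((hgapi).const_mul _) (integrable_const _), integral_const_mul,
    integral_const, probReal_univ, one_smul] at hmono
  have hn1 : 1 / (n : ℝ) ≤ 1 := by
    rw [div_le_one (by exact_mod_cast hn)]; exact_mod_cast hn
  have hgn : 1 / (n : ℝ) * ∫ a, ∑ t ∈ Finset.Icc 1 T, ∑ i,
      P.penalizedGap i t ((S a).q t i) ((S a).e t i) (y t) ∂Pr ≤ C₀ * X :=
    (mul_le_mul_of_nonneg_left hgap (by positivity)).trans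
      (mul_le_of_le_one_left (by positivity) hn1)
  have h1 : E₁ * (T : ℝ) ^ M ≤ E₁ * X := mul_le_mul_of_nonneg_left (by linarith) hE₁0
  linarith [hmono, hsum, hgn, h1]

/-- The expected constraint violation in terms of a bound on the expected penalized gap of a fixed
feasible point. -/
lemma integral_netCCV_le
    {n p : ℕ} {m : Fin n → ℕ} {r R F₁ F₂ w : ℝ} {B : ℕ} {g₁ g₂ g₃ : ℝ}
    {P : OnlineProblem n p m} {dl : Fin n → ℕ → Vec p → Vec p}
    {dc : (i : Fin n) → ℕ → Vec p → (Vec p →L[ℝ] Vec (m i))}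
    {G : ℕ → Digraph (Fin n)} {W : ℕ → Matrix (Fin n) (Fin n) ℝ} {e₁ : Fin n → Vec p}
    {Ω : Type*} {u : ℕ → Fin n → Ω → Metric.sphere (0 : Vec p) 1} {S : Ω → Trajectory n p m}
    [mΩ : MeasurableSpace Ω] {Pr : Measure Ω} [IsProbabilityMeasure Pr]
    (h : IsPolyRunFamily r R F₁ F₂ w B g₁ g₂ g₃ P dl dc G W e₁ u S)
    (hu : IsUniformSampling Pr u) (hn : 0 < n) {CΔ : ℝ} (hCΔ : 0 ≤ CΔ)
    (hΔ : ∀ a t, 1 ≤ t → ∀ i j,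
      ‖(S a).e t i - (S a).e t j‖ ≤ CΔ * (t : ℝ) ^ (-(g₁ - g₂ - g₃)))
    {T : ℕ} (hT : 1 ≤ T) {C₀ : ℝ} (hC₀ : 0 ≤ C₀)
    {y₀ : Vec p} (hy₀ : P.IsFeasible T fun _ => y₀)
    (hgap : ∫ a, ∑ t ∈ Finset.Icc 1 T, ∑ i,
        P.penalizedGap i t ((S a).q t i) ((S a).e t i) y₀ ∂Pr
      ≤ C₀ * (T : ℝ) ^ max (1 - g₁ + 2 * g₂ + 2 * g₃) (1 + g₂ - g₃)) :
    ∫ a, P.netCCV (S a).x T ∂Pr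
      ≤ (C₀ + ((1 + 1 / (1 + -g₂)) * ∑ i, (m i : ℝ)
          + n * (2 * F₁ + F₁ * F₂ * r + 2 * F₁ ^ 2)
          + n * (2 * F₂) * (2 * r * (1 / (1 + -g₃)) + CΔ * (1 / (1 + -(g₁ - g₂ - g₃))))))
        * (T : ℝ) ^ (1 - g₂ / 2) := by
  obtain ⟨a₀⟩ : Nonempty Ω := Pr.nonempty_of_neZero
  have hr := (h a₀).r_pos
  have hF₁ := (h a₀).F₁_pos
  have hF₂ := (h a₀).F₂_pos
  have hg₁ := (h a₀).g₁_mem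
  have hg₂ := (h a₀).g₂_mem
  have hg₃ := (h a₀).g₃_mem
  have hg₃0 := (h a₀).g₃_pos
  have hg₃1 := (h a₀).g₃_lt_one
  have hT1 : (1 : ℝ) ≤ T := by exact_mod_cast hT
  have hTp : (0 : ℝ) < T := by linarith
  have hg₂1 : g₂ < 1 := hg₃.1.trans hg₃1
  have hσ0 : 0 < g₁ - g₂ - g₃ := by linarith [hg₁.1, hg₂.2, hg₃.2]
  have hσ1 : g₁ - g₂ - g₃ < 1 := by linarith [hg₁.2, hg₂.1, hg₃.1]
  set M := max (1 - g₁ + 2 * g₂ + 2 * g₃) (1 + g₂ - g₃) with hM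
  set Sm := ∑ i, (m i : ℝ) with hSm
  set Q₃ := 1 / (1 + -g₂) with hQ₃
  set Q₄ := 1 / (1 + -g₃) with hQ₄
  set Q₅ := 1 / (1 + -(g₁ - g₂ - g₃)) with hQ₅
  set E₂ := (1 + Q₃) * Sm + n * (2 * F₁ + F₁ * F₂ * r + 2 * F₁ ^ 2)
    + n * (2 * F₂) * (2 * r * Q₄ + CΔ * Q₅) with hE₂
  have hgapi : Integrable (fun a => ∑ t ∈ Finset.Icc 1 T, ∑ i,
      P.penalizedGap i t ((S a).q t i) ((S a).e t i) y₀) Pr :=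
    integrable_finsetSum _ fun t ht => integrable_finsetSum _ fun i _ =>
      integrable_penalizedGap h hu (Finset.mem_Icc.1 ht).1 i y₀
  -- This multiplier balances `V² T^(1-g₂)` with `T`. All terms are then of order `V U = T`, and
  -- dividing by `V` leaves `U`.
  set V := (T : ℝ) ^ (g₂ / 2) with hV
  set U := (T : ℝ) ^ (1 - g₂ / 2) with hU
  have hV0 : 0 < V := by positivity
  have hU0 : 0 < U := by positivity
  have hVU : V * U = T := by
    rw [hV, hU, ← Real.rpow_add hTp]; simp
  have hVV : V ^ 2 * (T : ℝ) ^ (1 - g₂) = T := by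
    rw [hV, pow_two, ← Real.rpow_add hTp, ← Real.rpow_add hTp]
    ring_nf
    exact Real.rpow_one _
  have s₃ : 1 + ∑ t ∈ Finset.Icc 1 T, (t : ℝ) ^ (-g₂) ≤ (1 + Q₃) * (T : ℝ) ^ (1 - g₂) := by
    have h1 := sum_rpow_le_mul_rpow (a := -g₂) (b := 1 - g₂) (by linarith)
      (by linarith [hg₂.1]) (by linarith) hT
    have h2 : 1 ≤ (T : ℝ) ^ (1 - g₂) := Real.one_le_rpow hT1 (by linarith)
    linarith
  have s₄ : ∑ t ∈ Finset.Icc 1 T, (t : ℝ) ^ (-g₃) ≤ Q₄ * U :=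
    sum_rpow_le_mul_rpow (by linarith) (by linarith) (by linarith [hg₃.1, hg₂.1]) hT
  have s₅ : ∑ t ∈ Finset.Icc 1 T, (t : ℝ) ^ (-(g₁ - g₂ - g₃)) ≤ Q₅ * U :=
    sum_rpow_le_mul_rpow (by linarith) (by linarith)
      (by linarith [hg₃.2, hg₂.1, hg₂.2]) hT
  have hSm0 : 0 ≤ Sm := by positivity
  have hpath : ∀ a, V * P.netCCV (S a).x T
      ≤ ∑ t ∈ Finset.Icc 1 T, ∑ i, P.penalizedGap i t ((S a).q t i) ((S a).e t i) y₀
        + E₂ * (V * U) := by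
    intro a
    have h1 := mul_le_mul_of_nonneg_left ((h a).netCCV_le hn (hΔ a) T) hV0.le
    have h2 := (h a).mul_sum_norm_con_le hV0.le hy₀
    have h3 : (1 + ∑ t ∈ Finset.Icc 1 T, (t : ℝ) ^ (-g₂)) * (Sm * V ^ 2)
        ≤ (1 + Q₃) * Sm * (V * U) := by
      refine (mul_le_mul_of_nonneg_right s₃ (by positivity)).trans (le_of_eq ?_)
      rw [hVU, show (1 + Q₃) * (T : ℝ) ^ (1 - g₂) * (Sm * V ^ 2)
        = (1 + Q₃) * Sm * (V ^ 2 * (T : ℝ) ^ (1 - g₂)) by ring, hVV]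
    have h4 : V * (n * (2 * F₂) * ∑ t ∈ Finset.Icc 1 T,
        (2 * r * (t : ℝ) ^ (-g₃) + CΔ * (t : ℝ) ^ (-(g₁ - g₂ - g₃))))
        ≤ n * (2 * F₂) * (2 * r * Q₄ + CΔ * Q₅) * (V * U) := by
      have h5 : ∑ t ∈ Finset.Icc 1 T,
          (2 * r * (t : ℝ) ^ (-g₃) + CΔ * (t : ℝ) ^ (-(g₁ - g₂ - g₃)))
          ≤ (2 * r * Q₄ + CΔ * Q₅) * U := by
        rw [Finset.sum_add_distrib, ← Finset.mul_sum, ← Finset.mul_sum]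
        have h6 := mul_le_mul_of_nonneg_left s₄ (by positivity : 0 ≤ 2 * r)
        have h7 := mul_le_mul_of_nonneg_left s₅ hCΔ
        linarith
      have h8 := mul_le_mul_of_nonneg_left h5 (by positivity : 0 ≤ V * (n * (2 * F₂)))
      linarith
    rw [← hSm, ← hVU] at h2
    rw [hE₂]
    linarith
  have hmono := integral_mono ((h.integrable_netCCV hu T).const_mul V)
    (hgapi.add (integrable_const (E₂ * (V * U)))) hpath
  simp only [Pi.add_apply] at hmono
  rw [integral_add hgapi (integrable_const _), integral_const_mul,
    integral_const, probReal_univ, one_smul] at hmono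
  -- Both exponents in `M` are below `1`, by `2 g₂ + 2 g₃ < g₁` and `g₂ < g₃`.
  have hMT : (T : ℝ) ^ M ≤ V * U := by
    rw [hVU]
    have := Real.rpow_le_rpow_of_exponent_le hT1
      (max_le (by linarith [hg₃.2]) (by linarith [hg₃.1]) : M ≤ 1)
    rwa [Real.rpow_one] at this
  have h1 := mul_le_mul_of_nonneg_left hMT hC₀
  have h3 : V * ∫ a, P.netCCV (S a).x T ∂Pr ≤ V * ((C₀ + E₂) * U) := by
    linarith [hmono, hgap, h1]
  exact le_of_mul_le_mul_left h3 hV0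

end IsPolyRunFamily

/-! ### The uniform constant and the conclusion -/

theorem theorem2 (n p : ℕ) (m : Fin n → ℕ) (hn : 0 < n) (hp : 0 < p)
    (r R F₁ F₂ w μ : ℝ) (B : ℕ)
    (hr : 0 < r) (hF₁ : 0 < F₁) (hF₂ : 0 < F₂) (hw : w ∈ Set.Ioo (0 : ℝ) 1) (hB : 0 < B)
    (hμ : 0 < μ)
    (g₁ g₂ g₃ : ℝ) (hg₁ : g₁ ∈ Set.Ioo (0 : ℝ) 1) (hg₂ : g₂ ∈ Set.Ioo (0 : ℝ) (g₁ / 4))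
    (hg₃ : g₃ ∈ Set.Ioo g₂ ((g₁ - 2 * g₂) / 2)) :
    ∃ C : ℝ, 0 < C ∧
      ∀ (P : OnlineProblem n p m)
        (dl : Fin n → ℕ → Vec p → Vec p)
        (dc : (i : Fin n) → ℕ → Vec p → (Vec p →L[ℝ] Vec (m i)))
        (G : ℕ → Digraph (Fin n)) (W : ℕ → Matrix (Fin n) (Fin n) ℝ)
        (Ω : Type*) (_ : MeasurableSpace Ω) (Pr : Measure Ω) (_ : IsProbabilityMeasure Pr)
        (u : ℕ → Fin n → Ω → Metric.sphere (0 : Vec p) 1)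
        (e₁ : Fin n → Vec p) (S : Ω → Trajectory n p m),
        P.IsRegular r R F₁ F₂ dl dc →
        P.LossStronglyConvex μ dl →
        IsMixingNetwork G W w B →
        IsUniformSampling Pr u →
        (∀ a, IsRun P W
          (fun t => r ^ 2 / (20 * (p : ℝ) ^ 2 * F₁ ^ 2 * ((t : ℝ) + 1) ^ g₁))
          (fun t => 2 / (t : ℝ) ^ g₂)
          (fun t => 1 / (t : ℝ) ^ (1 - g₂))
          (fun t => 1 / ((t : ℝ) + 1) ^ g₃)
          (fun t => r / ((t : ℝ) + 1) ^ g₃)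
          e₁ (fun t i => (u t i a : Vec p)) (S a)) →
        ∀ T : ℕ, 1 ≤ T →
          (∀ y : ℕ → Vec p, P.IsFeasible T y →
            Integrable (fun a => P.netReg (S a).x y T) Pr ∧
            ∫ a, P.netReg (S a).x y T ∂Pr ≤
              C * ((T : ℝ) ^ max (1 - g₁ + 2 * g₂ + 2 * g₃) (1 + g₂ - g₃)
                + (T : ℝ) ^ g₁ * pathLength y T)) ∧
          (Integrable (fun a => P.netCCV (S a).x T) Pr ∧
            ((∃ y₀ : Vec p, P.IsFeasible T (fun _ => y₀)) →
              ∫ a, P.netCCV (S a).x T ∂Pr ≤ C * (T : ℝ) ^ (1 - g₂ / 2))) := by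
  -- The sign of `R` is not assumed; for `R < 0` no problem is regular, because `0 ∈ X`.
  by_cases hR : 0 ≤ R
  swap
  · refine ⟨1, one_pos, ?_⟩
    intro P dl dc G W Ω _ Pr _ u e₁ S hreg
    exact absurd (hreg.R_nonneg hr) hR
  have hg₃0 : 0 < g₃ := hg₂.1.trans hg₃.1
  have hσ0 : 0 < g₁ - g₂ - g₃ := by linarith [hg₁.1, hg₂.2, hg₃.2]
  have hσ1 : g₁ - g₂ - g₃ < 1 := by linarith [hg₁.2, hg₂.1]
  have hg₃1 : g₃ < 1 := by linarith [hg₁.2, hg₂.1, hg₃.2]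
  have hg₂1 : g₂ < 1 := hg₃.1.trans hg₃1
  -- The disagreement and weight-growth constants are fixed before the problem, the network and the
  -- probability space, so the final constant is uniform in them.
  obtain ⟨CΔ, hCΔ, hdis⟩ := exists_disagreement_bound (w := w) (Vec p) hn hB hw
    (σ := g₁ - g₂ - g₃) ⟨hσ0.le, hσ1.le⟩
    (b := r ^ 2 / (20 * (p : ℝ) ^ 2 * F₁ ^ 2) * (2 * p / r * (F₁ + F₁ ^ 2))) (by positivity) hR
  set A := 10 * (p : ℝ) ^ 2 * F₁ ^ 2 / r ^ 2 with hA
  obtain ⟨K, hK, hK'⟩ := exists_rpow_neg_sub_le (A := A) (μ := μ / 2) (a := 1 - g₁)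
    (by positivity) (by positivity) (by linarith [hg₁.2])
  set C₀ := n * (16 * A * R ^ 2 + 4 * R ^ 2 * K) * (1 / (1 + (g₂ - g₃))) + n * (12 * A * R)
          + n * (2 * p / r * (F₁ + F₁ ^ 2)
          * (r ^ 2 / (20 * (p : ℝ) ^ 2 * F₁ ^ 2) * (2 * p / r * (F₁ + F₁ ^ 2)) + CΔ))
            * (1 / (1 + (-g₁ + 2 * g₂ + 2 * g₃)))
          + n * ((2 * r + R) * (F₂ * (1 + F₁))) * (1 / (1 + (g₂ - g₃))) with hC₀
  set E₁ := F₂ * (r * (1 / (1 + (g₂ - g₃))) + CΔ * (1 / (1 + (-g₁ + 2 * g₂ + 2 * g₃)))) with hE₁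
  set E₂ := (1 + 1 / (1 + -g₂)) * ∑ i, (m i : ℝ)
          + n * (2 * F₁ + F₁ * F₂ * r + 2 * F₁ ^ 2)
          + n * (2 * F₂) * (2 * r * (1 / (1 + -g₃)) + CΔ * (1 / (1 + -(g₁ - g₂ - g₃)))) with hE₂
  have hQ₁ : 0 ≤ 1 / (1 + (g₂ - g₃)) := one_div_nonneg.2 (by linarith [hg₂.1])
  have hQ₂ : 0 ≤ 1 / (1 + (-g₁ + 2 * g₂ + 2 * g₃)) :=
    one_div_nonneg.2 (by linarith [hg₁.2, hg₂.1, hg₃.1])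
  have hQ₃ : 0 ≤ 1 / (1 + -g₂) := one_div_nonneg.2 (by linarith)
  have hQ₄ : 0 ≤ 1 / (1 + -g₃) := one_div_nonneg.2 (by linarith)
  have hQ₅ : 0 ≤ 1 / (1 + -(g₁ - g₂ - g₃)) := one_div_nonneg.2 (by linarith)
  have hC₀0 : 0 ≤ C₀ := by positivity
  have hE₁0 : 0 ≤ E₁ := by positivity
  have hE₂0 : 0 ≤ E₂ := by positivity
  refine ⟨C₀ + E₁ + E₂ + 1, by positivity, ?_⟩
  intro P dl dc G W Ω _ Pr _ u e₁ S hreg hstr hmix hu hrun T hT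
  have h : IsPolyRunFamily r R F₁ F₂ w B g₁ g₂ g₃ P dl dc G W e₁ u S := fun a =>
    { p_pos := hp
      r_pos := hr
      F₁_pos := hF₁
      F₂_pos := hF₂
      g₁_mem := hg₁
      g₂_mem := hg₂
      g₃_mem := hg₃
      regular := hreg
      mixing := hmix
      unit := fun t i => by simp
      run := hrun a }
  have hΔ : ∀ a t, 1 ≤ t → ∀ i j,
      ‖(S a).e t i - (S a).e t j‖ ≤ CΔ * (t : ℝ) ^ (-(g₁ - g₂ - g₃)) := fun a =>
    hdis G W (S a).e hmix (fun t ht i => (h a).norm_e_le ht i)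
      (fun t ht i => (h a).norm_e_sub_sum_le_rpow ht i)
  have hgap := fun (y : ℕ → Vec p) (hy : P.IsFeasible T y) =>
    h.integral_penalizedGap_le hu hμ.le hstr hCΔ.le hΔ hA hK hK' hT hy
  refine ⟨fun y hy => ⟨h.integrable_netReg hu T y, ?_⟩, h.integrable_netCCV hu T, ?_⟩
  · refine (h.integral_netReg_le hu hn hCΔ.le hΔ hT hC₀0 y (hgap y hy)).trans ?_
    have hPL := pathLength_nonneg y T
    exact mul_le_mul_of_nonneg_right (by linarith) (by positivity)
  · rintro ⟨y₀, hy₀⟩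
    have hb := hgap (fun _ => y₀) hy₀
    rw [pathLength_const, mul_zero, add_zero] at hb
    refine (h.integral_netCCV_le hu hn hCΔ.le hΔ hT hC₀0 hy₀ hb).trans ?_
    exact mul_le_mul_of_nonneg_right (by linarith) (by positivity)
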